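/- Fix $n\in\mathbb N$, $s\in[1/2,1)$, $C_0\in\mathbb R$ and $M\ge 0$. There is a modulus of continuity $\omega$ (a nondecreasing function $\omega:[0,\infty)\to[0,\infty)$ with $\omega(r)\to\omega(0)=0$ as $r\to 0$), depending only on $n,s,C_0,M$, with the following property. Let $T>0$ and let $u_0,\psi:\mathbb R^n\to\mathbb R$ be globally Lipschitz functions with $u_0\ge\psi$. Assume that both are $C_0$-semiconvex (that is, $u_0+C_0|x|^2/2$ and $\psi+C_0|x|^2/2$ are convex) and that $$\|(-\Delta)^su_0\|_{L^\infty(\mathbb R^n)}+\|(-\Delta)^s\psi\|_{L^\infty(\mathbb R^n)}\le M,$$ where $(-\Delta)^sf(x)=\lim_{\varepsilon\to0^+}\int_{|x'-x|\ge\varepsilon}\frac{f(x)-f(x')}{|x'-x|^{n+2s}}\,dx'$ (these truncated integrals being required to converge absolutely, and the limit to exist, for a.e. $x$). Let $u:[0,T]\times\mathbb R^n\to\mathbb R$ be a continuous viscosity solution, in the class $C\big([0,T];L^1(\mathbb R^n,(1+|x|)^{-n-2s}dx)\big)$, of $$\min\{u_t+(-\Delta)^su,\;u-\psi\}=0\ \text{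 on }[0,T]\times\mathbb R^n,\qquad u(0)=u_0\ \text{ on }\mathbb R^n.$$ Then $u(t)\in C^1(\mathbb R^n)$ for every $t\in[0,T]$, and $$|\nabla u(t,x)-\nabla u(t,y)|\le\omega(|x-y|)\qquad\forall\,t\in[0,T],\ x,y\in\mathbb R^n.$$ -/

import Mathlib

open Set Filter Topology MeasureTheory
open scoped NNReal ENNReal

noncomputable section

namespace FracObstacle

/-- The space `ℝⁿ` with its Euclidean norm. -/
abbrev E (n : ℕ) : Type := EuclideanSpace ℝ (Fin n)

/-- The integrand `(f(x) - f(x')) / |x' - x|^(n+2s)` of the fractional Laplacian at `x`. -/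
def fracKernel {n : ℕ} (s : ℝ) (f : E n → ℝ) (x x' : E n) : ℝ :=
  (f x - f x') / ‖x' - x‖ ^ ((n : ℝ) + 2 * s)

/-- `(-Δ)^s f (x)` exists as a principal value and equals `L`:
the integrals of `fracKernel s f x` over the complements of the balls `B_ε(x)` converge absolutely,
and they tend to `L` as `ε → 0⁺`. The multiplicative constant of the operator is normalized to `1`. -/
def HasFracLapAt {n : ℕ} (s : ℝ) (f : E n → ℝ) (x : E n) (L : ℝ) : Prop :=
  (∀ ε : ℝ, 0 < ε → IntegrableOn (fracKernel s f x) (Metric.ball x ε)ᶜ) ∧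
    Tendsto (fun ε : ℝ => ∫ x' in (Metric.ball x ε)ᶜ, fracKernel s f x x') (𝓝[>] 0) (𝓝 L)

/-- The norm `‖(-Δ)^s f‖_{L^∞(ℝⁿ)}`: the least `A` such that, for almost every `x`, `(-Δ)^s f (x)`
exists and has absolute value at most `A` (and `∞` if there is no such finite `A`). -/
def fracLapNorm {n : ℕ} (s : ℝ) (f : E n → ℝ) : ℝ≥0∞ :=
  sInf {A : ℝ≥0∞ | ∀ᵐ x : E n, ∃ L : ℝ, HasFracLapAt s f x L ∧ ‖L‖ₑ ≤ A}

/-- `w` is `C`-semiconvex: `w + C|x|²/2` is convex. -/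
def Semiconvex {n : ℕ} (C : ℝ) (w : E n → ℝ) : Prop :=
  ConvexOn ℝ univ fun x => w x + C * ‖x‖ ^ 2 / 2

/-- The function equal to `φ` in the ball `B_r(x₀)` and to `w` outside of it. -/
def patch {n : ℕ} (x₀ : E n) (r : ℝ) (φ w : E n → ℝ) : E n → ℝ := by
  classical exact fun x => if x ∈ Metric.ball x₀ r then φ x else w x

/-- The `C²` function `φ` touches `u` from above at `(t₀, x₀)`, within the part of
`(t₀ - r, t₀ + r) × B_r(x₀)` that lies in `[0,T] × ℝⁿ`. -/
def TouchesFromAbove {n : ℕ} (T : ℝ) (u φ : ℝ → E n → ℝ) (t₀ : ℝ) (x₀ : E n) (r : ℝ) : Prop :=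
  ContDiff ℝ 2 (fun p : ℝ × E n => φ p.1 p.2) ∧ φ t₀ x₀ = u t₀ x₀ ∧
    ∀ t ∈ Icc 0 T, |t - t₀| < r → ∀ x ∈ Metric.ball x₀ r, u t x ≤ φ t x

/-- The `C²` function `φ` touches `u` from below at `(t₀, x₀)`, within the part of
`(t₀ - r, t₀ + r) × B_r(x₀)` that lies in `[0,T] × ℝⁿ`. -/
def TouchesFromBelow {n : ℕ} (T : ℝ) (u φ : ℝ → E n → ℝ) (t₀ : ℝ) (x₀ : E n) (r : ℝ) : Prop :=
  ContDiff ℝ 2 (fun p : ℝ × E n => φ p.1 p.2) ∧ φ t₀ x₀ = u t₀ x₀ ∧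
    ∀ t ∈ Icc 0 T, |t - t₀| < r → ∀ x ∈ Metric.ball x₀ r, φ t x ≤ u t x

/-- Viscosity subsolution of `min {u_t + (-Δ)^s u, u - ψ} = 0`. As usual for nonlocal operators,
`(-Δ)^s` is evaluated on the test function near the contact point and on `u` away from it.
(If `u(t₀)` is continuous and integrable against `(1+|x|)^(-n-2s)`, then the fractional Laplacian
of the patched function exists at `x₀`, so that there is exactly one `L` below.) -/
def IsViscositySubsolution {n : ℕ} (s T : ℝ) (ψ : E n → ℝ) (u : ℝ → E n → ℝ) : Prop :=
  ∀ t₀ ∈ Ioo 0 T, ∀ (x₀ : E n) (r : ℝ), 0 < r → ∀ φ : ℝ → E n → ℝ,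
    TouchesFromAbove T u φ t₀ x₀ r →
      ∀ L : ℝ, HasFracLapAt s (patch x₀ r (φ t₀) (u t₀)) x₀ L →
        min (deriv (fun t => φ t x₀) t₀ + L) (u t₀ x₀ - ψ x₀) ≤ 0

/-- Viscosity supersolution of `min {u_t + (-Δ)^s u, u - ψ} = 0`. -/
def IsViscositySupersolution {n : ℕ} (s T : ℝ) (ψ : E n → ℝ) (u : ℝ → E n → ℝ) : Prop :=
  ∀ t₀ ∈ Ioo 0 T, ∀ (x₀ : E n) (r : ℝ), 0 < r → ∀ φ : ℝ → E n → ℝ,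
    TouchesFromBelow T u φ t₀ x₀ r →
      ∀ L : ℝ, HasFracLapAt s (patch x₀ r (φ t₀) (u t₀)) x₀ L →
        0 ≤ min (deriv (fun t => φ t x₀) t₀ + L) (u t₀ x₀ - ψ x₀)

/-- `u : [0,T] × ℝⁿ → ℝ` is a (continuous) viscosity solution of the obstacle problem
`min {u_t + (-Δ)^s u, u - ψ} = 0` on `[0,T] × ℝⁿ` with `u(0) = u₀`.
The fractional Laplacian of `u(t)` needs `u(t)` to lie in the space `L¹_s` of the functions
integrable against `(1+|x|)^(-n-2s)`; `u` is taken in the usual class `C([0,T]; L¹_s)`. -/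
structure IsObstacleSolution {n : ℕ} (s T : ℝ) (u₀ ψ : E n → ℝ) (u : ℝ → E n → ℝ) : Prop where
  continuousOn : ContinuousOn (fun p : ℝ × E n => u p.1 p.2) (Icc 0 T ×ˢ univ)
  integrable : ∀ t ∈ Icc 0 T,
    Integrable fun x : E n => |u t x| / (1 + ‖x‖) ^ ((n : ℝ) + 2 * s)
  tendsto_weighted : ∀ t₀ ∈ Icc 0 T,
    Tendsto (fun t => ∫ x : E n, |u t x - u t₀ x| / (1 + ‖x‖) ^ ((n : ℝ) + 2 * s))
      (𝓝[Icc 0 T] t₀) (𝓝 0)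
  initial : ∀ x, u 0 x = u₀ x
  subsolution : IsViscositySubsolution s T ψ u
  supersolution : IsViscositySupersolution s T ψ u

end FracObstacle

end

/-!
The gradient of `u(t)` has a modulus of continuity as soon as `u(t)` is semiconvex and its fractional
Laplacian is bounded below in the following weak sense: the integrals of
`(u(t, x + ξ) - u(t, x)) |ξ|^(-n-2s)` over the annuli `r ≤ |ξ| < 1` are bounded above, uniformly in `x`
and `r` (`FracObstacle.exists_modulus`). Indeed, if two subgradients at nearby points differ by
`κ e`, with `|e| = 1`, then convexity makes each dyadic shell between the distance of the points and `1`
contribute at least a fixed multiple of `κ`, and this is where `2s ≥ 1` enters; the number of these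
shells grows like the logarithm of the inverse distance, so that `κ` has to be small. Everything else consists in
proving the two hypotheses with constants that do not depend on `T`, `u` or the Lipschitz constants.

Both hypotheses follow from a comparison principle. A viscosity subsolution which lies below a convex
combination of finitely many supersolutions at the initial time lies below it at all times, provided
that the same inequality holds for the obstacles (`FracObstacle.comparison`). It is proved by doubling
variables, with one copy of the variables for each supersolution, and with a barrier that blows up on a
large sphere, because nothing is known about the functions at infinity beyond the uniform smallness of
their tails in the weighted `L¹` space. As translates of a solution are solutions of translated
problems, an inequality between a function and averages of its translates passes from `u₀` and `ψ` to
`u(t)` (`IsObstacleSolution.le_sum_shift`). This applies to Lipschitz bounds and to semiconvexity; by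
quadrature, it also applies to upper bounds for the part of the operator that comes from an annulus
`1 ≤ |ξ| < R` (`IsObstacleSolution.trunc_one_sub_trunc_le`), whence an upper bound for the operator
truncated at radius `1`. Comparison with `u₀ + D t` and with time translates shows that `u - D t` is
nonincreasing in time (`IsObstacleSolution.le_add_time`). Since `u(t)` is semiconvex, it can then be
touched from below by paraboloids with slope at most `D` in time, and the supersolution property bounds
the operator truncated at any radius from below (`IsObstacleSolution.le_trunc`).

The constant `D` is a bound for the operators truncated at any radius, applied to `u₀` and `ψ`, in
terms of the `L^∞` norm of their fractional Laplacians (`FracObstacle.exists_abs_trunc_le`). Thanks to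
semiconvexity, the truncated operators of a mollification `f` of the datum converge as the radius
shrinks, to a function bounded by the same norm. The maximum principle `FracObstacle.le_of_conv_le`
bounds the second differences of an average of `f` at scale `R` by those of its average at scale `2R`;
summing over the dyadic scales above `R`, where the contribution of the Lipschitz constant disappears in
the limit, shows that they are of size `R^(2s-2) |h|²`. It follows that `f` differs by a quantity of size
`R^(2s)` from its average at scale `R`, and this average has a bounded truncated operator at radius `R`.

In dimension `0` there is nothing to prove.
-/

namespace FracObstacle

/-! ### The kernel of the fractional Laplacian and its truncations -/

/-- The kernel `|ξ|^(-n-2s)` of the fractional Laplacian. -/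
noncomputable def jumpKernel {n : ℕ} (s : ℝ) (ξ : E n) : ℝ := (‖ξ‖ ^ ((n : ℝ) + 2 * s))⁻¹

/-- The second moment `∫_{B₁} |ξ|² |ξ|^(-n-2s) dξ`. -/
noncomputable def innerMoment (n : ℕ) (s : ℝ) : ℝ :=
  ∫ ξ in Metric.ball (0 : E n) 1, ‖ξ‖ ^ 2 * jumpKernel s ξ

/-- The mass `∫_{|ξ| ≥ 1} |ξ|^(-n-2s) dξ`. -/
noncomputable def outerMass (n : ℕ) (s : ℝ) : ℝ :=
  ∫ ξ in (Metric.ball (0 : E n) 1)ᶜ, jumpKernel s ξ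

/-- The truncated operator `∫_{|ξ| ≥ r} (f(x) - f(x+ξ)) |ξ|^(-n-2s) dξ`. -/
noncomputable def trunc {n : ℕ} (s r : ℝ) (f : E n → ℝ) (x : E n) : ℝ :=
  ∫ ξ in (Metric.ball (0 : E n) r)ᶜ, (f x - f (x + ξ)) * jumpKernel s ξ

/-- Integrability of `f` against the weight `(1+|x|)^(-n-2s)`. -/
def WeightedIntegrable {n : ℕ} (s : ℝ) (f : E n → ℝ) : Prop :=
  Integrable fun x : E n => |f x| / (1 + ‖x‖) ^ ((n : ℝ) + 2 * s)

variable {n : ℕ} {s : ℝ}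

lemma jumpKernel_nonneg (ξ : E n) : 0 ≤ jumpKernel s ξ := by
  unfold jumpKernel; positivity

lemma jumpKernel_pos {ξ : E n} (h : ξ ≠ 0) : 0 < jumpKernel s ξ := by
  unfold jumpKernel
  have := norm_pos_iff.2 h
  positivity

lemma measurable_jumpKernel : Measurable (jumpKernel s : E n → ℝ) := by
  unfold jumpKernel
  fun_prop

lemma jumpKernel_neg (ξ : E n) : jumpKernel s (-ξ) = jumpKernel s ξ := by
  simp [jumpKernel]

lemma jumpKernel_smul {r : ℝ} (hr : 0 < r) (ξ : E n) :
    jumpKernel s (r • ξ) = r ^ (-((n : ℝ) + 2 * s)) * jumpKernel s ξ := by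
  unfold jumpKernel
  rw [norm_smul, Real.norm_of_nonneg hr.le, Real.mul_rpow hr.le (norm_nonneg _), mul_inv,
    Real.rpow_neg hr.le]

/-- Comparison of the kernel with the weights `(R+|·|)^(-n-2s)`. -/
lemma jumpKernel_le_weight (hs : 0 < s) {R C : ℝ} (hR : 0 < R) (hC : 0 ≤ C) {x ξ : E n}
    (h : R + ‖x‖ ≤ C * ‖ξ‖) :
    jumpKernel s ξ ≤ C ^ ((n : ℝ) + 2 * s) * ((R + ‖x‖) ^ ((n : ℝ) + 2 * s))⁻¹ := by
  have h1 : 0 < R + ‖x‖ := by positivity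
  have hξ : 0 < ‖ξ‖ := by
    by_contra hξ
    have : ‖ξ‖ = 0 := le_antisymm (not_lt.1 hξ) (norm_nonneg _)
    rw [this] at h; linarith
  have hp : 0 ≤ (n : ℝ) + 2 * s := by positivity
  unfold jumpKernel
  rw [← div_eq_mul_inv, le_div_iff₀ (by positivity), inv_mul_le_iff₀ (by positivity),
    mul_comm (_ ^ _), ← Real.mul_rpow hC hξ.le]
  exact Real.rpow_le_rpow h1.le h hp

lemma integrable_inv_weight (hs : 0 < s) {R : ℝ} (hR : 0 < R) :
    Integrable fun x : E n => ((R + ‖x‖) ^ ((n : ℝ) + 2 * s))⁻¹ := by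
  have h1 : Integrable fun x : E n => (1 + ‖x‖) ^ (-((n : ℝ) + 2 * s)) := by
    apply integrable_one_add_norm
    simp; positivity
  have hC : 0 ≤ max 1 (1 / R) := by positivity
  refine (h1.const_mul ((max 1 (1 / R)) ^ ((n : ℝ) + 2 * s))).mono'
    (by apply Measurable.aestronglyMeasurable; fun_prop) (.of_forall fun x => ?_)
  have hx := norm_nonneg x
  rw [Real.norm_of_nonneg (by positivity), Real.rpow_neg (by positivity),
    ← div_eq_mul_inv, le_div_iff₀ (by positivity), inv_mul_le_iff₀ (by positivity),
    mul_comm (_ ^ _), ← Real.mul_rpow hC (by positivity)]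
  refine Real.rpow_le_rpow (by positivity) ?_ (by positivity)
  have e1 : (1 : ℝ) ≤ max 1 (1 / R) * R := by
    calc (1 : ℝ) = 1 / R * R := by field_simp
      _ ≤ _ := by gcongr; exact le_max_right _ _
  nlinarith [le_max_left 1 (1 / R)]

lemma one_add_norm_le {r : ℝ} (hr : 0 < r) (x : E n) {ξ : E n} (h : ξ ∈ (Metric.ball (0 : E n) r)ᶜ) :
    1 + ‖x + ξ‖ ≤ ((1 + ‖x‖) / r + 1) * ‖ξ‖ := by
  have h' : r ≤ ‖ξ‖ := by simpa using h
  have h1 := norm_add_le x ξ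
  have : 1 + ‖x‖ ≤ (1 + ‖x‖) / r * ‖ξ‖ := by
    rw [div_mul_eq_mul_div, le_div_iff₀ hr]; gcongr
  linarith

lemma integrableOn_jumpKernel (hs : 0 < s) {r : ℝ} (hr : 0 < r) :
    IntegrableOn (jumpKernel s : E n → ℝ) (Metric.ball (0 : E n) r)ᶜ := by
  have h := ((integrable_inv_weight (n := n) hs one_pos).const_mul
    (((1 + ‖(0 : E n)‖) / r + 1) ^ ((n : ℝ) + 2 * s))).integrableOn (s := (Metric.ball (0 : E n) r)ᶜ)
  refine h.mono' measurable_jumpKernel.aestronglyMeasurable ?_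
  filter_upwards [self_mem_ae_restrict measurableSet_ball.compl] with ξ hξ
  rw [Real.norm_of_nonneg (jumpKernel_nonneg _)]
  have := one_add_norm_le hr (0 : E n) hξ
  rw [zero_add] at this
  exact jumpKernel_le_weight hs one_pos (by positivity) this

open scoped Pointwise in
lemma integral_jumpKernel_compl {r : ℝ} (hr : 0 < r) :
    ∫ ξ in (Metric.ball (0 : E n) r)ᶜ, jumpKernel s ξ = outerMass n s * r ^ (-(2 * s)) := by
  have h := Measure.setIntegral_comp_smul_of_pos (volume : Measure (E n)) (jumpKernel s)
    (Metric.ball (0 : E n) 1)ᶜ hr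
  have e : r • (Metric.ball (0 : E n) 1)ᶜ = (Metric.ball (0 : E n) r)ᶜ := by
    ext ξ
    rw [Set.mem_smul_set_iff_inv_smul_mem₀ hr.ne']
    simp [norm_smul, abs_of_pos hr, le_inv_mul_iff₀ hr]
  rw [e] at h
  simp only [jumpKernel_smul hr, integral_const_mul, finrank_euclideanSpace, Fintype.card_fin,
    smul_eq_mul] at h
  have : r ^ n * (r ^ n)⁻¹ = 1 := mul_inv_cancel₀ (by positivity)
  calc _ = r ^ n * ((r ^ n)⁻¹ * ∫ ξ in (Metric.ball (0 : E n) r)ᶜ, jumpKernel s ξ) := by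
        rw [← mul_assoc, this, one_mul]
    _ = _ := by
        rw [← h, outerMass, ← mul_assoc, ← Real.rpow_natCast, ← Real.rpow_add hr, mul_comm]
        congr 2; ring

open scoped Pointwise in
lemma integral_sq_jumpKernel_ball {r : ℝ} (hr : 0 < r) :
    ∫ ξ in Metric.ball (0 : E n) r, ‖ξ‖ ^ 2 * jumpKernel s ξ
      = innerMoment n s * r ^ (2 - 2 * s) := by
  have h := Measure.setIntegral_comp_smul_of_pos (volume : Measure (E n))
    (fun ξ => ‖ξ‖ ^ 2 * jumpKernel s ξ) (Metric.ball (0 : E n) 1) hr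
  have e : r • (Metric.ball (0 : E n) 1) = (Metric.ball (0 : E n) r) := by
    rw [smul_unitBall hr.ne', Real.norm_of_nonneg hr.le]
  rw [e] at h
  have e2 : ∀ ξ : E n, ‖r • ξ‖ ^ 2 * jumpKernel s (r • ξ)
      = (r ^ 2 * r ^ (-((n : ℝ) + 2 * s))) * (‖ξ‖ ^ 2 * jumpKernel s ξ) := by
    intro ξ
    rw [jumpKernel_smul hr, norm_smul, Real.norm_of_nonneg hr.le]; ring
  simp only [e2, integral_const_mul, finrank_euclideanSpace, Fintype.card_fin,
    smul_eq_mul] at h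
  have : r ^ n * (r ^ n)⁻¹ = 1 := mul_inv_cancel₀ (by positivity)
  calc _ = r ^ n * ((r ^ n)⁻¹ * ∫ ξ in Metric.ball (0 : E n) r, ‖ξ‖ ^ 2 * jumpKernel s ξ) := by
        rw [← mul_assoc, this, one_mul]
    _ = _ := by
        rw [← h, innerMoment, ← mul_assoc, ← Real.rpow_natCast, ← Real.rpow_natCast,
          ← Real.rpow_add hr, ← Real.rpow_add hr, mul_comm]
        congr 2; push_cast; ring

lemma innerMoment_nonneg : 0 ≤ innerMoment n s :=
  setIntegral_nonneg measurableSet_ball fun ξ _ => mul_nonneg (by positivity) (jumpKernel_nonneg _)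

lemma outerMass_pos (hn : 0 < n) (hs : 0 < s) : 0 < outerMass n s := by
  have : Nontrivial (E n) := by
    have : Nonempty (Fin n) := ⟨⟨0, hn⟩⟩
    infer_instance
  unfold outerMass
  rw [setIntegral_pos_iff_support_of_nonneg_ae (.of_forall fun ξ => jumpKernel_nonneg _)
    (integrableOn_jumpKernel hs one_pos)]
  obtain ⟨v, hv⟩ := exists_norm_eq (E n) (c := 3) (by norm_num)
  refine (Metric.measure_ball_pos volume v (r := 1) one_pos).trans_le (measure_mono fun x hx => ?_)
  have h1 : dist x v < 1 := hx
  rw [dist_eq_norm] at h1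
  have h2 : ‖v‖ ≤ ‖x‖ + ‖x - v‖ := by
    have := norm_sub_norm_le v x
    rw [norm_sub_rev] at this; linarith
  refine ⟨?_, by simp; linarith⟩
  have : x ≠ 0 := by rintro rfl; simp at h2 h1; linarith
  exact (jumpKernel_pos this).ne'

lemma sq_mul_jumpKernel (ξ : E n) (h : ξ ≠ 0) :
    ‖ξ‖ ^ 2 * jumpKernel s ξ = ‖ξ‖ ^ (-((n : ℝ) + 2 * s - 2)) := by
  have := norm_pos_iff.2 h
  rw [jumpKernel, ← Real.rpow_neg this.le, ← Real.rpow_natCast, ← Real.rpow_add this]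
  congr 1; push_cast; ring

lemma integrableOn_sq_jumpKernel (hn : 0 < n) (hs : s < 1) (r : ℝ) :
    IntegrableOn (fun ξ : E n => ‖ξ‖ ^ 2 * jumpKernel s ξ) (Metric.ball (0 : E n) r) := by
  apply integrableOn_ball_of_norm_le_rpow (C := 1) (α := (n : ℝ) + 2 * s - 2)
  · simp; linarith
  · have : ∀ᵐ ξ : E n, ξ ≠ 0 := by
      have : Nontrivial (E n) := by
        have : Nonempty (Fin n) := ⟨⟨0, hn⟩⟩
        infer_instance
      exact Measure.ae_ne _ _
    filter_upwards [ae_restrict_of_ae this] with ξ hξ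
    rw [Real.norm_of_nonneg (mul_nonneg (by positivity) (jumpKernel_nonneg _)),
      sq_mul_jumpKernel ξ hξ, one_mul]
  · exact ((continuous_norm.measurable.pow_const 2).mul measurable_jumpKernel).aestronglyMeasurable
  · simp; omega

/-! ### Truncated operators on weighted integrable functions -/

lemma WeightedIntegrable.integrable_div (hs : 0 < s) {f : E n → ℝ} (hf : WeightedIntegrable s f)
    {R : ℝ} (hR : 1 ≤ R) (hm : AEStronglyMeasurable f) :
    Integrable fun x : E n => |f x| / (R + ‖x‖) ^ ((n : ℝ) + 2 * s) := by
  refine hf.mono' ?_ (.of_forall fun x => ?_)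
  · refine (hm.norm).mul (Measurable.aestronglyMeasurable ?_)
    fun_prop
  · rw [Real.norm_of_nonneg (by positivity)]
    gcongr

lemma WeightedIntegrable.integrableOn_shift (hs : 0 < s) {f : E n → ℝ} (hf : WeightedIntegrable s f)
    (hc : Continuous f) (x : E n) {r : ℝ} (hr : 0 < r) :
    IntegrableOn (fun ξ => f (x + ξ) * jumpKernel s ξ) (Metric.ball (0 : E n) r)ᶜ := by
  have h := ((hf.comp_add_left x).const_mul
    (((1 + ‖x‖) / r + 1) ^ ((n : ℝ) + 2 * s))).integrableOn (s := (Metric.ball (0 : E n) r)ᶜ)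
  refine h.mono' ((hc.comp (continuous_const.add continuous_id)).measurable.mul
    measurable_jumpKernel).aestronglyMeasurable ?_
  filter_upwards [self_mem_ae_restrict measurableSet_ball.compl] with ξ hξ
  rw [norm_mul, Real.norm_of_nonneg (jumpKernel_nonneg _), Real.norm_eq_abs]
  have := mul_le_mul_of_nonneg_left (jumpKernel_le_weight hs one_pos (by positivity)
    (one_add_norm_le hr x hξ)) (abs_nonneg (f (x + ξ)))
  refine this.trans (le_of_eq ?_)
  rw [div_eq_mul_inv]; ring

lemma WeightedIntegrable.integrableOn_sub (hs : 0 < s) {f : E n → ℝ} (hf : WeightedIntegrable s f)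
    (hc : Continuous f) (x : E n) {r : ℝ} (hr : 0 < r) :
    IntegrableOn (fun ξ => (f x - f (x + ξ)) * jumpKernel s ξ) (Metric.ball (0 : E n) r)ᶜ := by
  have := ((integrableOn_jumpKernel (n := n) hs hr).const_mul (f x)).sub
    (hf.integrableOn_shift hs hc x hr)
  refine this.congr (.of_forall fun ξ => ?_)
  simp only [Pi.sub_apply]; ring

lemma map_add_compl_ball (x : E n) (r : ℝ) :
    (fun ξ => x + ξ) ⁻¹' (Metric.ball x r)ᶜ = (Metric.ball (0 : E n) r)ᶜ := by
  ext ξ; simp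

lemma fracKernel_add (f : E n → ℝ) (x ξ : E n) :
    fracKernel s f x (x + ξ) = (f x - f (x + ξ)) * jumpKernel s ξ := by
  simp [fracKernel, jumpKernel, div_eq_mul_inv]

lemma integral_fracKernel (f : E n → ℝ) (x : E n) (r : ℝ) :
    ∫ x' in (Metric.ball x r)ᶜ, fracKernel s f x x' = trunc s r f x := by
  have := (measurePreserving_add_left (volume : Measure (E n)) x).setIntegral_preimage_emb
    (measurableEmbedding_addLeft x) (fracKernel s f x) (Metric.ball x r)ᶜ
  rw [← this, map_add_compl_ball]
  simp [trunc, fracKernel_add]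

lemma integrableOn_fracKernel_iff (f : E n → ℝ) (x : E n) (r : ℝ) :
    IntegrableOn (fracKernel s f x) (Metric.ball x r)ᶜ ↔
      IntegrableOn (fun ξ => (f x - f (x + ξ)) * jumpKernel s ξ) (Metric.ball (0 : E n) r)ᶜ := by
  have := (measurePreserving_add_left (volume : Measure (E n)) x).integrableOn_comp_preimage
    (measurableEmbedding_addLeft x) (f := fracKernel s f x) (s := (Metric.ball x r)ᶜ)
  rw [← this, map_add_compl_ball]
  simp only [Function.comp_def, fracKernel_add]

/-- `trunc` as a mass term minus an integral in the original variable. -/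
lemma trunc_eq (hs : 0 < s) {f : E n → ℝ} (hf : WeightedIntegrable s f)
    (hc : Continuous f) (x : E n) {r : ℝ} (hr : 0 < r) :
    trunc s r f x = f x * (outerMass n s * r ^ (-(2 * s)))
      - ∫ ξ in (Metric.ball (0 : E n) r)ᶜ, f (x + ξ) * jumpKernel s ξ := by
  rw [← integral_jumpKernel_compl hr, ← integral_const_mul, ← integral_sub
    ((integrableOn_jumpKernel hs hr).const_mul _) (hf.integrableOn_shift hs hc x hr)]
  simp only [trunc, sub_mul]

/-- Odd integrands drop out over the complement of a ball. -/
lemma integral_inner_jumpKernel {A : Set (E n)} (hA : ∀ ξ, -ξ ∈ A ↔ ξ ∈ A)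
    (hm : MeasurableSet A) (p : E n) :
    ∫ ξ in A, inner ℝ p ξ * jumpKernel s ξ = 0 := by
  have h := integral_neg_eq_self (A.indicator fun ξ => inner ℝ p ξ * jumpKernel s ξ)
    (volume : Measure (E n))
  have e : (fun ξ => A.indicator (fun ξ => inner ℝ p ξ * jumpKernel s ξ) (-ξ))
      = fun ξ => - A.indicator (fun ξ => inner ℝ p ξ * jumpKernel s ξ) ξ := by
    funext ξ
    by_cases hξ : ξ ∈ A
    · rw [indicator_of_mem hξ, indicator_of_mem ((hA ξ).2 hξ), jumpKernel_neg, inner_neg_right]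
      ring
    · rw [indicator_of_notMem hξ, indicator_of_notMem (fun h => hξ ((hA ξ).1 h)), neg_zero]
  rw [e, integral_neg, integral_indicator hm] at h
  linarith

/-! ### From viscosity inequalities to pointwise inequalities -/

lemma integrableOn_inner_annulus (hs : 0 < s) (p : E n) {ε r : ℝ} (hε : 0 < ε) :
    IntegrableOn (fun ξ => inner ℝ p ξ * jumpKernel s ξ)
      (Metric.ball (0 : E n) r \ Metric.ball (0 : E n) ε) := by
  have h := ((integrableOn_jumpKernel (n := n) hs hε).mono_set
    (s := Metric.ball (0 : E n) r \ Metric.ball (0 : E n) ε) (fun ξ hξ => hξ.2)).const_mul (‖p‖ * r)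
  refine h.mono' (((continuous_const.inner continuous_id).measurable).mul
    measurable_jumpKernel).aestronglyMeasurable ?_
  filter_upwards [self_mem_ae_restrict (measurableSet_ball.diff measurableSet_ball)] with ξ hξ
  rw [norm_mul, Real.norm_of_nonneg (jumpKernel_nonneg _)]
  gcongr
  · exact jumpKernel_nonneg _
  · refine (norm_inner_le_norm p ξ).trans ?_
    gcongr
    have := hξ.1
    simp only [Metric.mem_ball, dist_zero_right] at this
    exact this.le

lemma integral_sq_jumpKernel_annulus (hn : 0 < n) (hs : s < 1) {ε r : ℝ} (hε : 0 < ε)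
    (h : ε ≤ r) :
    ∫ ξ in Metric.ball (0 : E n) r \ Metric.ball (0 : E n) ε, ‖ξ‖ ^ 2 * jumpKernel s ξ
      = innerMoment n s * r ^ (2 - 2 * s) - innerMoment n s * ε ^ (2 - 2 * s) := by
  rw [setIntegral_sdiff measurableSet_ball (integrableOn_sq_jumpKernel hn hs r)
    (Metric.ball_subset_ball h), integral_sq_jumpKernel_ball hε,
    integral_sq_jumpKernel_ball (hε.trans_le h)]

lemma compl_ball_eq_union {ε r : ℝ} (h : ε ≤ r) :
    (Metric.ball (0 : E n) ε)ᶜ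
      = (Metric.ball (0 : E n) r)ᶜ ∪ (Metric.ball (0 : E n) r \ Metric.ball (0 : E n) ε) := by
  ext ξ
  simp only [mem_compl_iff, Metric.mem_ball, dist_zero_right, mem_union, Set.mem_sdiff]
  constructor
  · intro h1
    by_cases h2 : ‖ξ‖ < r
    · exact .inr ⟨h2, h1⟩
    · exact .inl h2
  · rintro (h1 | h1)
    · exact fun h2 => h1 (h2.trans_le h)
    · exact h1.2

lemma tendsto_rpow_nhdsGT_zero {a : ℝ} (ha : 0 < a) (c : ℝ) :
    Tendsto (fun r : ℝ => c * r ^ a) (𝓝[>] 0) (𝓝 0) := by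
  have h : Tendsto (fun r : ℝ => r ^ a) (𝓝[>] 0) (𝓝 0) := by
    have := (Real.continuousAt_rpow_const 0 a (.inr ha.le)).tendsto
    rw [Real.zero_rpow ha.ne'] at this
    exact this.mono_left nhdsWithin_le_nhds
  simpa using h.const_mul c

/-- The fractional Laplacian, at the centre, of a function that is quadratic in a ball. -/
lemma hasFracLapAt_patch (hn : 0 < n) (hs0 : 0 < s) (hs1 : s < 1) {f : E n → ℝ}
    (hf : WeightedIntegrable s f) (hc : Continuous f) (x₀ p : E n) (A : ℝ) {r : ℝ} (hr : 0 < r)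
    {φ : E n → ℝ} (hφ : ∀ x, φ x = f x₀ + inner ℝ p (x - x₀) + A * ‖x - x₀‖ ^ 2) :
    HasFracLapAt s (patch x₀ r φ f) x₀
      (trunc s r f x₀ - A * (innerMoment n s * r ^ (2 - 2 * s))) := by
  set g := patch x₀ r φ f with hg
  have g0 : g x₀ = f x₀ := by simp [hg, patch, hr, hφ]
  have gin : ∀ ξ ∈ Metric.ball (0 : E n) r, g (x₀ + ξ) = f x₀ + inner ℝ p ξ + A * ‖ξ‖ ^ 2 := by
    intro ξ hξ
    have : x₀ + ξ ∈ Metric.ball x₀ r := by simpa using hξ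
    simp [hg, patch, hφ, mem_ball_zero_iff.1 hξ]
  have gout : ∀ ξ ∈ (Metric.ball (0 : E n) r)ᶜ, g (x₀ + ξ) = f (x₀ + ξ) := by
    intro ξ hξ
    have : ¬ ‖ξ‖ < r := by simpa using hξ
    simp [hg, patch, this]
  have hmd : ∀ ε, MeasurableSet (Metric.ball (0 : E n) r \ Metric.ball (0 : E n) ε) :=
    fun ε => measurableSet_ball.diff measurableSet_ball
  have iout : IntegrableOn (fun ξ => (g x₀ - g (x₀ + ξ)) * jumpKernel s ξ)
      (Metric.ball (0 : E n) r)ᶜ := by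
    refine (hf.integrableOn_sub hs0 hc x₀ hr).congr_fun (fun ξ hξ => ?_) measurableSet_ball.compl
    simp only [g0, gout ξ hξ]
  have i1 : ∀ ε, 0 < ε → IntegrableOn (fun ξ => - (inner ℝ p ξ * jumpKernel s ξ))
      (Metric.ball (0 : E n) r \ Metric.ball (0 : E n) ε) :=
    fun ε hε => (integrableOn_inner_annulus hs0 p hε).neg
  have i2 : ∀ ε, IntegrableOn (fun ξ => A * (‖ξ‖ ^ 2 * jumpKernel s ξ))
      (Metric.ball (0 : E n) r \ Metric.ball (0 : E n) ε) :=
    fun ε => ((integrableOn_sq_jumpKernel hn hs1 r).mono_set sdiff_subset).const_mul A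
  have ee : ∀ ε, EqOn (fun ξ => - (inner ℝ p ξ * jumpKernel s ξ) - A * (‖ξ‖ ^ 2 * jumpKernel s ξ))
      (fun ξ => (g x₀ - g (x₀ + ξ)) * jumpKernel s ξ)
      (Metric.ball (0 : E n) r \ Metric.ball (0 : E n) ε) := by
    intro ε ξ hξ
    simp only [g0, gin ξ hξ.1]; ring
  have iin : ∀ ε, 0 < ε → IntegrableOn (fun ξ => (g x₀ - g (x₀ + ξ)) * jumpKernel s ξ)
      (Metric.ball (0 : E n) r \ Metric.ball (0 : E n) ε) := fun ε hε =>
    ((i1 ε hε).sub (i2 ε)).congr_fun (ee ε) (hmd ε)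
  refine ⟨fun ε hε => ?_, ?_⟩
  · rw [integrableOn_fracKernel_iff]
    rcases le_total ε r with h | h
    · rw [compl_ball_eq_union h]
      exact iout.union (iin ε hε)
    · exact iout.mono_set (compl_subset_compl.2 (Metric.ball_subset_ball h))
  · have key : ∀ ε, 0 < ε → ε < r → ∫ x' in (Metric.ball x₀ ε)ᶜ, fracKernel s g x₀ x'
        = trunc s r f x₀ - A * (innerMoment n s * r ^ (2 - 2 * s))
          + A * innerMoment n s * ε ^ (2 - 2 * s) := by
      intro ε hε h
      rw [integral_fracKernel, trunc, compl_ball_eq_union h.le, setIntegral_union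
        (disjoint_left.2 fun _ h1 h2 => (mem_compl_iff _ _).1 h1 h2.1) (hmd ε) iout (iin ε hε),
        ← setIntegral_congr_fun (hmd ε) (ee ε), integral_sub (i1 ε hε) (i2 ε), integral_neg,
        integral_inner_jumpKernel (fun ξ => by simp) (hmd ε), integral_const_mul,
        integral_sq_jumpKernel_annulus hn hs1 hε h.le, trunc,
        setIntegral_congr_fun (g := fun ξ => (f x₀ - f (x₀ + ξ)) * jumpKernel s ξ)
          measurableSet_ball.compl (fun ξ hξ => by simp only [g0, gout ξ hξ])]
      ring
    have hl : Tendsto (fun ε : ℝ => trunc s r f x₀ - A * (innerMoment n s * r ^ (2 - 2 * s))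
          + A * innerMoment n s * ε ^ (2 - 2 * s)) (𝓝[>] 0)
        (𝓝 (trunc s r f x₀ - A * (innerMoment n s * r ^ (2 - 2 * s)) + 0)) :=
      tendsto_const_nhds.add (tendsto_rpow_nhdsGT_zero (by linarith) _)
    rw [add_zero] at hl
    refine hl.congr' ?_
    filter_upwards [Ioo_mem_nhdsGT hr] with ε hε
    exact (key ε hε.1 hε.2).symm

/-- The quadratic polynomial in `(t, x)` used as a test function at `(t₀, x₀)`. -/
noncomputable def quadTest {n : ℕ} (t₀ : ℝ) (x₀ : E n) (c a B : ℝ) (p : E n) (A : ℝ) (t : ℝ) (x : E n) : ℝ :=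
  c + a * (t - t₀) + B * (t - t₀) ^ 2 + inner ℝ p (x - x₀) + A * ‖x - x₀‖ ^ 2

lemma contDiff_quadTest (t₀ : ℝ) (x₀ : E n) (c a B : ℝ) (p : E n) (A : ℝ) :
    ContDiff ℝ 2 (fun q : ℝ × E n => quadTest t₀ x₀ c a B p A q.1 q.2) := by
  unfold quadTest
  have h1 : ContDiff ℝ 2 (fun q : ℝ × E n => q.1 - t₀) := contDiff_fst.sub contDiff_const
  have h2 : ContDiff ℝ 2 (fun q : ℝ × E n => q.2 - x₀) := contDiff_snd.sub contDiff_const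
  exact (((contDiff_const.add (contDiff_const.mul h1)).add (contDiff_const.mul (h1.pow 2))).add
    (contDiff_const.inner ℝ h2)).add (contDiff_const.mul (h2.norm_sq ℝ))

lemma deriv_quadTest (t₀ : ℝ) (x₀ : E n) (c a B : ℝ) (p : E n) (A : ℝ) :
    deriv (fun t => quadTest t₀ x₀ c a B p A t x₀) t₀ = a := by
  unfold quadTest
  have h1 : HasDerivAt (fun t : ℝ => t - t₀) 1 t₀ := (hasDerivAt_id t₀).sub_const t₀
  have := ((((h1.const_mul a).const_add c).add ((h1.pow 2).const_mul B)).add_const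
    (inner ℝ p (x₀ - x₀))).add_const (A * ‖x₀ - x₀‖ ^ 2)
  have h := this.deriv
  simpa using h

/-- A viscosity supersolution satisfies the truncated inequality wherever a paraboloid touches it
from below. -/
lemma IsViscositySupersolution.le_trunc (hn : 0 < n) (hs0 : 0 < s) (hs1 : s < 1) {T : ℝ}
    {ψ : E n → ℝ} {v : ℝ → E n → ℝ} (h : IsViscositySupersolution s T ψ v) {t₀ : ℝ}
    (ht₀ : t₀ ∈ Ioo 0 T) (hw : WeightedIntegrable s (v t₀)) (hc : Continuous (v t₀))
    {x₀ p : E n} {a A B r : ℝ} (hr : 0 < r)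
    (ht : ∀ t ∈ Icc 0 T, |t - t₀| < r → ∀ x ∈ Metric.ball x₀ r,
      quadTest t₀ x₀ (v t₀ x₀) a (-B) p (-A) t x ≤ v t x) :
    ψ x₀ ≤ v t₀ x₀ ∧ -(A * (innerMoment n s * r ^ (2 - 2 * s))) ≤ a + trunc s r (v t₀) x₀ := by
  have := h t₀ ht₀ x₀ r hr (quadTest t₀ x₀ (v t₀ x₀) a (-B) p (-A))
    ⟨contDiff_quadTest .., by simp [quadTest], ht⟩ _
    (hasFracLapAt_patch hn hs0 hs1 hw hc x₀ p (-A) hr (fun x => by simp [quadTest]))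
  rw [deriv_quadTest] at this
  have h1 := this.trans (min_le_left _ _)
  have h2 := this.trans (min_le_right _ _)
  constructor <;> linarith

/-- A viscosity subsolution satisfies the truncated inequality wherever it lies above the obstacle
and is touched from above by a paraboloid. -/
lemma IsViscositySubsolution.trunc_le (hn : 0 < n) (hs0 : 0 < s) (hs1 : s < 1) {T : ℝ}
    {ψ : E n → ℝ} {v : ℝ → E n → ℝ} (h : IsViscositySubsolution s T ψ v) {t₀ : ℝ}
    (ht₀ : t₀ ∈ Ioo 0 T) (hw : WeightedIntegrable s (v t₀)) (hc : Continuous (v t₀))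
    {x₀ p : E n} {a A B r : ℝ} (hr : 0 < r) (hψ : ψ x₀ < v t₀ x₀)
    (ht : ∀ t ∈ Icc 0 T, |t - t₀| < r → ∀ x ∈ Metric.ball x₀ r,
      v t x ≤ quadTest t₀ x₀ (v t₀ x₀) a B p A t x) :
    a + trunc s r (v t₀) x₀ ≤ A * (innerMoment n s * r ^ (2 - 2 * s)) := by
  have := h t₀ ht₀ x₀ r hr (quadTest t₀ x₀ (v t₀ x₀) a B p A)
    ⟨contDiff_quadTest .., by simp [quadTest], ht⟩ _
    (hasFracLapAt_patch hn hs0 hs1 hw hc x₀ p A hr (fun x => by simp [quadTest]))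
  rw [deriv_quadTest] at this
  rcases min_le_iff.1 this with h | h
  · linarith
  · linarith

/-- Supersolutions in a pointwise sense: wherever a paraboloid touches `v` from below, `v` lies above
the obstacle and the truncated operators satisfy the inequality in the limit. -/
def PointwiseSuper {n : ℕ} (s T : ℝ) (ψ : E n → ℝ) (v : ℝ → E n → ℝ) : Prop :=
  ∀ t₀ ∈ Ioo 0 T, ∀ (x₀ : E n) (a B : ℝ) (p : E n) (A : ℝ),
    (∀ᶠ q : ℝ × E n in 𝓝 (t₀, x₀), quadTest t₀ x₀ (v t₀ x₀) a (-B) p (-A) q.1 q.2 ≤ v q.1 q.2) →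
      ψ x₀ ≤ v t₀ x₀ ∧ ∀ η > 0, ∀ᶠ r in 𝓝[>] (0 : ℝ), -η ≤ a + trunc s r (v t₀) x₀

/-- Subsolutions in a pointwise sense: wherever `v` lies above the obstacle and is touched from above
by a paraboloid, the truncated operators satisfy the inequality in the limit. -/
def PointwiseSub {n : ℕ} (s T : ℝ) (ψ : E n → ℝ) (v : ℝ → E n → ℝ) : Prop :=
  ∀ t₀ ∈ Ioo 0 T, ∀ (x₀ : E n) (a B : ℝ) (p : E n) (A : ℝ),
    (∀ᶠ q : ℝ × E n in 𝓝 (t₀, x₀), v q.1 q.2 ≤ quadTest t₀ x₀ (v t₀ x₀) a B p A q.1 q.2) →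
      ψ x₀ < v t₀ x₀ → ∀ η > 0, ∀ᶠ r in 𝓝[>] (0 : ℝ), a + trunc s r (v t₀) x₀ ≤ η

lemma IsViscositySupersolution.pointwiseSuper (hn : 0 < n) (hs0 : 0 < s) (hs1 : s < 1) {T : ℝ}
    {ψ : E n → ℝ} {v : ℝ → E n → ℝ} (h : IsViscositySupersolution s T ψ v)
    (hw : ∀ t ∈ Icc 0 T, WeightedIntegrable s (v t)) (hc : ∀ t ∈ Icc 0 T, Continuous (v t)) :
    PointwiseSuper s T ψ v := by
  intro t₀ ht₀ x₀ a B p A ht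
  obtain ⟨ρ, hρ, hb⟩ := Metric.eventually_nhds_iff_ball.1 ht
  have key : ∀ r, 0 < r → r < ρ → _ := fun r hr hrρ =>
    h.le_trunc hn hs0 hs1 ht₀ (hw t₀ (Ioo_subset_Icc_self ht₀)) (hc t₀ (Ioo_subset_Icc_self ht₀))
      (x₀ := x₀) (p := p) (a := a) (A := A) (B := B) hr (fun t _ h1 x hx => hb (t, x) (by
        rw [← ball_prod_same]
        exact ⟨(by simpa [Real.dist_eq] using h1.trans hrρ), Metric.ball_subset_ball hrρ.le hx⟩))
  refine ⟨(key (ρ / 2) (by positivity) (by linarith)).1, fun η hη => ?_⟩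
  have hl := (tendsto_rpow_nhdsGT_zero (a := 2 - 2 * s) (by linarith) (A * innerMoment n s))
  filter_upwards [hl.eventually (gt_mem_nhds hη), Ioo_mem_nhdsGT hρ] with r h1 h2
  have := (key r h2.1 h2.2).2
  linarith

lemma IsViscositySubsolution.pointwiseSub (hn : 0 < n) (hs0 : 0 < s) (hs1 : s < 1) {T : ℝ}
    {ψ : E n → ℝ} {v : ℝ → E n → ℝ} (h : IsViscositySubsolution s T ψ v)
    (hw : ∀ t ∈ Icc 0 T, WeightedIntegrable s (v t)) (hc : ∀ t ∈ Icc 0 T, Continuous (v t)) :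
    PointwiseSub s T ψ v := by
  intro t₀ ht₀ x₀ a B p A ht hψ η hη
  obtain ⟨ρ, hρ, hb⟩ := Metric.eventually_nhds_iff_ball.1 ht
  have hl := (tendsto_rpow_nhdsGT_zero (a := 2 - 2 * s) (by linarith) (A * innerMoment n s))
  filter_upwards [hl.eventually (gt_mem_nhds hη), Ioo_mem_nhdsGT hρ] with r h1 h2
  have := h.trunc_le hn hs0 hs1 ht₀ (hw t₀ (Ioo_subset_Icc_self ht₀))
    (hc t₀ (Ioo_subset_Icc_self ht₀))
    (x₀ := x₀) (p := p) (a := a) (A := A) (B := B) h2.1 hψ (fun t _ h1 x hx => hb (t, x) (by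
      rw [← ball_prod_same]
      exact ⟨(by simpa [Real.dist_eq] using h1.trans h2.2), Metric.ball_subset_ball h2.2.le hx⟩))
  linarith

/-! ### Vanishing tails, and continuity of the truncated operator -/

/-- The functions `w(t)`, `t ∈ [0,T]`, have uniformly vanishing weighted tails. -/
def TailsVanish {n : ℕ} (s T : ℝ) (w : ℝ → E n → ℝ) : Prop :=
  (∀ t ∈ Icc 0 T, WeightedIntegrable s (w t)) ∧
    ∀ ε > 0, ∃ R₀ : ℝ, 1 ≤ R₀ ∧ ∀ R ≥ R₀, ∀ t ∈ Icc 0 T,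
      ∫ y : E n, |w t y| / (R + ‖y‖) ^ ((n : ℝ) + 2 * s) ≤ ε

lemma integral_div_anti (hs : 0 < s) {f : E n → ℝ} (hf : WeightedIntegrable s f)
    (hm : AEStronglyMeasurable f) {R R' : ℝ} (hR : 1 ≤ R) (h : R ≤ R') :
    ∫ y : E n, |f y| / (R' + ‖y‖) ^ ((n : ℝ) + 2 * s)
      ≤ ∫ y : E n, |f y| / (R + ‖y‖) ^ ((n : ℝ) + 2 * s) := by
  refine integral_mono (hf.integrable_div hs (hR.trans h) hm) (hf.integrable_div hs hR hm)
    fun y => ?_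
  dsimp only
  gcongr

lemma tendsto_integral_div (hs : 0 < s) {f : E n → ℝ} (hf : WeightedIntegrable s f)
    (hm : AEStronglyMeasurable f) :
    Tendsto (fun R : ℝ => ∫ y : E n, |f y| / (R + ‖y‖) ^ ((n : ℝ) + 2 * s)) atTop (𝓝 0) := by
  have : (0 : ℝ) = ∫ y : E n, (0 : ℝ) := by simp
  rw [this]
  refine tendsto_integral_filter_of_dominated_convergence _ ?_ ?_ hf ?_
  · filter_upwards [eventually_ge_atTop 1] with R hR
    exact (hf.integrable_div hs hR hm).aestronglyMeasurable
  · filter_upwards [eventually_ge_atTop 1] with R hR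
    refine .of_forall fun x => ?_
    rw [Real.norm_of_nonneg (by positivity)]
    gcongr
  · refine .of_forall fun x => ?_
    refine Tendsto.div_atTop tendsto_const_nhds ?_
    exact (tendsto_rpow_atTop (by positivity)).comp (tendsto_atTop_add_const_right _ _ tendsto_id)

lemma IsObstacleSolution.continuous {T : ℝ} {u₀ ψ : E n → ℝ} {u : ℝ → E n → ℝ}
    (h : IsObstacleSolution s T u₀ ψ u) {t : ℝ} (ht : t ∈ Icc 0 T) : Continuous (u t) := by
  have := h.continuousOn.comp_continuous (f := fun x : E n => (t, x)) (by fun_prop)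
    (fun x => ⟨ht, mem_univ _⟩)
  exact this

lemma integrable_sub_div (hs : 0 < s) {f g : E n → ℝ} (hf : WeightedIntegrable s f)
    (hg : WeightedIntegrable s g) (hfc : Continuous f) (hgc : Continuous g) {R : ℝ} (hR : 1 ≤ R) :
    Integrable fun y : E n => |f y - g y| / (R + ‖y‖) ^ ((n : ℝ) + 2 * s) := by
  refine ((hf.integrable_div hs hR hfc.aestronglyMeasurable).add
    (hg.integrable_div hs hR hgc.aestronglyMeasurable)).mono' ?_ (.of_forall fun x => ?_)
  · refine ((hfc.sub hgc).norm).aestronglyMeasurable.mul (Measurable.aestronglyMeasurable ?_)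
    fun_prop
  · rw [Real.norm_of_nonneg (by positivity), Pi.add_apply, ← add_div]
    gcongr
    exact abs_sub _ _

lemma IsObstacleSolution.weighted {T : ℝ} {u₀ ψ : E n → ℝ} {u : ℝ → E n → ℝ}
    (h : IsObstacleSolution s T u₀ ψ u) (t : ℝ) (ht : t ∈ Icc 0 T) : WeightedIntegrable s (u t) :=
  h.integrable t ht

lemma IsObstacleSolution.tailsVanish (hs : 0 < s) {T : ℝ} {u₀ ψ : E n → ℝ} {u : ℝ → E n → ℝ}
    (h : IsObstacleSolution s T u₀ ψ u) : TailsVanish s T u := by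
  refine ⟨fun t => h.weighted t, fun ε hε => ?_⟩
  have hloc : ∀ t₀ ∈ Icc 0 T, ∃ U ∈ 𝓝[Icc 0 T] t₀, ∃ R₀ : ℝ, 1 ≤ R₀ ∧ ∀ R ≥ R₀, ∀ t ∈ U ∩ Icc 0 T,
      ∫ y : E n, |u t y| / (R + ‖y‖) ^ ((n : ℝ) + 2 * s) ≤ ε := by
    intro t₀ ht₀
    have h1 := (h.tendsto_weighted t₀ ht₀).eventually (gt_mem_nhds (half_pos hε))
    have h2 := (tendsto_integral_div hs (h.weighted t₀ ht₀)
      (h.continuous ht₀).aestronglyMeasurable).eventually (gt_mem_nhds (half_pos hε))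
    obtain ⟨R₀, hR₀⟩ := (h2.and (eventually_ge_atTop 1)).exists
    refine ⟨_, h1, R₀, hR₀.2, fun R hR t ht => ?_⟩
    have ht1 : ∫ y : E n, |u t y - u t₀ y| / (1 + ‖y‖) ^ ((n : ℝ) + 2 * s) < ε / 2 := ht.1
    have ct := h.continuous ht.2
    have ct₀ := h.continuous ht₀
    refine (integral_div_anti hs (h.weighted t ht.2) ct.aestronglyMeasurable hR₀.2 hR).trans ?_
    calc _ ≤ ∫ y : E n, (|u t y - u t₀ y| / (1 + ‖y‖) ^ ((n : ℝ) + 2 * s)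
              + |u t₀ y| / (R₀ + ‖y‖) ^ ((n : ℝ) + 2 * s)) := by
          refine integral_mono ((h.weighted t ht.2).integrable_div hs hR₀.2
            ct.aestronglyMeasurable) ((integrable_sub_div hs (h.weighted t ht.2)
            (h.weighted t₀ ht₀) ct ct₀ le_rfl).add ((h.weighted t₀ ht₀).integrable_div hs hR₀.2
            ct₀.aestronglyMeasurable)) fun y => ?_
          dsimp only
          have e1 : |u t y| ≤ |u t y - u t₀ y| + |u t₀ y| := by
            simpa using abs_add_le (u t y - u t₀ y) (u t₀ y)
          have hR1 := hR₀.2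
          calc _ ≤ (|u t y - u t₀ y| + |u t₀ y|) / (R₀ + ‖y‖) ^ ((n : ℝ) + 2 * s) := by gcongr
            _ ≤ _ := by
              rw [add_div]
              gcongr
      _ ≤ ε / 2 + ε / 2 := by
          rw [integral_add (integrable_sub_div hs (h.weighted t ht.2)
            (h.weighted t₀ ht₀) ct ct₀ le_rfl) ((h.weighted t₀ ht₀).integrable_div hs hR₀.2
            ct₀.aestronglyMeasurable)]
          exact add_le_add ht1.le hR₀.1.le
      _ = ε := by ring
  obtain ⟨R₀, h1, h2⟩ := (isCompact_Icc (a := (0 : ℝ)) (b := T)).induction_on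
    (p := fun U => ∃ R₀ : ℝ, 1 ≤ R₀ ∧ ∀ R ≥ R₀, ∀ t ∈ U ∩ Icc 0 T,
      ∫ y : E n, |u t y| / (R + ‖y‖) ^ ((n : ℝ) + 2 * s) ≤ ε)
    ⟨1, le_rfl, fun R _ t ht => ht.1.elim⟩
    (fun U V hUV ⟨R₀, h1, h2⟩ => ⟨R₀, h1, fun R hR t ht => h2 R hR t ⟨hUV ht.1, ht.2⟩⟩)
    (fun U V ⟨R₀, h1, h2⟩ ⟨R₁, h3, h4⟩ => ⟨max R₀ R₁, h1.trans (le_max_left _ _), fun R hR t ht =>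
      ht.1.elim (fun h => h2 R ((le_max_left _ _).trans hR) t ⟨h, ht.2⟩)
        (fun h => h4 R ((le_max_right _ _).trans hR) t ⟨h, ht.2⟩)⟩)
    hloc
  exact ⟨R₀, h1, fun R hR t ht => h2 R hR t ⟨ht, ht⟩⟩

/-- Tails of translated functions, up to bounded terms. -/
lemma TailsVanish.shift (hs : 0 < s) {T T' : ℝ} {w w' : ℝ → E n → ℝ} (hw : TailsVanish s T w)
    (hwc : ∀ t ∈ Icc 0 T, Continuous (w t)) (hc : ∀ t ∈ Icc 0 T', Continuous (w' t))
    (g : ℝ → ℝ) (hg : ∀ t ∈ Icc 0 T', g t ∈ Icc 0 T) (h : E n) (B : ℝ)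
    (hb : ∀ t ∈ Icc 0 T', ∀ x, |w' t x| ≤ |w (g t) (x + h)| + B) : TailsVanish s T' w' := by
  have hB : Integrable fun x : E n => |B| / (1 + ‖x‖) ^ ((n : ℝ) + 2 * s) := by
    simpa [div_eq_mul_inv] using (integrable_inv_weight (n := n) hs one_pos).const_mul |B|
  have hBw : WeightedIntegrable s (fun _ : E n => B) := hB
  have key : ∀ R : ℝ, 1 ≤ R → ∀ t ∈ Icc 0 T', ∀ x : E n,
      |w' t x| / (R + ‖h‖ + ‖x‖) ^ ((n : ℝ) + 2 * s) ≤
        |w (g t) (x + h)| / (R + ‖x + h‖) ^ ((n : ℝ) + 2 * s)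
        + |B| / (R + ‖x‖) ^ ((n : ℝ) + 2 * s) := by
    intro R hR t ht x
    have e2 : ‖x + h‖ ≤ ‖x‖ + ‖h‖ := norm_add_le _ _
    have h0 := norm_nonneg h
    have h0x := norm_nonneg x
    calc _ ≤ (|w (g t) (x + h)| + |B|) / (R + ‖h‖ + ‖x‖) ^ ((n : ℝ) + 2 * s) := by
          gcongr
          exact (hb t ht x).trans (by gcongr; exact le_abs_self B)
      _ ≤ _ := by
          rw [add_div]
          exact add_le_add (div_le_div_of_nonneg_left (abs_nonneg _) (by positivity)
            (Real.rpow_le_rpow (by positivity) (by linarith) (by positivity)))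
            (div_le_div_of_nonneg_left (abs_nonneg _) (by positivity)
            (Real.rpow_le_rpow (by positivity) (by linarith) (by positivity)))
  have int1 : ∀ R : ℝ, 1 ≤ R → ∀ t ∈ Icc 0 T', Integrable fun x : E n =>
      |w (g t) (x + h)| / (R + ‖x + h‖) ^ ((n : ℝ) + 2 * s)
        + |B| / (R + ‖x‖) ^ ((n : ℝ) + 2 * s) := by
    intro R hR t ht
    exact (((hw.1 _ (hg t ht)).integrable_div hs hR
      (hwc _ (hg t ht)).aestronglyMeasurable).comp_add_right h).add
      (hBw.integrable_div hs hR aestronglyMeasurable_const)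
  have meas : ∀ R : ℝ, ∀ t ∈ Icc 0 T', AEStronglyMeasurable fun x : E n =>
      |w' t x| / (R + ‖x‖) ^ ((n : ℝ) + 2 * s) := by
    intro R t ht
    refine ((hc t ht).norm).aestronglyMeasurable.mul (Measurable.aestronglyMeasurable ?_)
    fun_prop
  have hW : ∀ t ∈ Icc 0 T', WeightedIntegrable s (w' t) := by
    intro t ht
    refine ((int1 1 le_rfl t ht).const_mul ((1 + ‖h‖) ^ ((n : ℝ) + 2 * s))).mono' (meas 1 t ht)
      (.of_forall fun x => ?_)
    rw [Real.norm_of_nonneg (by positivity)]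
    refine le_trans ?_ (mul_le_mul_of_nonneg_left (key 1 le_rfl t ht x) (by positivity))
    rw [div_eq_mul_inv, div_eq_mul_inv, mul_left_comm]
    refine mul_le_mul_of_nonneg_left ?_ (abs_nonneg _)
    rw [← div_eq_mul_inv, le_div_iff₀ (by positivity), inv_mul_le_iff₀ (by positivity),
      ← Real.mul_rpow (by positivity) (by positivity)]
    refine Real.rpow_le_rpow (by positivity) ?_ (by positivity)
    nlinarith [norm_nonneg h, norm_nonneg x]
  refine ⟨hW, fun ε hε => ?_⟩
  obtain ⟨R₁, h1, h2⟩ := hw.2 (ε / 2) (half_pos hε)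
  have h3 := (tendsto_integral_div hs hBw aestronglyMeasurable_const).eventually
    (gt_mem_nhds (half_pos hε))
  obtain ⟨R₂, h4⟩ := eventually_atTop.1 h3
  refine ⟨max R₁ R₂ + ‖h‖, by have := norm_nonneg h; have := le_max_left R₁ R₂; linarith,
    fun R hR t ht => ?_⟩
  have hR1 : R₁ ≤ R - ‖h‖ := by have := le_max_left R₁ R₂; linarith
  have hR2 : R₂ ≤ R - ‖h‖ := by have := le_max_right R₁ R₂; linarith
  have hR3 : 1 ≤ R := by have := norm_nonneg h; linarith
  calc _ ≤ ∫ x : E n, (|w (g t) (x + h)| / (R - ‖h‖ + ‖x + h‖) ^ ((n : ℝ) + 2 * s)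
        + |B| / (R - ‖h‖ + ‖x‖) ^ ((n : ℝ) + 2 * s)) := by
        refine integral_mono ((hW t ht).integrable_div hs hR3 (hc t ht).aestronglyMeasurable)
          (int1 _ (h1.trans hR1) t ht) fun x => ?_
        have := key (R - ‖h‖) (h1.trans hR1) t ht x
        rwa [sub_add_cancel] at this
    _ = (∫ x : E n, |w (g t) x| / (R - ‖h‖ + ‖x‖) ^ ((n : ℝ) + 2 * s))
        + ∫ x : E n, |B| / (R - ‖h‖ + ‖x‖) ^ ((n : ℝ) + 2 * s) := by
        rw [integral_add (((hw.1 _ (hg t ht)).integrable_div hs (h1.trans hR1)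
          (hwc _ (hg t ht)).aestronglyMeasurable).comp_add_right h)
          (hBw.integrable_div hs (h1.trans hR1) aestronglyMeasurable_const),
          integral_add_right_eq_self
            (fun x : E n => |w (g t) x| / (R - ‖h‖ + ‖x‖) ^ ((n : ℝ) + 2 * s)) h]
    _ ≤ ε / 2 + ε / 2 := add_le_add (h2 _ hR1 _ (hg t ht)) (h4 _ hR2).le
    _ = ε := by ring

/-- For fixed `f`, the far interaction depends continuously on the base point. -/
lemma continuousAt_far (hn : 0 < n) (hs : 0 < s) {f : E n → ℝ} (hf : WeightedIntegrable s f)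
    (hc : Continuous f) {r : ℝ} (hr : 0 < r) (x₀ : E n) :
    ContinuousAt (fun x => ∫ ξ in (Metric.ball (0 : E n) r)ᶜ, f (x + ξ) * jumpKernel s ξ) x₀ := by
  have hcv : ∀ x : E n, ∫ ξ in (Metric.ball (0 : E n) r)ᶜ, f (x + ξ) * jumpKernel s ξ
      = ∫ y, (Metric.ball x r)ᶜ.indicator (fun y => f y * jumpKernel s (y - x)) y := by
    intro x
    have := (measurePreserving_add_left (volume : Measure (E n)) x).setIntegral_preimage_emb
      (measurableEmbedding_addLeft x) (fun y => f y * jumpKernel s (y - x)) (Metric.ball x r)ᶜ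
    rw [integral_indicator measurableSet_ball.compl, ← this, map_add_compl_ball]
    simp
  simp only [hcv]
  have hnt : Nontrivial (E n) := by
    have : Nonempty (Fin n) := ⟨⟨0, hn⟩⟩
    infer_instance
  refine continuousAt_of_dominated (bound := fun y => ((1 + (‖x₀‖ + 1)) / r + 1) ^ ((n : ℝ) + 2 * s) *
    (|f y| / (1 + ‖y‖) ^ ((n : ℝ) + 2 * s))) ?_ ?_ (hf.const_mul _) ?_
  · refine .of_forall fun x => AEStronglyMeasurable.indicator ?_ measurableSet_ball.compl
    exact (hc.measurable.mul (measurable_jumpKernel.comp (measurable_id.sub_const x))).aestronglyMeasurable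
  · filter_upwards [Metric.ball_mem_nhds x₀ one_pos] with x hx
    refine .of_forall fun y => ?_
    by_cases hy : y ∈ (Metric.ball x r)ᶜ
    · rw [indicator_of_mem hy, norm_mul, Real.norm_of_nonneg (jumpKernel_nonneg _),
        Real.norm_eq_abs]
      have hy' : y - x ∈ (Metric.ball (0 : E n) r)ᶜ := by
        simpa [dist_eq_norm] using hy
      have h1 := one_add_norm_le hr x hy'
      rw [add_sub_cancel] at h1
      have hx' : ‖x‖ ≤ ‖x₀‖ + 1 := by
        have h2 : ‖x - x₀‖ < 1 := by simpa [dist_eq_norm] using hx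
        have := norm_sub_norm_le x x₀
        linarith
      have h3 : 1 + ‖y‖ ≤ ((1 + (‖x₀‖ + 1)) / r + 1) * ‖y - x‖ := h1.trans (by gcongr)
      have := mul_le_mul_of_nonneg_left (jumpKernel_le_weight hs one_pos (by positivity) h3)
        (abs_nonneg (f y))
      refine this.trans (le_of_eq ?_)
      rw [div_eq_mul_inv]; ring
    · rw [indicator_of_notMem hy, norm_zero]; positivity
  · have hae : ∀ᵐ y : E n, y ∉ Metric.sphere x₀ r :=
      measure_eq_zero_iff_ae_notMem.1 (Measure.addHaar_sphere (volume : Measure (E n)) x₀ r)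
    filter_upwards [hae] with y hy
    have hd : dist y x₀ ≠ r := hy
    have hcd : Continuous fun x => dist y x := by fun_prop
    rcases lt_or_gt_of_ne hd with h | h
    · have he : (fun x => (Metric.ball x r)ᶜ.indicator (fun y => f y * jumpKernel s (y - x)) y)
          =ᶠ[𝓝 x₀] fun _ => 0 := by
        filter_upwards [hcd.continuousAt.eventually (gt_mem_nhds h)] with x hx
        exact indicator_of_notMem (by simpa using hx) _
      exact continuousAt_const.congr he.symm
    · have he : (fun x => (Metric.ball x r)ᶜ.indicator (fun y => f y * jumpKernel s (y - x)) y)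
          =ᶠ[𝓝 x₀] fun x => f y * jumpKernel s (y - x) := by
        filter_upwards [hcd.continuousAt.eventually (lt_mem_nhds h)] with x hx
        exact indicator_of_mem (by simpa using hx.le) _
      refine ContinuousAt.congr ?_ he.symm
      have hpos : ‖y - x₀‖ ≠ 0 := by rw [← dist_eq_norm]; linarith
      unfold jumpKernel
      refine continuousAt_const.mul (ContinuousAt.inv₀ ?_ ?_)
      · exact ContinuousAt.rpow_const (by fun_prop) (.inl hpos)
      · have : 0 < ‖y - x₀‖ := lt_of_le_of_ne (norm_nonneg _) (Ne.symm hpos)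
        positivity

lemma abs_far_sub_le (hs : 0 < s) {f g : E n → ℝ} (hf : WeightedIntegrable s f)
    (hg : WeightedIntegrable s g) (hfc : Continuous f) (hgc : Continuous g) (x : E n) {r : ℝ}
    (hr : 0 < r) :
    |(∫ ξ in (Metric.ball (0 : E n) r)ᶜ, f (x + ξ) * jumpKernel s ξ)
        - ∫ ξ in (Metric.ball (0 : E n) r)ᶜ, g (x + ξ) * jumpKernel s ξ|
      ≤ ((1 + ‖x‖) / r + 1) ^ ((n : ℝ) + 2 * s)
        * ∫ y : E n, |f y - g y| / (1 + ‖y‖) ^ ((n : ℝ) + 2 * s) := by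
  have hi := (integrable_sub_div hs hf hg hfc hgc le_rfl).const_mul
    (((1 + ‖x‖) / r + 1) ^ ((n : ℝ) + 2 * s))
  rw [← integral_sub (hf.integrableOn_shift hs hfc x hr) (hg.integrableOn_shift hs hgc x hr),
    ← integral_const_mul, ← integral_add_left_eq_self
      (fun y : E n => ((1 + ‖x‖) / r + 1) ^ ((n : ℝ) + 2 * s) *
        (|f y - g y| / (1 + ‖y‖) ^ ((n : ℝ) + 2 * s))) x, ← Real.norm_eq_abs]
  refine (norm_integral_le_of_norm_le (hi.comp_add_left x).integrableOn ?_).trans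
    (setIntegral_le_integral (hi.comp_add_left x) (.of_forall fun y => by positivity))
  filter_upwards [self_mem_ae_restrict measurableSet_ball.compl] with ξ hξ
  rw [← sub_mul, norm_mul, Real.norm_of_nonneg (jumpKernel_nonneg _), Real.norm_eq_abs]
  have := mul_le_mul_of_nonneg_left (jumpKernel_le_weight hs one_pos (by positivity)
    (one_add_norm_le hr x hξ)) (abs_nonneg (f (x + ξ) - g (x + ξ)))
  refine this.trans (le_of_eq ?_)
  rw [div_eq_mul_inv]; ring

/-- The truncated operator is continuous in time and space along a solution. -/
lemma IsObstacleSolution.tendsto_trunc (hn : 0 < n) (hs : 0 < s) {T : ℝ} {u₀ ψ : E n → ℝ}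
    {u : ℝ → E n → ℝ} (h : IsObstacleSolution s T u₀ ψ u) {r : ℝ} (hr : 0 < r) {t₀ : ℝ}
    (ht₀ : t₀ ∈ Icc 0 T) (x₀ : E n) :
    Tendsto (fun q : ℝ × E n => trunc s r (u q.1) q.2) (𝓝[Icc 0 T ×ˢ univ] (t₀, x₀))
      (𝓝 (trunc s r (u t₀) x₀)) := by
  have hmem : ∀ᶠ q : ℝ × E n in 𝓝[Icc 0 T ×ˢ univ] (t₀, x₀), q.1 ∈ Icc 0 T := by
    filter_upwards [self_mem_nhdsWithin] with q hq using hq.1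
  have h1 : Tendsto (fun q : ℝ × E n => u q.1 q.2) (𝓝[Icc 0 T ×ˢ univ] (t₀, x₀))
      (𝓝 (u t₀ x₀)) := h.continuousOn (t₀, x₀) ⟨ht₀, mem_univ _⟩
  have hfst : Tendsto (fun q : ℝ × E n => q.1) (𝓝[Icc 0 T ×ˢ univ] (t₀, x₀)) (𝓝[Icc 0 T] t₀) :=
    tendsto_nhdsWithin_iff.2 ⟨(continuous_fst.tendsto (t₀, x₀)).mono_left nhdsWithin_le_nhds, hmem⟩
  have hsnd : Tendsto (fun q : ℝ × E n => q.2) (𝓝[Icc 0 T ×ˢ univ] (t₀, x₀)) (𝓝 x₀) :=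
    (continuous_snd.tendsto (t₀, x₀)).mono_left nhdsWithin_le_nhds
  have h2 := (continuousAt_far hn hs (h.weighted t₀ ht₀) (h.continuous ht₀) hr x₀).tendsto.comp hsnd
  have h3 : Tendsto (fun q : ℝ × E n => (∫ ξ in (Metric.ball (0 : E n) r)ᶜ, u q.1 (q.2 + ξ) * jumpKernel s ξ)
        - ∫ ξ in (Metric.ball (0 : E n) r)ᶜ, u t₀ (q.2 + ξ) * jumpKernel s ξ)
      (𝓝[Icc 0 T ×ˢ univ] (t₀, x₀)) (𝓝 0) := by
    have h4 : Tendsto (fun q : ℝ × E n => ((1 + ‖q.2‖) / r + 1) ^ ((n : ℝ) + 2 * s)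
        * ∫ y : E n, |u q.1 y - u t₀ y| / (1 + ‖y‖) ^ ((n : ℝ) + 2 * s))
        (𝓝[Icc 0 T ×ˢ univ] (t₀, x₀)) (𝓝 (((1 + ‖x₀‖) / r + 1) ^ ((n : ℝ) + 2 * s) * 0)) := by
      refine Tendsto.mul ?_ ((h.tendsto_weighted t₀ ht₀).comp hfst)
      refine Tendsto.rpow_const ?_ (.inl (by positivity))
      exact ((tendsto_const_nhds.add hsnd.norm).div_const r).add_const 1
    rw [mul_zero] at h4
    refine squeeze_zero_norm' ?_ h4
    filter_upwards [hmem] with q hq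
    exact abs_far_sub_le hs (h.weighted _ hq) (h.weighted t₀ ht₀) (h.continuous hq)
      (h.continuous ht₀) q.2 hr
  have h5 := (h1.mul_const (outerMass n s * r ^ (-(2 * s)))).sub (h3.add h2)
  rw [zero_add, ← trunc_eq hs (h.weighted t₀ ht₀) (h.continuous ht₀) x₀ hr] at h5
  refine h5.congr' ?_
  filter_upwards [hmem] with q hq
  rw [trunc_eq hs (h.weighted _ hq) (h.continuous hq) q.2 hr]
  simp

/-! ### Lower bounds for truncated operators -/

/-- If `W` lies below a paraboloid in `B_ρ`, then its truncated operator at `0` is bounded below by the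
contribution of the paraboloid in `B_ρ`, of the value `W 0` outside, and of the tail of `W`. -/
lemma le_integral_of_le_quadratic (hn : 0 < n) (hs0 : 0 < s) (hs1 : s < 1) {W : E n → ℝ} {p : E n}
    {W₀ A r ρ : ℝ} (hA : 0 ≤ A) (hr : 0 < r) (hrρ : r ≤ ρ)
    (hi : IntegrableOn (fun ξ => W ξ * jumpKernel s ξ) (Metric.ball (0 : E n) r)ᶜ)
    (hq : ∀ ξ ∈ Metric.ball (0 : E n) ρ, W ξ ≤ W₀ + inner ℝ p ξ + A * ‖ξ‖ ^ 2) :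
    -(A * (innerMoment n s * ρ ^ (2 - 2 * s))) + W₀ * (outerMass n s * ρ ^ (-(2 * s)))
        - ∫ ξ in (Metric.ball (0 : E n) ρ)ᶜ, |W ξ| * jumpKernel s ξ
      ≤ ∫ ξ in (Metric.ball (0 : E n) r)ᶜ, (W₀ - W ξ) * jumpKernel s ξ := by
  have hρ : 0 < ρ := hr.trans_le hrρ
  have hmd : MeasurableSet (Metric.ball (0 : E n) ρ \ Metric.ball (0 : E n) r) :=
    measurableSet_ball.diff measurableSet_ball
  have i0 : IntegrableOn (fun ξ => (W₀ - W ξ) * jumpKernel s ξ) (Metric.ball (0 : E n) r)ᶜ := by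
    refine (((integrableOn_jumpKernel (n := n) hs0 hr).const_mul W₀).sub hi).congr
      (.of_forall fun ξ => ?_)
    simp only [Pi.sub_apply]; ring
  have hsub : (Metric.ball (0 : E n) ρ)ᶜ ⊆ (Metric.ball (0 : E n) r)ᶜ :=
    compl_subset_compl.2 (Metric.ball_subset_ball hrρ)
  have hsub2 : Metric.ball (0 : E n) ρ \ Metric.ball (0 : E n) r ⊆ (Metric.ball (0 : E n) r)ᶜ :=
    fun ξ h => h.2
  have iW := hi.mono_set hsub
  have iabs : IntegrableOn (fun ξ => |W ξ| * jumpKernel s ξ) (Metric.ball (0 : E n) ρ)ᶜ := by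
    refine iW.norm.congr (.of_forall fun ξ => ?_)
    simp only [norm_mul, Real.norm_of_nonneg (jumpKernel_nonneg ξ), Real.norm_eq_abs]
  have e1 : W₀ * (outerMass n s * ρ ^ (-(2 * s)))
        - ∫ ξ in (Metric.ball (0 : E n) ρ)ᶜ, |W ξ| * jumpKernel s ξ
      ≤ ∫ ξ in (Metric.ball (0 : E n) ρ)ᶜ, (W₀ - W ξ) * jumpKernel s ξ := by
    rw [← integral_jumpKernel_compl hρ, ← integral_const_mul, ← integral_sub
      ((integrableOn_jumpKernel hs0 hρ).const_mul _) iabs]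
    refine integral_mono (((integrableOn_jumpKernel hs0 hρ).const_mul _).sub iabs)
      (i0.mono_set hsub) fun ξ => ?_
    simp only
    rw [← sub_mul]
    have := jumpKernel_nonneg (s := s) ξ
    gcongr
    exact le_abs_self _
  have i1 : IntegrableOn (fun ξ => - (inner ℝ p ξ * jumpKernel s ξ))
      (Metric.ball (0 : E n) ρ \ Metric.ball (0 : E n) r) := (integrableOn_inner_annulus hs0 p hr).neg
  have i2 : IntegrableOn (fun ξ => A * (‖ξ‖ ^ 2 * jumpKernel s ξ))
      (Metric.ball (0 : E n) ρ \ Metric.ball (0 : E n) r) :=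
    ((integrableOn_sq_jumpKernel hn hs1 ρ).mono_set sdiff_subset).const_mul A
  have e2 : -(A * (innerMoment n s * ρ ^ (2 - 2 * s)))
      ≤ ∫ ξ in Metric.ball (0 : E n) ρ \ Metric.ball (0 : E n) r, (W₀ - W ξ) * jumpKernel s ξ := by
    calc _ ≤ - (A * (innerMoment n s * ρ ^ (2 - 2 * s) - innerMoment n s * r ^ (2 - 2 * s))) := by
          have := mul_nonneg hA (mul_nonneg (innerMoment_nonneg (n := n) (s := s))
            (Real.rpow_nonneg hr.le (2 - 2 * s)))
          linarith
      _ = ∫ ξ in Metric.ball (0 : E n) ρ \ Metric.ball (0 : E n) r,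
            (- (inner ℝ p ξ * jumpKernel s ξ) - A * (‖ξ‖ ^ 2 * jumpKernel s ξ)) := by
          rw [integral_sub i1 i2, integral_neg, integral_inner_jumpKernel (fun ξ => by simp) hmd,
            integral_const_mul, integral_sq_jumpKernel_annulus hn hs1 hr hrρ]
          ring
      _ ≤ _ := by
          refine setIntegral_mono_on (i1.sub i2) (i0.mono_set hsub2) hmd fun ξ hξ => ?_
          have := mul_le_mul_of_nonneg_right (hq ξ hξ.1) (jumpKernel_nonneg (s := s) ξ)
          nlinarith
  rw [compl_ball_eq_union hrρ, setIntegral_union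
    (disjoint_left.2 fun _ h1 h2 => (mem_compl_iff _ _).1 h1 h2.1) hmd (i0.mono_set hsub)
    (i0.mono_set hsub2)]
  linarith

lemma integral_abs_shift_le (hs : 0 < s) {f : E n → ℝ} (hf : WeightedIntegrable s f)
    (hc : Continuous f) {y : E n} {R C ρ : ℝ} (hR : 1 ≤ R) (hC : 0 ≤ C)
    (h : ∀ ξ ∈ (Metric.ball (0 : E n) ρ)ᶜ, R + ‖y + ξ‖ ≤ C * ‖ξ‖) :
    ∫ ξ in (Metric.ball (0 : E n) ρ)ᶜ, |f (y + ξ)| * jumpKernel s ξ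
      ≤ C ^ ((n : ℝ) + 2 * s) * ∫ z : E n, |f z| / (R + ‖z‖) ^ ((n : ℝ) + 2 * s) := by
  have hi := (hf.integrable_div hs hR hc.aestronglyMeasurable).const_mul (C ^ ((n : ℝ) + 2 * s))
  rw [← integral_const_mul, ← integral_add_left_eq_self
      (fun z : E n => C ^ ((n : ℝ) + 2 * s) * (|f z| / (R + ‖z‖) ^ ((n : ℝ) + 2 * s))) y]
  refine le_trans ?_ (setIntegral_le_integral (s := (Metric.ball (0 : E n) ρ)ᶜ)
    (hi.comp_add_left y) (.of_forall fun y => ?_))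
  · refine integral_mono_of_nonneg (.of_forall fun ξ => mul_nonneg (abs_nonneg _) (jumpKernel_nonneg _))
      (hi.comp_add_left y).integrableOn ?_
    filter_upwards [self_mem_ae_restrict measurableSet_ball.compl] with ξ hξ
    have := mul_le_mul_of_nonneg_left (jumpKernel_le_weight hs (by linarith) hC (h ξ hξ))
      (abs_nonneg (f (y + ξ)))
    refine this.trans (le_of_eq ?_)
    rw [div_eq_mul_inv]; ring
  · have : 0 ≤ R := by linarith
    simp only [Pi.zero_apply]
    positivity

/-! ### A barrier that blows up on a sphere -/

lemma pow_le_quadratic (N : ℕ) : ∃ D : ℝ, 0 ≤ D ∧ ∀ σ : ℝ, 0 ≤ σ → σ ≤ 2 →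
    σ ^ N ≤ 1 + N * (σ - 1) + D * (σ - 1) ^ 2 := by
  induction N with
  | zero => exact ⟨0, le_rfl, fun σ _ _ => by simp⟩
  | succ N ih =>
    obtain ⟨D, hD, h⟩ := ih
    refine ⟨N + 2 * D, by positivity, fun σ h0 h2 => ?_⟩
    have h1 := mul_le_mul_of_nonneg_left (h σ h0 h2) h0
    rw [pow_succ']
    push_cast
    nlinarith [mul_nonneg (mul_nonneg hD (sq_nonneg (σ - 1))) (sub_nonneg.2 h2)]

lemma inv_one_sub_pow_le (N : ℕ) : ∃ D : ℝ, 0 ≤ D ∧ ∀ θ : ℝ, |θ| ≤ 1 / 2 →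
    ((1 - θ)⁻¹) ^ N ≤ 1 + N * θ + D * θ ^ 2 := by
  obtain ⟨D, hD, hpow⟩ := pow_le_quadratic N
  refine ⟨2 * N + 4 * D, by positivity, fun θ hθ1 => ?_⟩
  obtain ⟨hθ2, hθ3⟩ := abs_le.1 hθ1
  have h1θ : 0 < 1 - θ := by linarith
  set σ := (1 - θ)⁻¹ with hσ
  have hσθ : σ * (1 - θ) = 1 := inv_mul_cancel₀ h1θ.ne'
  have hσ0 : 0 < σ := by positivity
  have hσ2 : σ ≤ 2 := by nlinarith
  have hσ1 : σ - 1 = θ * σ := by linarith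
  refine (hpow σ hσ0.le hσ2).trans ?_
  have e1 : σ - 1 ≤ θ + 2 * θ ^ 2 := by
    have e : σ - 1 = θ + θ ^ 2 * σ := by
      have : θ ^ 2 * σ = θ * (σ - 1) := by rw [hσ1]; ring
      rw [this]; linarith
    rw [e]
    have := mul_le_mul_of_nonneg_left hσ2 (sq_nonneg θ)
    linarith
  have e2 : (σ - 1) ^ 2 ≤ 4 * θ ^ 2 := by
    rw [hσ1, mul_pow]
    have : σ ^ 2 ≤ 4 := by nlinarith
    nlinarith [sq_nonneg θ]
  have e3 := mul_le_mul_of_nonneg_left e1 (Nat.cast_nonneg (α := ℝ) N)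
  have e4 := mul_le_mul_of_nonneg_left e2 hD
  linarith

/-- The profile `1/(1-|x|²/R²)` of the barrier in `B_R`. -/
noncomputable def profile {n : ℕ} (R : ℝ) (x : E n) : ℝ := (1 - ‖x‖ ^ 2 / R ^ 2)⁻¹

lemma profile_denom {R : ℝ} (hR : 0 < R) {x : E n} (hx : ‖x‖ < R) :
    0 < 1 - ‖x‖ ^ 2 / R ^ 2 ∧ 1 - ‖x‖ ^ 2 / R ^ 2 ≤ 1 := by
  have h0 := norm_nonneg x
  constructor
  · rw [sub_pos, div_lt_one (by positivity)]
    gcongr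
  · have : 0 ≤ ‖x‖ ^ 2 / R ^ 2 := by positivity
    linarith

lemma one_le_profile {R : ℝ} (hR : 0 < R) {x : E n} (hx : ‖x‖ < R) : 1 ≤ profile R x :=
  (one_le_inv₀ (profile_denom hR hx).1).2 (profile_denom hR hx).2

/-- Second-order upper bound for powers of the profile, on the natural scale `R / profile R x`. -/
lemma profile_pow_le (N : ℕ) : ∃ C : ℝ, 0 ≤ C ∧ ∀ (R : ℝ) (x ξ : E n), 0 < R → ‖x‖ < R →
    ‖ξ‖ ≤ R / (8 * profile R x) → ‖x + ξ‖ < R ∧ profile R (x + ξ) ^ N ≤ profile R x ^ N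
      + inner ℝ ((2 * N * profile R x ^ (N + 1) / R ^ 2) • x) ξ
      + C * profile R x ^ (N + 2) / R ^ 2 * ‖ξ‖ ^ 2 := by
  obtain ⟨D, hD, hpow⟩ := inv_one_sub_pow_le N
  refine ⟨N + 9 * D, by positivity, fun R x ξ hR hx hξ => ?_⟩
  obtain ⟨hq, hq1⟩ := profile_denom hR hx
  have hQ : profile R x = (1 - ‖x‖ ^ 2 / R ^ 2)⁻¹ := rfl
  set q := 1 - ‖x‖ ^ 2 / R ^ 2 with hqdef
  have hξ' : ‖ξ‖ ≤ R * q / 8 := by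
    rw [hQ] at hξ
    refine hξ.trans (le_of_eq ?_)
    field_simp
  have hξR : ‖ξ‖ ≤ R := by nlinarith
  have h0 := norm_nonneg ξ
  have h0x := norm_nonneg x
  set m := (2 * inner ℝ x ξ + ‖ξ‖ ^ 2) / R ^ 2 with hm
  have hnorm : ‖x + ξ‖ ^ 2 = ‖x‖ ^ 2 + 2 * inner ℝ x ξ + ‖ξ‖ ^ 2 := norm_add_sq_real x ξ
  have hq' : 1 - ‖x + ξ‖ ^ 2 / R ^ 2 = q - m := by
    rw [hnorm, hqdef, hm]; ring
  have hin : |inner ℝ x ξ| ≤ R * ‖ξ‖ := (abs_real_inner_le_norm x ξ).trans (by gcongr)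
  have hmabs : |m| ≤ 3 * ‖ξ‖ / R := by
    rw [hm, abs_div, abs_of_pos (by positivity : (0 : ℝ) < R ^ 2),
      div_le_div_iff₀ (by positivity) hR]
    have : |2 * inner ℝ x ξ + ‖ξ‖ ^ 2| ≤ 3 * ‖ξ‖ * R := by
      obtain ⟨h1, h2⟩ := abs_le.1 hin
      rw [abs_le]; constructor <;> nlinarith
    nlinarith
  have hmq : |m| ≤ q / 2 := by
    refine hmabs.trans ?_
    rw [div_le_iff₀ hR]; nlinarith
  obtain ⟨hm1, hm2⟩ := abs_le.1 hmq
  have hqm : 0 < q - m := by linarith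
  have hlt : ‖x + ξ‖ < R := by
    have : ‖x + ξ‖ ^ 2 / R ^ 2 < 1 := by linarith
    rw [div_lt_one (by positivity)] at this
    exact lt_of_pow_lt_pow_left₀ 2 hR.le this
  refine ⟨hlt, ?_⟩
  -- `θ` is the relative change of the denominator of the profile
  set θ := m / q with hθ
  have hθ1 : |θ| ≤ 1 / 2 := by
    rw [hθ, abs_div, abs_of_pos hq, div_le_iff₀ hq]; linarith
  have hstep := hpow θ hθ1
  have hprof : profile R (x + ξ) = profile R x * (1 - θ)⁻¹ := by
    rw [profile, hq', hQ, ← mul_inv, hθ]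
    congr 1
    field_simp
  rw [hprof, mul_pow]
  have hP : 0 ≤ profile R x ^ N := by rw [hQ]; positivity
  have hP1 : 1 ≤ profile R x := one_le_profile hR hx
  refine (mul_le_mul_of_nonneg_left hstep hP).trans ?_
  have hθQ : θ = m * profile R x := by rw [hQ, hθ, div_eq_mul_inv]
  have hθsq : θ ^ 2 ≤ 9 * ‖ξ‖ ^ 2 / R ^ 2 * profile R x ^ 2 := by
    rw [hθQ, mul_pow]
    gcongr
    rw [← sq_abs]
    calc |m| ^ 2 ≤ (3 * ‖ξ‖ / R) ^ 2 := by gcongr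
      _ = _ := by ring
  have hξ2 : ‖ξ‖ ^ 2 / R ^ 2 * profile R x ≤ ‖ξ‖ ^ 2 / R ^ 2 * profile R x ^ 2 := by
    gcongr
    nlinarith
  rw [inner_smul_left]
  simp only [conj_trivial]
  have hkey : (N : ℝ) * θ + D * θ ^ 2 ≤ 2 * N * profile R x / R ^ 2 * inner ℝ x ξ
      + (N + 9 * D) * (‖ξ‖ ^ 2 / R ^ 2 * profile R x ^ 2) := by
    have e1 : (N : ℝ) * θ = 2 * N * profile R x / R ^ 2 * inner ℝ x ξ
        + N * (‖ξ‖ ^ 2 / R ^ 2 * profile R x) := by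
      rw [hθQ, hm]; ring
    have e2 := mul_le_mul_of_nonneg_left hθsq hD
    have e3 := mul_le_mul_of_nonneg_left hξ2 (Nat.cast_nonneg (α := ℝ) N)
    rw [e1]
    have e4 : D * (9 * ‖ξ‖ ^ 2 / R ^ 2 * profile R x ^ 2)
        = 9 * D * (‖ξ‖ ^ 2 / R ^ 2 * profile R x ^ 2) := by ring
    linarith
  have := mul_le_mul_of_nonneg_left hkey hP
  calc _ = profile R x ^ N + profile R x ^ N * (N * θ + D * θ ^ 2) := by ring
    _ ≤ _ := add_le_add_right this _
    _ = _ := by ring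

/-- The balance of the barrier: its blow-up dominates the second-order and tail terms. -/
lemma barrier_balance (hn : 0 < n) (hs0 : 0 < s) (hs1 : s < 1) {Q δ κ K ε : ℝ} (hQ : 1 ≤ Q) (hδ : 0 < δ)
    (hκ : 0 < κ) (hε : ε = 64 * (δ * κ)) (hK : K ≤ δ * κ / 4) :
    0 < ε + δ * κ * Q ^ (2 * s) * (Q ^ n / 2 - 1) - K * (Q ^ n * Q ^ (2 * s)) := by
  have hδκ : 0 < δ * κ := by positivity
  have h1 : 1 ≤ Q ^ n := one_le_pow₀ hQ
  have hP : 0 < Q ^ (2 * s) := by positivity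
  have hKm : K * (Q ^ n * Q ^ (2 * s)) ≤ δ * κ / 4 * (Q ^ n * Q ^ (2 * s)) := by gcongr
  rcases le_total 4 (Q ^ n) with h4 | h4
  · have : 0 ≤ δ * κ * Q ^ (2 * s) * (Q ^ n / 4 - 1) := by
      apply mul_nonneg (by positivity); linarith
    nlinarith
  · have hQ4 : Q ≤ 4 := (le_self_pow₀ hQ hn.ne').trans h4
    have hP16 : Q ^ (2 * s) ≤ 16 := by
      calc Q ^ (2 * s) ≤ Q ^ (2 : ℝ) := Real.rpow_le_rpow_of_exponent_le hQ (by linarith)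
        _ = Q ^ 2 := by norm_cast
        _ ≤ 16 := by nlinarith
    have e1 : Q ^ n * Q ^ (2 * s) ≤ 64 := by nlinarith
    have e2 : δ * κ * Q ^ (2 * s) * (Q ^ n / 2 - 1) ≥ -(δ * κ * 16) := by
      have : δ * κ * Q ^ (2 * s) ≤ δ * κ * 16 := by gcongr
      have h0 : 0 < δ * κ * Q ^ (2 * s) := by positivity
      nlinarith
    nlinarith

/-! ### Doubling of variables -/

/-- The functional maximized in the doubling argument: one copy `(t, x)` of the variables for the
subsolution `u`, and one copy `(τ i, y i)` for each supersolution `v i`. -/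
noncomputable def doubling {ι : Type*} [Fintype ι] (lam : ι → ℝ) (u : ℝ → E n → ℝ)
    (v : ι → ℝ → E n → ℝ) (b : ℝ → E n → ℝ) (k : ℝ) (t : ℝ) (x : E n) (τ : ι → ℝ) (y : ι → E n) :
    ℝ :=
  u t x - ∑ i, lam i * (v i (τ i) (y i) + k * (‖x - y i‖ ^ 2 + (t - τ i) ^ 2)) - b t x

section

variable {ι : Type*} [Fintype ι] {lam : ι → ℝ} {u : ℝ → E n → ℝ} {v : ι → ℝ → E n → ℝ}
  {b : ℝ → E n → ℝ}

lemma doubling_diag (k t : ℝ) (x : E n) :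
    doubling lam u v b k t x (fun _ => t) (fun _ => x) = u t x - ∑ i, lam i * v i t x - b t x := by
  simp [doubling]

/-- Uniform continuity of finitely many functions on a compact set, with a common modulus. -/
lemma exists_uniform_radius {X : Type*} [PseudoMetricSpace X] {κ : Type*} [Finite κ] {S : Set X}
    (hS : IsCompact S) (f : κ → X → ℝ) (hf : ∀ i, ContinuousOn (f i) S) {ε : ℝ} (hε : 0 < ε) :
    ∃ ρ > 0, ∀ i, ∀ p ∈ S, ∀ q ∈ S, dist p q < ρ → |f i p - f i q| < ε := by
  have h : ∀ᶠ ρ in 𝓝[>] (0 : ℝ), ∀ i, ∀ p ∈ S, ∀ q ∈ S, dist p q < ρ → |f i p - f i q| < ε := by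
    rw [eventually_all]
    intro i
    obtain ⟨ρ, hρ, h⟩ := Metric.uniformContinuousOn_iff.1
      (hS.uniformContinuousOn_of_continuous (hf i)) ε hε
    filter_upwards [Ioo_mem_nhdsGT hρ] with ρ' hρ' p hp q hq hd
    exact h p hp q hq (hd.trans hρ'.2)
  obtain ⟨ρ, h1, h2⟩ := (h.and self_mem_nhdsWithin).exists
  exact ⟨ρ, h2, h1⟩

/-- Maximum points of the doubling functional, for a large penalization: they are attained at positive
times, the different copies of the variables are close to each other, and so are the obstacles. -/
lemma exists_doubling_max {T R T₁ B₀ θ : ℝ} {Kx : Set (E n)} {ψ : ι → E n → ℝ}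
    (hlam : ∀ i, 0 < lam i) (hsum : ∑ i, lam i = 1)
    (hu : ContinuousOn (fun p : ℝ × E n => u p.1 p.2) (Icc 0 T ×ˢ univ))
    (hv : ∀ i, ContinuousOn (fun p : ℝ × E n => v i p.1 p.2) (Icc 0 T ×ˢ univ))
    (hψ : ∀ i, Continuous (ψ i))
    (hinit : ∀ x, u 0 x ≤ ∑ i, lam i * v i 0 x)
    (hT₁ : T₁ < T) (hKc : IsCompact Kx) (hKx : Kx ⊆ Metric.ball 0 R)
    (hb : ContinuousOn (fun p : ℝ × E n => b p.1 p.2) (Icc 0 T₁ ×ˢ Kx))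
    (hb0 : ∀ t ∈ Ico 0 T, ∀ x ∈ Metric.ball (0 : E n) R, 0 ≤ b t x)
    (hboff : ∀ t ∈ Ico 0 T, ∀ x ∈ Metric.ball (0 : E n) R, (t, x) ∉ Icc 0 T₁ ×ˢ Kx → B₀ ≤ b t x)
    (hB₀ : ∀ t ∈ Icc 0 T, ∀ x ∈ Metric.closedBall (0 : E n) (R + 1), ∀ τ : ι → ℝ, ∀ y : ι → E n,
      (∀ i, τ i ∈ Icc 0 T) → (∀ i, y i ∈ Metric.closedBall (0 : E n) (R + 1)) →
      u t x - ∑ i, lam i * v i (τ i) (y i) ≤ B₀)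
    (hθ : 0 < θ) {t' : ℝ} {x' : E n} (ht' : t' ∈ Ico 0 T) (hx' : x' ∈ Metric.ball 0 R)
    (hpos : θ ≤ u t' x' - ∑ i, lam i * v i t' x' - b t' x') :
    ∃ k t x τ y, 0 ≤ k ∧ t ∈ Ioo 0 T ∧ ‖x‖ < R ∧ (∀ i, τ i ∈ Ioo 0 T) ∧ (∀ i, ‖x - y i‖ < 1) ∧
      (∀ i, |ψ i (y i) - ψ i x| < θ / 2) ∧ θ ≤ doubling lam u v b k t x τ y ∧
      ∀ t₁ ∈ Ico 0 T, ∀ x₁ ∈ Metric.ball (0 : E n) R, ∀ τ₁ : ι → ℝ, (∀ i, τ₁ i ∈ Icc 0 T) →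
        ∀ y₁ : ι → E n, (∀ i, y₁ i ∈ Metric.closedBall (0 : E n) (R + 1)) →
        doubling lam u v b k t₁ x₁ τ₁ y₁ ≤ doubling lam u v b k t x τ y := by
  have hRb : Metric.ball (0 : E n) R ⊆ Metric.closedBall 0 (R + 1) :=
    Metric.ball_subset_closedBall.trans (Metric.closedBall_subset_closedBall (by linarith))
  have hle : ∀ k : ℝ, 0 ≤ k → ∀ t x (τ : ι → ℝ) (y : ι → E n),
      doubling lam u v b k t x τ y ≤ u t x - ∑ i, lam i * v i (τ i) (y i) - b t x := by
    intro k hk t x τ y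
    unfold doubling
    gcongr with i
    · exact (hlam i).le
    · have : 0 ≤ k * (‖x - y i‖ ^ 2 + (t - τ i) ^ 2) := by positivity
      linarith
  -- off the compact set the functional is nonpositive
  have hoff : ∀ k : ℝ, 0 ≤ k → ∀ t ∈ Ico 0 T, ∀ x ∈ Metric.ball (0 : E n) R, ∀ τ : ι → ℝ,
      (∀ i, τ i ∈ Icc 0 T) → ∀ y : ι → E n, (∀ i, y i ∈ Metric.closedBall (0 : E n) (R + 1)) →
      (t, x) ∉ Icc 0 T₁ ×ˢ Kx → doubling lam u v b k t x τ y ≤ 0 := by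
    intro k hk t ht x hx τ hτ y hy hn
    have h1 := hle k hk t x τ y
    have h2 := hB₀ t ⟨ht.1, ht.2.le⟩ x (hRb hx) τ y hτ hy
    have h3 := hboff t ht x hx hn
    linarith
  set S : Set ((ℝ × E n) × ((ι → ℝ) × (ι → E n))) := (Icc 0 T₁ ×ˢ Kx) ×ˢ
    ((Set.univ.pi fun _ => Icc 0 T) ×ˢ (Set.univ.pi fun _ => Metric.closedBall (0 : E n) (R + 1)))
    with hS
  have hSc : IsCompact S := (isCompact_Icc.prod hKc).prod
    ((isCompact_univ_pi fun _ => isCompact_Icc).prod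
      (isCompact_univ_pi fun _ => isCompact_closedBall _ _))
  have hcont : ∀ k, ContinuousOn (fun z : (ℝ × E n) × ((ι → ℝ) × (ι → E n)) =>
      doubling lam u v b k z.1.1 z.1.2 z.2.1 z.2.2) S := by
    intro k
    unfold doubling
    refine ContinuousOn.sub (ContinuousOn.sub ?_ (continuousOn_finsetSum _ fun i _ =>
      continuousOn_const.mul (ContinuousOn.add ?_ ?_))) ?_
    · exact hu.comp continuousOn_fst fun z hz => ⟨⟨hz.1.1.1, hz.1.1.2.trans hT₁.le⟩, mem_univ _⟩
    · exact (hv i).comp (f := fun z : (ℝ × E n) × ((ι → ℝ) × (ι → E n)) => (z.2.1 i, z.2.2 i))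
        (by fun_prop) fun z hz => ⟨hz.2.1 i (mem_univ _), mem_univ _⟩
    · fun_prop
    · exact hb.comp continuousOn_fst fun z hz => hz.1
  have hx'K : (t', x') ∈ Icc 0 T₁ ×ˢ Kx := by
    by_contra hcon
    have := hoff 0 le_rfl t' ht' x' hx' (fun _ => t') (fun _ => ⟨ht'.1, ht'.2.le⟩) (fun _ => x')
      (fun _ => hRb hx') hcon
    rw [doubling_diag] at this
    linarith
  have hz'S : ((t', x'), ((fun _ : ι => t'), (fun _ : ι => x'))) ∈ S :=
    ⟨hx'K, ⟨fun _ _ => ⟨ht'.1, ht'.2.le⟩, fun _ _ => hRb hx'⟩⟩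
  -- a common modulus of continuity
  have hS₂ : IsCompact (Icc 0 T ×ˢ Metric.closedBall (0 : E n) (R + 1)) :=
    isCompact_Icc.prod (isCompact_closedBall _ _)
  have hsub₂ : Icc 0 T ×ˢ Metric.closedBall (0 : E n) (R + 1) ⊆ Icc 0 T ×ˢ univ :=
    prod_mono le_rfl (subset_univ _)
  obtain ⟨ρ₁, hρ₁, hmod₁⟩ := exists_uniform_radius hS₂
    (fun i : Option ι => i.elim (fun p : ℝ × E n => u p.1 p.2) fun i p => v i p.1 p.2)
    (fun i => by cases i with
      | none => exact hu.mono hsub₂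
      | some i => exact (hv i).mono hsub₂) (show 0 < θ / 4 by linarith)
  obtain ⟨ρ₂, hρ₂, hmod₂⟩ := exists_uniform_radius (isCompact_closedBall (0 : E n) (R + 1)) ψ
    (fun i => (hψ i).continuousOn) (show 0 < θ / 2 by linarith)
  set ρ := min (min ρ₁ ρ₂) (min 1 (T - T₁)) with hρdef
  have hρ : 0 < ρ := lt_min (lt_min hρ₁ hρ₂) (lt_min one_pos (by linarith))
  have hρ1 : ρ ≤ ρ₁ := (min_le_left _ _).trans (min_le_left _ _)
  have hρ2 : ρ ≤ ρ₂ := (min_le_left _ _).trans (min_le_right _ _)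
  have hρ3 : ρ ≤ 1 := (min_le_right _ _).trans (min_le_left _ _)
  have hρ4 : ρ ≤ T - T₁ := (min_le_right _ _).trans (min_le_right _ _)
  obtain ⟨k, hk⟩ : ∃ k : ℝ, 0 < k ∧ ∀ i, B₀ < lam i * (k * (ρ / 2) ^ 2) := by
    have : ∀ᶠ k : ℝ in atTop, ∀ i, B₀ < lam i * (k * (ρ / 2) ^ 2) := by
      rw [eventually_all]
      intro i
      exact ((tendsto_id.atTop_mul_const (by positivity : 0 < (ρ / 2) ^ 2)).const_mul_atTop
        (hlam i)).eventually_gt_atTop B₀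
    exact ((eventually_gt_atTop 0).and this).exists
  obtain ⟨hk0, hk⟩ := hk
  obtain ⟨⟨⟨t, x⟩, ⟨τ, y⟩⟩, hzS, hmax⟩ := hSc.exists_isMaxOn ⟨_, hz'S⟩ (hcont k)
  have hθz : θ ≤ doubling lam u v b k t x τ y := by
    have := hmax hz'S
    simp only [mem_ofPred_eq] at this
    rw [doubling_diag] at this
    exact hpos.trans this
  have ht : t ∈ Icc 0 T₁ := hzS.1.1
  have hxK : x ∈ Kx := hzS.1.2
  have hxR := hKx hxK
  have hτ : ∀ i, τ i ∈ Icc 0 T := fun i => hzS.2.1 i (mem_univ _)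
  have hy : ∀ i, y i ∈ Metric.closedBall (0 : E n) (R + 1) := fun i => hzS.2.2 i (mem_univ _)
  have htT : t ∈ Ico 0 T := ⟨ht.1, ht.2.trans_lt hT₁⟩
  have hbz := hb0 t htT x hxR
  -- the penalization is bounded
  have hclose : ∀ i, ‖x - y i‖ ^ 2 + (t - τ i) ^ 2 < (ρ / 2) ^ 2 := by
    intro i
    have h1 : lam i * (k * (‖x - y i‖ ^ 2 + (t - τ i) ^ 2))
        ≤ ∑ j, lam j * (k * (‖x - y j‖ ^ 2 + (t - τ j) ^ 2)) :=
      Finset.single_le_sum (f := fun j => lam j * (k * (‖x - y j‖ ^ 2 + (t - τ j) ^ 2)))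
        (fun j _ => mul_nonneg (hlam j).le (by positivity)) (Finset.mem_univ i)
    have h2 := hB₀ t ⟨htT.1, htT.2.le⟩ x (hRb hxR) τ y hτ hy
    have h3 : doubling lam u v b k t x τ y = u t x - ∑ i, lam i * v i (τ i) (y i) - b t x
        - ∑ j, lam j * (k * (‖x - y j‖ ^ 2 + (t - τ j) ^ 2)) := by
      unfold doubling
      simp only [mul_add, Finset.sum_add_distrib]
      ring
    have h4 : lam i * (k * (‖x - y i‖ ^ 2 + (t - τ i) ^ 2)) < lam i * (k * (ρ / 2) ^ 2) :=
      lt_of_le_of_lt (by linarith) (hk i)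
    exact lt_of_mul_lt_mul_left (lt_of_mul_lt_mul_left h4 (hlam i).le) hk0.le
  have hxy : ∀ i, ‖x - y i‖ < ρ / 2 := fun i =>
    lt_of_pow_lt_pow_left₀ 2 (by positivity) (by nlinarith [hclose i, sq_nonneg (t - τ i)])
  have htτ : ∀ i, |t - τ i| < ρ / 2 := fun i =>
    abs_lt_of_sq_lt_sq (by nlinarith [hclose i, sq_nonneg ‖x - y i‖]) (by positivity)
  have hgap : θ ≤ u t x - ∑ i, lam i * v i (τ i) (y i) := by
    have := hle k hk0.le t x τ y
    linarith
  -- the maximum is attained at a time that is bounded away from `0`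
  have htpos : ρ / 2 ≤ t := by
    by_contra! hlt
    have h0T : (0 : ℝ) ∈ Icc 0 T := ⟨le_rfl, ht'.1.trans ht'.2.le⟩
    have e1 := hmod₁ none (t, x) ⟨⟨htT.1, htT.2.le⟩, hRb hxR⟩ (0, x) ⟨h0T, hRb hxR⟩ (by
      rw [Prod.dist_eq]
      simp only [Real.dist_eq, sub_zero, dist_self]
      rw [abs_of_nonneg ht.1]
      exact max_lt (by linarith) hρ₁)
    have e2 : ∀ i, v i 0 x - θ / 4 ≤ v i (τ i) (y i) := by
      intro i
      have := hmod₁ (some i) (τ i, y i) ⟨hτ i, hy i⟩ (0, x) ⟨h0T, hRb hxR⟩ (by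
        rw [Prod.dist_eq]
        simp only [Real.dist_eq, sub_zero]
        rw [dist_comm, dist_eq_norm, abs_of_nonneg (hτ i).1]
        have h1 := hxy i
        have h2 := (abs_lt.1 (htτ i)).1
        exact max_lt (by linarith) (by linarith))
      have := (abs_lt.1 this).1
      simp only [Option.elim] at this
      linarith
    have e3 : ∑ i, lam i * v i 0 x - θ / 4 ≤ ∑ i, lam i * v i (τ i) (y i) := by
      calc _ = ∑ i, lam i * (v i 0 x - θ / 4) := by
            simp only [mul_sub, Finset.sum_sub_distrib, ← Finset.sum_mul, hsum, one_mul]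
        _ ≤ _ := Finset.sum_le_sum fun i _ => mul_le_mul_of_nonneg_left (e2 i) (hlam i).le
    have e4 := (abs_lt.1 e1).2
    simp only [Option.elim] at e4
    have := hinit x
    linarith
  refine ⟨k, t, x, τ, y, hk0.le, ⟨by linarith, htT.2⟩, by simpa using hxR, fun i => ?_, fun i => ?_,
    fun i => ?_, hθz, fun t₁ ht₁ x₁ hx₁ τ₁ hτ₁ y₁ hy₁ => ?_⟩
  · have h := abs_lt.1 (htτ i)
    have h1 := ht.2
    exact ⟨by linarith [h.2], by linarith [h.1]⟩
  · have := hxy i; linarith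
  · refine hmod₂ i _ (hy i) _ (hRb hxR) ?_
    rw [dist_comm, dist_eq_norm]
    have := hxy i; linarith
  · by_cases hmem : (t₁, x₁) ∈ Icc 0 T₁ ×ˢ Kx
    · exact hmax (show ((t₁, x₁), (τ₁, y₁)) ∈ S from
        ⟨hmem, fun i _ => hτ₁ i, fun i _ => hy₁ i⟩)
    · have := hoff k hk0.le t₁ ht₁ x₁ hx₁ τ₁ hτ₁ y₁ hy₁ hmem
      linarith

/-- At a maximum point of the doubling functional the sub- and supersolution inequalities combine into
one inequality, in which the penalization has dropped out. -/
lemma eventually_doubling_le {T R k θ t : ℝ} {x : E n} {τ : ι → ℝ} {y : ι → E n}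
    {ψu : E n → ℝ} {ψ : ι → E n → ℝ} (hlam : ∀ i, 0 < lam i) (hsum : ∑ i, lam i = 1)
    (hsub : PointwiseSub s T ψu u) (hsup : ∀ i, PointwiseSuper s T (ψ i) (v i))
    (hψu : ∀ x, ψu x ≤ ∑ i, lam i * ψ i x) (hk : 0 ≤ k) (ht : t ∈ Ioo 0 T) (hx : ‖x‖ < R)
    (hτ : ∀ i, τ i ∈ Ioo 0 T) (hy : ∀ i, ‖x - y i‖ < 1)
    (hψ : ∀ i, |ψ i (y i) - ψ i x| < θ / 2) (hθ : 0 < θ) (hb0 : 0 ≤ b t x)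
    (hpos : θ ≤ doubling lam u v b k t x τ y)
    (hmax : ∀ t₁ ∈ Ico 0 T, ∀ x₁ ∈ Metric.ball (0 : E n) R, ∀ τ₁ : ι → ℝ, (∀ i, τ₁ i ∈ Icc 0 T) →
        ∀ y₁ : ι → E n, (∀ i, y₁ i ∈ Metric.closedBall (0 : E n) (R + 1)) →
        doubling lam u v b k t₁ x₁ τ₁ y₁ ≤ doubling lam u v b k t x τ y)
    {bt Bt Ab : ℝ} {pb : E n}
    (hbq : ∀ᶠ q : ℝ × E n in 𝓝 (t, x), b q.1 q.2 ≤ quadTest t x (b t x) bt Bt pb Ab q.1 q.2)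
    {η : ℝ} (hη : 0 < η) :
    ∀ᶠ r in 𝓝[>] (0 : ℝ),
      bt + trunc s r (u t) x - ∑ i, lam i * trunc s r (v i (τ i)) (y i) ≤ η := by
  classical
  have hτI : ∀ i, τ i ∈ Icc 0 T := fun i => Ioo_subset_Icc_self (hτ i)
  have hyB : ∀ i, y i ∈ Metric.ball (0 : E n) (R + 1) := by
    intro i
    have h1 : ‖y i‖ ≤ ‖x‖ + ‖x - y i‖ := by
      have := norm_sub_norm_le (y i) x
      rw [norm_sub_rev] at this; linarith
    have := hy i
    simp only [Metric.mem_ball, dist_zero_right]; linarith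
  have hyC : ∀ i, y i ∈ Metric.closedBall (0 : E n) (R + 1) :=
    fun i => Metric.ball_subset_closedBall (hyB i)
  -- each supersolution is touched from below
  have hv : ∀ i, ψ i (y i) ≤ v i (τ i) (y i) ∧ ∀ η > 0, ∀ᶠ r in 𝓝[>] (0 : ℝ),
      -η ≤ 2 * k * (t - τ i) + trunc s r (v i (τ i)) (y i) := by
    intro i
    refine hsup i (τ i) (hτ i) (y i) _ k ((2 * k) • (x - y i)) k ?_
    have h1 : ∀ᶠ q : ℝ × E n in 𝓝 (τ i, y i), q.1 ∈ Ioo 0 T ∧ q.2 ∈ Metric.ball (0 : E n) (R + 1) :=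
      (isOpen_Ioo.prod Metric.isOpen_ball).mem_nhds ⟨hτ i, hyB i⟩
    filter_upwards [h1] with q hq
    have h2 := hmax t ⟨ht.1.le, ht.2⟩ x (by simpa using hx) (Function.update τ i q.1) (fun j => by
      by_cases h : j = i
      · subst h; simpa using Ioo_subset_Icc_self hq.1
      · simpa [h] using hτI j) (Function.update y i q.2) (fun j => by
      by_cases h : j = i
      · subst h; simpa using (Metric.ball_subset_closedBall hq.2)
      · simpa [h] using hyC j)
    unfold doubling at h2
    rw [← Finset.add_sum_erase Finset.univ _ (Finset.mem_univ i),
      ← Finset.add_sum_erase Finset.univ (fun j => lam j * (v j (τ j) (y j) +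
        k * (‖x - y j‖ ^ 2 + (t - τ j) ^ 2))) (Finset.mem_univ i),
      Finset.sum_congr rfl (fun j hj => by
        rw [Function.update_of_ne (Finset.ne_of_mem_erase hj),
          Function.update_of_ne (Finset.ne_of_mem_erase hj)])] at h2
    simp only [Function.update_self] at h2
    have h3 : lam i * (v i (τ i) (y i) + k * (‖x - y i‖ ^ 2 + (t - τ i) ^ 2))
        ≤ lam i * (v i q.1 q.2 + k * (‖x - q.2‖ ^ 2 + (t - q.1) ^ 2)) := by linarith
    have h4 := le_of_mul_le_mul_left h3 (hlam i)
    have h5 : ‖x - q.2‖ ^ 2 = ‖x - y i‖ ^ 2 - 2 * inner ℝ (x - y i) (q.2 - y i) + ‖q.2 - y i‖ ^ 2 := by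
      rw [← norm_sub_sq_real]; congr 2; abel
    rw [h5] at h4
    simp only [quadTest, inner_smul_left, conj_trivial]
    nlinarith
  have hgap : θ ≤ u t x - ∑ i, lam i * v i (τ i) (y i) := by
    unfold doubling at hpos
    have : ∑ i, lam i * v i (τ i) (y i)
        ≤ ∑ i, lam i * (v i (τ i) (y i) + k * (‖x - y i‖ ^ 2 + (t - τ i) ^ 2)) :=
      Finset.sum_le_sum fun i _ => mul_le_mul_of_nonneg_left
        (by have : 0 ≤ k * (‖x - y i‖ ^ 2 + (t - τ i) ^ 2) := by positivity
            linarith) (hlam i).le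
    linarith
  -- hence the subsolution lies above its obstacle
  have hobs : ψu x < u t x := by
    have h1 : ∑ i, lam i * ψ i x - θ / 2 ≤ ∑ i, lam i * v i (τ i) (y i) := by
      calc _ = ∑ i, lam i * (ψ i x - θ / 2) := by
            simp only [mul_sub, Finset.sum_sub_distrib, ← Finset.sum_mul, hsum, one_mul]
        _ ≤ _ := Finset.sum_le_sum fun i _ => mul_le_mul_of_nonneg_left
          (by have := (abs_lt.1 (hψ i)).1; have := (hv i).1; linarith) (hlam i).le
    have := hψu x
    linarith
  -- the subsolution is touched from above
  have hu : ∀ᶠ q : ℝ × E n in 𝓝 (t, x), u q.1 q.2 ≤ quadTest t x (u t x)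
      (∑ i, lam i * (2 * k * (t - τ i)) + bt) (k + Bt)
      (∑ i, (lam i * (2 * k)) • (x - y i) + pb) (k + Ab) q.1 q.2 := by
    have h1 : ∀ᶠ q : ℝ × E n in 𝓝 (t, x), q.1 ∈ Ioo 0 T ∧ q.2 ∈ Metric.ball (0 : E n) R :=
      (isOpen_Ioo.prod Metric.isOpen_ball).mem_nhds ⟨ht, by simpa using hx⟩
    filter_upwards [h1, hbq] with q hq hbq
    have h2 := hmax q.1 ⟨hq.1.1.le, hq.1.2⟩ q.2 hq.2 τ hτI y hyC
    unfold doubling at h2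
    have h3 : ∑ i, lam i * (v i (τ i) (y i) + k * (‖q.2 - y i‖ ^ 2 + (q.1 - τ i) ^ 2))
        = ∑ i, lam i * (v i (τ i) (y i) + k * (‖x - y i‖ ^ 2 + (t - τ i) ^ 2))
          + (∑ i, lam i * (2 * k * (t - τ i))) * (q.1 - t)
          + inner ℝ (∑ i, (lam i * (2 * k)) • (x - y i)) (q.2 - x)
          + k * (q.1 - t) ^ 2 + k * ‖q.2 - x‖ ^ 2 := by
      have e1 : k * (q.1 - t) ^ 2 + k * ‖q.2 - x‖ ^ 2
          = ∑ i, lam i * (k * (q.1 - t) ^ 2 + k * ‖q.2 - x‖ ^ 2) := by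
        rw [← Finset.sum_mul, hsum, one_mul]
      rw [add_assoc, e1, sum_inner, Finset.sum_mul, ← Finset.sum_add_distrib,
        ← Finset.sum_add_distrib, ← Finset.sum_add_distrib]
      refine Finset.sum_congr rfl fun i _ => ?_
      have h5 : ‖q.2 - y i‖ ^ 2
          = ‖x - y i‖ ^ 2 + 2 * inner ℝ (x - y i) (q.2 - x) + ‖q.2 - x‖ ^ 2 := by
        rw [← norm_add_sq_real]; congr 2; abel
      rw [h5, inner_smul_left]
      simp only [conj_trivial]
      ring
    simp only [quadTest] at hbq ⊢
    rw [inner_add_left]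
    linarith
  have h1 := hsub t ht x _ _ _ _ hu hobs (η / 2) (half_pos hη)
  have h2 : ∀ᶠ r in 𝓝[>] (0 : ℝ), ∀ i, -(η / 2) ≤ 2 * k * (t - τ i) + trunc s r (v i (τ i)) (y i) := by
    rw [eventually_all]
    exact fun i => (hv i).2 (η / 2) (half_pos hη)
  filter_upwards [h1, h2] with r h1 h2
  have h3 : -(η / 2) ≤ ∑ i, lam i * (2 * k * (t - τ i) + trunc s r (v i (τ i)) (y i)) := by
    calc -(η / 2) = ∑ i, lam i * -(η / 2) := by rw [← Finset.sum_mul, hsum, one_mul]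
      _ ≤ _ := Finset.sum_le_sum fun i _ => mul_le_mul_of_nonneg_left (h2 i) (hlam i).le
  simp only [mul_add, Finset.sum_add_distrib] at h3
  linarith

end

/-! ### The comparison principle -/

lemma inv_sub_le_quadratic {γ T t t' : ℝ} (hγ : 0 ≤ γ) (ht : t < T) (h : |t' - t| ≤ (T - t) / 2) :
    γ / (T - t') ≤ γ / (T - t) + γ / (T - t) ^ 2 * (t' - t)
      + 2 * γ / (T - t) ^ 3 * (t' - t) ^ 2 := by
  obtain ⟨h1, h2⟩ := abs_le.1 h
  have hd : 0 < T - t := by linarith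
  have hd' : (T - t) / 2 ≤ T - t' := by linarith
  have hd'' : 0 < T - t' := by linarith
  have e : γ / (T - t') = γ / (T - t) + γ / (T - t) ^ 2 * (t' - t)
      + γ * (t' - t) ^ 2 / ((T - t) ^ 2 * (T - t')) := by
    field_simp
    ring
  have e2 : γ * (t' - t) ^ 2 / ((T - t) ^ 2 * (T - t'))
      ≤ γ * (t' - t) ^ 2 / ((T - t) ^ 2 * ((T - t) / 2)) := by gcongr
  have e3 : γ * (t' - t) ^ 2 / ((T - t) ^ 2 * ((T - t) / 2))
      = 2 * γ / (T - t) ^ 3 * (t' - t) ^ 2 := by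
    field_simp
  linarith

/-- The barrier of the comparison principle: it grows at least linearly in time, and blows up at the
final time and on the sphere `∂B_R`. -/
noncomputable def barrier {n : ℕ} (s T R ε γ δ : ℝ) (t : ℝ) (x : E n) : ℝ :=
  ε * t + γ / (T - t) + δ * R ^ (2 * s) * (profile R x ^ n - 1)

lemma barrier_nonneg {T R ε γ δ t : ℝ} {x : E n} (hε : 0 ≤ ε) (hγ : 0 ≤ γ) (hδ : 0 ≤ δ) (hR : 0 < R)
    (ht : t ∈ Ico 0 T) (hx : ‖x‖ < R) : δ * R ^ (2 * s) * (profile R x ^ n - 1) ≤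
      barrier s T R ε γ δ t x ∧ γ / (T - t) ≤ barrier s T R ε γ δ t x ∧
      0 ≤ barrier s T R ε γ δ t x := by
  have h1 : 0 ≤ ε * t := mul_nonneg hε ht.1
  have h2 : 0 ≤ γ / (T - t) := div_nonneg hγ (by linarith [ht.2])
  have h3 : 0 ≤ δ * R ^ (2 * s) * (profile R x ^ n - 1) :=
    mul_nonneg (by positivity) (by linarith [one_le_pow₀ (n := n) (one_le_profile hR hx)])
  unfold barrier
  refine ⟨?_, ?_, ?_⟩ <;> linarith

/-- The barrier is bounded away from a compact set by any prescribed constant. -/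
lemma exists_barrier_compact (hn : 0 < n) {T R ε γ δ B₀ : ℝ} (hε : 0 ≤ ε) (hγ : 0 < γ) (hδ : 0 < δ)
    (hR : 0 < R) (hB₀ : 0 ≤ B₀) :
    ∃ (T₁ : ℝ) (Kx : Set (E n)), T₁ < T ∧ IsCompact Kx ∧ Kx ⊆ Metric.ball 0 R ∧
      ContinuousOn (fun p : ℝ × E n => barrier s T R ε γ δ p.1 p.2) (Icc 0 T₁ ×ˢ Kx) ∧
      ∀ t ∈ Ico 0 T, ∀ x ∈ Metric.ball (0 : E n) R, (t, x) ∉ Icc 0 T₁ ×ˢ Kx →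
        B₀ ≤ barrier s T R ε γ δ t x := by
  have hδR : 0 < δ * R ^ (2 * s) := by positivity
  set Q₀ := B₀ / (δ * R ^ (2 * s)) + 2 with hQ₀
  have hQ₀pos : 0 < Q₀ := by positivity
  have hcont : Continuous fun x : E n => 1 - ‖x‖ ^ 2 / R ^ 2 := by fun_prop
  have hsub : {x : E n | 1 / Q₀ ≤ 1 - ‖x‖ ^ 2 / R ^ 2} ⊆ Metric.ball 0 R := by
    intro x hx
    have h1 : 1 / Q₀ ≤ 1 - ‖x‖ ^ 2 / R ^ 2 := hx
    have h2 : 0 < 1 / Q₀ := by positivity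
    have h3 : ‖x‖ ^ 2 / R ^ 2 < 1 := by linarith
    rw [div_lt_one (by positivity)] at h3
    simpa using lt_of_pow_lt_pow_left₀ 2 hR.le h3
  have hT₁ : T - γ / (B₀ + 1) < T := by
    have : 0 < γ / (B₀ + 1) := by positivity
    linarith
  refine ⟨T - γ / (B₀ + 1), {x | 1 / Q₀ ≤ 1 - ‖x‖ ^ 2 / R ^ 2}, hT₁, ?_, hsub, ?_, ?_⟩
  · exact (isCompact_closedBall (0 : E n) R).of_isClosed_subset
      (isClosed_le continuous_const hcont) (hsub.trans Metric.ball_subset_closedBall)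
  · unfold barrier profile
    refine ContinuousOn.add (ContinuousOn.add (by fun_prop) ?_) ?_
    · refine continuousOn_const.div (by fun_prop) fun p hp => ?_
      have := hp.1.2
      linarith
    · refine continuousOn_const.mul (ContinuousOn.sub (ContinuousOn.pow (ContinuousOn.inv₀
        (hcont.comp continuous_snd).continuousOn fun p hp => ?_) _) continuousOn_const)
      exact (profile_denom hR (by simpa using hsub hp.2)).1.ne'
  · intro t ht x hx hmem
    have hxR : ‖x‖ < R := by simpa using hx
    obtain ⟨b1, b2, -⟩ := barrier_nonneg (s := s) hε hγ.le hδ.le hR ht hxR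
    by_cases htT : t ≤ T - γ / (B₀ + 1)
    · have hxK : 1 - ‖x‖ ^ 2 / R ^ 2 < 1 / Q₀ := by
        by_contra! hcon
        exact hmem ⟨⟨ht.1, htT⟩, hcon⟩
      have hq := (profile_denom hR hxR).1
      have h1 : Q₀ ≤ profile R x := by
        rw [profile]
        rw [one_div] at hxK
        exact (le_inv_comm₀ hQ₀pos hq).2 hxK.le
      have h2 : profile R x ≤ profile R x ^ n := le_self_pow₀ (one_le_profile hR hxR) hn.ne'
      refine le_trans ?_ b1
      calc B₀ = δ * R ^ (2 * s) * (B₀ / (δ * R ^ (2 * s))) := by field_simp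
        _ ≤ _ := by
          gcongr
          linarith
    · refine le_trans ?_ b2
      have hd : 0 < T - t := by linarith [ht.2]
      rw [le_div_iff₀ hd]
      have h1 : T - t ≤ γ / (B₀ + 1) := by linarith
      rw [le_div_iff₀ (by positivity)] at h1
      nlinarith

lemma barrier_le_quadTest {T R ε γ δ C t : ℝ} {x : E n} (hγ : 0 ≤ γ) (hδ : 0 < δ) (hR : 0 < R)
    (ht : t < T)
    (hprof : ∀ ξ : E n, ‖ξ‖ ≤ R / (8 * profile R x) → ‖x + ξ‖ < R ∧ profile R (x + ξ) ^ n ≤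
      profile R x ^ n + inner ℝ ((2 * n * profile R x ^ (n + 1) / R ^ 2) • x) ξ
      + C * profile R x ^ (n + 2) / R ^ 2 * ‖ξ‖ ^ 2) {t' : ℝ} {ξ : E n}
    (ht' : |t' - t| ≤ (T - t) / 2) (hξ : ‖ξ‖ ≤ R / (8 * profile R x)) :
    barrier s T R ε γ δ t' (x + ξ) ≤ quadTest t x (barrier s T R ε γ δ t x)
      (ε + γ / (T - t) ^ 2) (2 * γ / (T - t) ^ 3)
      ((δ * R ^ (2 * s)) • ((2 * n * profile R x ^ (n + 1) / R ^ 2) • x))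
      (δ * R ^ (2 * s) * (C * profile R x ^ (n + 2) / R ^ 2)) t' (x + ξ) := by
  have h1 := inv_sub_le_quadratic hγ ht ht'
  have h2 := mul_le_mul_of_nonneg_left (hprof ξ hξ).2 (by positivity : 0 ≤ δ * R ^ (2 * s))
  simp only [barrier, quadTest, add_sub_cancel_left, inner_smul_left _ _ (δ * R ^ (2 * s)),
    conj_trivial]
  nlinarith

/-- At a contact point with the barrier, the time derivative of the barrier and its blow-up dominate
the second-order part of the barrier and the tails. -/
lemma barrier_dominates (hn : 0 < n) (hs0 : 0 < s) (hs1 : s < 1) {C c R Q W₀ K₀ δ κ ε k₁ k₂ : ℝ}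
    (hQ1 : 1 ≤ Q) (hδ : 0 < δ) (hκpos : 0 < κ) (hc0 : 0 < c) (hR : 0 < R) (hk₂ : 0 < k₂)
    (hc : C * k₁ * c ^ 2 ≤ k₂ / 2) (hκ : κ = k₂ * c ^ (-(2 * s))) (hε : ε = 64 * (δ * κ))
    (hK₀ : K₀ = δ * κ / (8 * (4 / c) ^ ((n : ℝ) + 2 * s)))
    (hW0 : δ * R ^ (2 * s) * (Q ^ n - 1) ≤ W₀) :
    0 < ε + (-(δ * R ^ (2 * s) * (C * Q ^ (n + 2) / R ^ 2) * (k₁ * (c * R / Q) ^ (2 - 2 * s)))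
      + W₀ * (k₂ * (c * R / Q) ^ (-(2 * s))) - (4 / c * Q) ^ ((n : ℝ) + 2 * s) * (2 * K₀)) := by
  have hQ0 : 0 < Q := by linarith
  have hQn : Q ^ (n : ℝ) = Q ^ n := Real.rpow_natCast Q n
  have hρpos : 0 < c * R / Q := by positivity
  have hρ1 : (c * R / Q) ^ (-(2 * s)) = c ^ (-(2 * s)) * (R ^ (2 * s))⁻¹ * Q ^ (2 * s) := by
    rw [Real.div_rpow (by positivity) hQ0.le, Real.mul_rpow hc0.le hR.le, Real.rpow_neg hQ0.le,
      Real.rpow_neg hR.le, div_inv_eq_mul]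
  have hρ2 : (c * R / Q) ^ (2 - 2 * s) = (c * R / Q) ^ 2 * (c * R / Q) ^ (-(2 * s)) := by
    rw [sub_eq_add_neg, Real.rpow_add hρpos]; norm_cast
  have hRs : R ^ (2 * s) * (R ^ (2 * s))⁻¹ = 1 := mul_inv_cancel₀ (by positivity)
  have hm1 : δ * R ^ (2 * s) * (C * Q ^ (n + 2) / R ^ 2) * (k₁ * (c * R / Q) ^ (2 - 2 * s))
      ≤ δ * κ * Q ^ (2 * s) * (Q ^ n / 2) := by
    have e : δ * R ^ (2 * s) * (C * Q ^ (n + 2) / R ^ 2) * (k₁ * (c * R / Q) ^ (2 - 2 * s))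
        = C * k₁ * c ^ 2 *
        (δ * c ^ (-(2 * s)) * Q ^ (2 * s) * Q ^ n * (R ^ (2 * s) * (R ^ (2 * s))⁻¹)) := by
      rw [hρ2, hρ1, pow_add]
      generalize (R ^ (2 * s)) = a
      generalize (R ^ (2 * s))⁻¹ = a'
      field_simp
    rw [e, hRs, mul_one]
    refine (mul_le_mul_of_nonneg_right hc (by positivity)).trans (le_of_eq ?_)
    rw [hκ]; ring
  have hm2 : δ * κ * Q ^ (2 * s) * (Q ^ n - 1) ≤ W₀ * (k₂ * (c * R / Q) ^ (-(2 * s))) := by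
    refine le_trans (le_of_eq ?_) (mul_le_mul_of_nonneg_right hW0 (by positivity))
    rw [hρ1, hκ]
    linear_combination (-(δ * (Q ^ n - 1) * k₂ * c ^ (-(2 * s)) * Q ^ (2 * s))) * hRs
  have hm3 : (4 / c * Q) ^ ((n : ℝ) + 2 * s) * (2 * K₀) = δ * κ / 4 * (Q ^ n * Q ^ (2 * s)) := by
    have h4 : 0 < (4 / c) ^ ((n : ℝ) + 2 * s) := by positivity
    rw [Real.mul_rpow (by positivity) hQ0.le, Real.rpow_add hQ0, hQn, hK₀]
    generalize (4 / c) ^ ((n : ℝ) + 2 * s) = a at h4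
    field_simp
    ring
  have hbal := barrier_balance (K := δ * κ / 4) hn hs0 hs1 hQ1 hδ hκpos hε le_rfl
  rw [hm3]
  linarith

set_option maxHeartbeats 800000 in
/-- Comparison principle: a subsolution of the obstacle problem lies below any finite convex
combination of supersolutions, if this holds for the initial data and for the obstacles. Growth at
infinity is controlled only through the weighted `L¹` norms. -/
theorem comparison (hn : 0 < n) (hs0 : 0 < s) (hs1 : s < 1) {ι : Type*} [Fintype ι] {lam : ι → ℝ}
    {u : ℝ → E n → ℝ} {v : ι → ℝ → E n → ℝ} {T : ℝ} {ψu : E n → ℝ} {ψ : ι → E n → ℝ}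
    (hlam : ∀ i, 0 < lam i) (hsum : ∑ i, lam i = 1)
    (hu : ContinuousOn (fun p : ℝ × E n => u p.1 p.2) (Icc 0 T ×ˢ univ))
    (hv : ∀ i, ContinuousOn (fun p : ℝ × E n => v i p.1 p.2) (Icc 0 T ×ˢ univ))
    (hut : TailsVanish s T u) (hvt : ∀ i, TailsVanish s T (v i))
    (hsub : PointwiseSub s T ψu u) (hsup : ∀ i, PointwiseSuper s T (ψ i) (v i))
    (hψ : ∀ i, Continuous (ψ i)) (hψu : ∀ x, ψu x ≤ ∑ i, lam i * ψ i x)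
    (hinit : ∀ x, u 0 x ≤ ∑ i, lam i * v i 0 x) {t' : ℝ} (ht' : t' ∈ Ico 0 T) (x' : E n) :
    u t' x' ≤ ∑ i, lam i * v i t' x' := by
  by_contra! hcon
  set w := u t' x' - ∑ i, lam i * v i t' x' with hw
  have hwpos : 0 < w := by rw [hw]; linarith
  have hT : 0 < T := ht'.1.trans_lt ht'.2
  have hTt : 0 < T - t' := by linarith [ht'.2]
  obtain ⟨C, hC, hprof⟩ := profile_pow_le (n := n) n
  have hk1 := innerMoment_nonneg (n := n) (s := s)
  have hk2 := outerMass_pos (n := n) hn hs0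
  -- `c` is so small that the second-order part of the barrier is dominated by its size
  obtain ⟨c, hc0, hc8, hc⟩ : ∃ c : ℝ, 0 < c ∧ c ≤ 1 / 8 ∧
      C * innerMoment n s * c ^ 2 ≤ outerMass n s / 2 := by
    refine ⟨min (1 / 8) (outerMass n s / (2 * (C * innerMoment n s + 1))), by positivity,
      min_le_left _ _, ?_⟩
    set c := min (1 / 8) (outerMass n s / (2 * (C * innerMoment n s + 1))) with hcdef
    have h0 : 0 < c := by positivity
    have h8 : c ≤ 1 / 8 := min_le_left _ _
    have h2 : c ≤ outerMass n s / (2 * (C * innerMoment n s + 1)) := min_le_right _ _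
    rw [le_div_iff₀ (by positivity)] at h2
    have h3 : C * innerMoment n s * c ^ 2 ≤ C * innerMoment n s * c := by
      gcongr; nlinarith
    nlinarith
  set κ := outerMass n s * c ^ (-(2 * s)) with hκ
  have hκpos : 0 < κ := by positivity
  set ε := w / (4 * T) with hε
  have hεpos : 0 < ε := by positivity
  set δ := ε / (64 * κ) with hδ
  have hδpos : 0 < δ := by positivity
  set γ := w * (T - t') / 4 with hγ
  have hγpos : 0 < γ := by positivity
  set K₀ := δ * κ / (8 * (4 / c) ^ ((n : ℝ) + 2 * s)) with hK₀
  have hK₀pos : 0 < K₀ := by positivity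
  -- choice of the radius
  have htail : ∀ᶠ R : ℝ in atTop, (∀ t ∈ Icc 0 T,
      ∫ y : E n, |u t y| / (R + ‖y‖) ^ ((n : ℝ) + 2 * s) ≤ K₀) ∧ ∀ i, ∀ t ∈ Icc 0 T,
      ∫ y : E n, |v i t y| / (R + ‖y‖) ^ ((n : ℝ) + 2 * s) ≤ K₀ := by
    refine Eventually.and ?_ (eventually_all.2 fun i => ?_)
    · obtain ⟨R₀, -, h⟩ := hut.2 K₀ hK₀pos
      exact eventually_atTop.2 ⟨R₀, h⟩
    · obtain ⟨R₀, -, h⟩ := (hvt i).2 K₀ hK₀pos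
      exact eventually_atTop.2 ⟨R₀, h⟩
  have hcenter : ∀ᶠ R : ℝ in atTop, δ * R ^ (2 * s) * (profile R x' ^ n - 1) < w / 4 := by
    have h1 : Tendsto (fun R : ℝ => δ * C * ‖x'‖ ^ 2 * R ^ (-(2 - 2 * s))) atTop (𝓝 0) := by
      simpa using (tendsto_rpow_neg_atTop (by linarith : 0 < 2 - 2 * s)).const_mul
        (δ * C * ‖x'‖ ^ 2)
    filter_upwards [h1.eventually (gt_mem_nhds (by positivity : 0 < w / 4)),
      eventually_ge_atTop (8 * ‖x'‖), eventually_gt_atTop 0] with R h1 h2 h3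
    have hp0 : profile R (0 : E n) = 1 := by simp [profile]
    have := (hprof R 0 x' h3 (by simpa using h3) (by rw [hp0]; linarith)).2
    simp only [zero_add, hp0, one_pow, smul_zero, inner_zero_left, add_zero] at this
    refine lt_of_le_of_lt ?_ h1
    have h4 := mul_le_mul_of_nonneg_left (sub_le_iff_le_add'.2 this)
      (by positivity : 0 ≤ δ * R ^ (2 * s))
    refine h4.trans (le_of_eq ?_)
    have e : R ^ (-(2 - 2 * s)) = R ^ (2 * s) / R ^ 2 := by
      rw [neg_sub, Real.rpow_sub h3]; norm_cast
    rw [e]; ring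
  obtain ⟨R, ⟨⟨hRu, hRv⟩, hRc⟩, hRx, hR1⟩ := ((htail.and hcenter).and
    ((eventually_gt_atTop ‖x'‖).and (eventually_ge_atTop (1 : ℝ)))).exists
  have hR : 0 < R := by linarith
  -- the functions are bounded on a compact set
  have hcpt : IsCompact (Icc 0 T ×ˢ Metric.closedBall (0 : E n) (R + 1)) :=
    isCompact_Icc.prod (isCompact_closedBall _ _)
  have hcsub : Icc 0 T ×ˢ Metric.closedBall (0 : E n) (R + 1) ⊆ Icc 0 T ×ˢ univ :=
    prod_mono le_rfl (subset_univ _)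
  obtain ⟨B₁, hB₁⟩ : ∃ B₁ : ℝ, 0 ≤ B₁ ∧ (∀ p ∈ Icc 0 T ×ˢ Metric.closedBall (0 : E n) (R + 1),
      |u p.1 p.2| ≤ B₁) ∧ ∀ i, ∀ p ∈ Icc 0 T ×ˢ Metric.closedBall (0 : E n) (R + 1),
      |v i p.1 p.2| ≤ B₁ := by
    have h1 : ∀ᶠ B : ℝ in atTop, ∀ p ∈ Icc 0 T ×ˢ Metric.closedBall (0 : E n) (R + 1),
        |u p.1 p.2| ≤ B := by
      obtain ⟨B, hB⟩ := hcpt.exists_bound_of_continuousOn (hu.mono hcsub)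
      exact eventually_atTop.2 ⟨B, fun B' h p hp => (hB p hp).trans h⟩
    have h2 : ∀ᶠ B : ℝ in atTop, ∀ i, ∀ p ∈ Icc 0 T ×ˢ Metric.closedBall (0 : E n) (R + 1),
        |v i p.1 p.2| ≤ B := by
      rw [eventually_all]
      intro i
      obtain ⟨B, hB⟩ := hcpt.exists_bound_of_continuousOn ((hv i).mono hcsub)
      exact eventually_atTop.2 ⟨B, fun B' h p hp => (hB p hp).trans h⟩
    exact ((eventually_ge_atTop 0).and (h1.and h2)).exists
  obtain ⟨hB₁0, hB₁u, hB₁v⟩ := hB₁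
  obtain ⟨T₁, Kx, hT₁, hKc, hKx, hbc, hboff⟩ := exists_barrier_compact (s := s) (T := T) hn hεpos.le
    hγpos hδpos hR (show 0 ≤ 2 * B₁ by positivity)
  have hb' : barrier s T R ε γ δ t' x' < 3 * w / 4 := by
    have e1 : ε * t' ≤ w / 4 := by
      rw [hε, div_mul_eq_mul_div, div_le_iff₀ (by positivity)]
      nlinarith [ht'.2]
    have e2 : γ / (T - t') = w / 4 := by rw [hγ]; field_simp
    unfold barrier
    rw [e2]; linarith
  have hbnn := fun t ht x hx => barrier_nonneg (n := n) (s := s) (T := T) (t := t) (x := x) hεpos.le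
    hγpos.le hδpos.le hR ht hx
  have hθ : 0 < w / 4 := by positivity
  obtain ⟨k, t, x, τ, y, hk, ht, hx, hτ, hy, hψc, hpos, hmax⟩ := exists_doubling_max
    (b := barrier s T R ε γ δ) (θ := w / 4) (B₀ := 2 * B₁) hlam hsum hu hv hψ hinit hT₁ hKc hKx hbc
    (fun t ht x hx => (hbnn t ht x (by simpa using hx)).2.2) hboff
    (fun t ht x hx τ y hτ hy => by
      have h1 := (abs_le.1 (hB₁u (t, x) ⟨ht, hx⟩)).2
      have h2 : -B₁ ≤ ∑ i, lam i * v i (τ i) (y i) := by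
        calc -B₁ = ∑ i, lam i * -B₁ := by rw [← Finset.sum_mul, hsum, one_mul]
          _ ≤ _ := Finset.sum_le_sum fun i _ => mul_le_mul_of_nonneg_left
            (abs_le.1 (hB₁v i (τ i, y i) ⟨hτ i, hy i⟩)).1 (hlam i).le
      simp only at h1
      linarith) hθ ht' (by simpa using hRx) (by linarith)
  have htI : t ∈ Icc 0 T := Ioo_subset_Icc_self ht
  have htIco : t ∈ Ico 0 T := ⟨ht.1.le, ht.2⟩
  obtain ⟨hbδ, -, hbt0⟩ := hbnn t htIco x hx
  set Q := profile R x with hQ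
  have hQ1 : 1 ≤ Q := one_le_profile hR hx
  have hQ0 : 0 < Q := by linarith
  have hprofx := fun ξ : E n => hprof R x ξ hR hx
  have hTt2 : 0 < (T - t) / 2 := by linarith [ht.2]
  have hbq : ∀ᶠ q : ℝ × E n in 𝓝 (t, x), barrier s T R ε γ δ q.1 q.2 ≤ quadTest t x
      (barrier s T R ε γ δ t x) (ε + γ / (T - t) ^ 2) (2 * γ / (T - t) ^ 3)
      ((δ * R ^ (2 * s)) • ((2 * n * Q ^ (n + 1) / R ^ 2) • x))
      (δ * R ^ (2 * s) * (C * Q ^ (n + 2) / R ^ 2)) q.1 q.2 := by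
    have hmem : Metric.closedBall t ((T - t) / 2) ×ˢ Metric.closedBall x (R / (8 * Q)) ∈ 𝓝 (t, x) :=
      prod_mem_nhds (Metric.closedBall_mem_nhds _ hTt2) (Metric.closedBall_mem_nhds _ (by positivity))
    filter_upwards [hmem] with q hq
    have := barrier_le_quadTest (s := s) (ε := ε) (C := C) hγpos.le hδpos hR ht.2 hprofx
      (t' := q.1) (ξ := q.2 - x) (by simpa [Real.dist_eq] using hq.1)
      (by simpa [dist_eq_norm] using hq.2)
    rwa [add_sub_cancel] at this
  have hineq := fun η (hη : (0 : ℝ) < η) => eventually_doubling_le hlam hsum hsub hsup hψu hk ht hx hτ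
    hy hψc hθ hbt0 hpos hmax hbq hη
  -- the common translation of all the copies
  set W : E n → ℝ := fun ξ => u t (x + ξ) - ∑ i, lam i * v i (τ i) (y i + ξ) with hW
  have hτI : ∀ i, τ i ∈ Icc 0 T := fun i => Ioo_subset_Icc_self (hτ i)
  have hcu : Continuous (u t) :=
    hu.comp_continuous (f := fun x : E n => (t, x)) (by fun_prop) fun x => ⟨htI, mem_univ _⟩
  have hcv : ∀ i, Continuous (v i (τ i)) := fun i =>
    (hv i).comp_continuous (f := fun x : E n => (τ i, x)) (by fun_prop) fun x => ⟨hτI i, mem_univ _⟩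
  have huw := hut.1 t htI
  have hvw := fun i => (hvt i).1 (τ i) (hτI i)
  set ρ := c * R / Q with hρ
  have hρpos : 0 < ρ := by positivity
  have hρ8 : ρ ≤ R / (8 * Q) := by
    rw [hρ, div_le_div_iff₀ hQ0 (by positivity)]
    have : 0 < R * Q := by positivity
    nlinarith
  have hyR : ∀ i, ‖y i‖ ≤ R + 1 := by
    intro i
    have h1 := norm_sub_norm_le (y i) x
    rw [norm_sub_rev] at h1
    linarith [hy i]
  set A := δ * R ^ (2 * s) * (C * Q ^ (n + 2) / R ^ 2) with hA
  have hA0 : 0 ≤ A := by positivity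
  have hWq : ∀ ξ ∈ Metric.ball (0 : E n) ρ, W ξ ≤ W 0
      + inner ℝ ((δ * R ^ (2 * s)) • ((2 * n * Q ^ (n + 1) / R ^ 2) • x)) ξ + A * ‖ξ‖ ^ 2 := by
    intro ξ hξ
    have hξ' : ‖ξ‖ ≤ R / (8 * Q) := by
      have : ‖ξ‖ < ρ := by simpa using hξ
      linarith
    have hxξ := (hprofx ξ hξ').1
    have h1 := hmax t htIco (x + ξ) (by simpa using hxξ) τ hτI (fun i => y i + ξ) (fun i => by
      have e : y i + ξ = (x + ξ) - (x - y i) := by abel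
      have := norm_sub_le (x + ξ) (x - y i)
      rw [← e] at this
      have := hy i
      simp only [Metric.mem_closedBall, dist_zero_right]
      linarith)
    have h2 := barrier_le_quadTest (s := s) (ε := ε) (C := C) hγpos.le hδpos hR ht.2 hprofx
      (t' := t) (ξ := ξ) (by rw [sub_self, abs_zero]; linarith) hξ'
    simp only [quadTest, add_sub_cancel_left, sub_self, mul_zero, add_zero] at h2
    simp only [doubling, add_sub_add_right_eq_sub, mul_add, Finset.sum_add_distrib] at h1
    simp only [hW, add_zero]
    linarith
  have hW0 : δ * R ^ (2 * s) * (Q ^ n - 1) ≤ W 0 := by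
    have : W 0 ≥ barrier s T R ε γ δ t x := by
      have h1 : ∑ i, lam i * v i (τ i) (y i)
          ≤ ∑ i, lam i * (v i (τ i) (y i) + k * (‖x - y i‖ ^ 2 + (t - τ i) ^ 2)) :=
        Finset.sum_le_sum fun i _ => mul_le_mul_of_nonneg_left
          (by have : 0 ≤ k * (‖x - y i‖ ^ 2 + (t - τ i) ^ 2) := by positivity
              linarith) (hlam i).le
      unfold doubling at hpos
      simp only [hW, add_zero]
      linarith
    linarith
  have hWi : ∀ r, 0 < r → IntegrableOn (fun ξ => W ξ * jumpKernel s ξ) (Metric.ball (0 : E n) r)ᶜ := by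
    intro r hr
    have h1 : IntegrableOn (fun ξ => ∑ i, lam i * (v i (τ i) (y i + ξ) * jumpKernel s ξ))
        (Metric.ball (0 : E n) r)ᶜ := integrable_finsetSum _ fun i _ =>
      ((hvw i).integrableOn_shift hs0 (hcv i) (y i) hr).const_mul (lam i)
    refine ((huw.integrableOn_shift hs0 hcu x hr).sub h1).congr (.of_forall fun ξ => ?_)
    simp only [Pi.sub_apply, hW, sub_mul, Finset.sum_mul, mul_assoc]
  have htr : ∀ r, 0 < r → trunc s r (u t) x - ∑ i, lam i * trunc s r (v i (τ i)) (y i)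
      = ∫ ξ in (Metric.ball (0 : E n) r)ᶜ, (W 0 - W ξ) * jumpKernel s ξ := by
    intro r hr
    unfold trunc
    simp only [← integral_const_mul]
    rw [← integral_finsetSum _ fun i _ => ((hvw i).integrableOn_sub hs0 (hcv i) (y i) hr).const_mul _,
      ← integral_sub (huw.integrableOn_sub hs0 hcu x hr) (integrable_finsetSum _ fun i _ =>
        ((hvw i).integrableOn_sub hs0 (hcv i) (y i) hr).const_mul (lam i))]
    refine integral_congr_ae (.of_forall fun ξ => ?_)
    simp only [hW, add_zero, ← mul_assoc, mul_sub, Finset.sum_sub_distrib, sub_mul, Finset.sum_mul]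
    ring
  -- the far interaction is controlled by the tails
  have hfar : ∀ z : E n, ‖z‖ ≤ R + 1 → ∀ ξ ∈ (Metric.ball (0 : E n) ρ)ᶜ,
      R + ‖z + ξ‖ ≤ (4 / c * Q) * ‖ξ‖ := by
    intro z hz ξ hξ
    have h1 : ρ ≤ ‖ξ‖ := by simpa using hξ
    have h2 : R ≤ Q / c * ‖ξ‖ := by
      calc R = Q / c * ρ := by rw [hρ]; field_simp
        _ ≤ _ := by gcongr
    have h3 : 1 ≤ Q / c := by rw [le_div_iff₀ hc0]; linarith
    have h4 := norm_add_le z ξ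
    have h5 : ‖ξ‖ ≤ Q / c * ‖ξ‖ := le_mul_of_one_le_left (norm_nonneg _) h3
    have e : 4 / c * Q * ‖ξ‖ = 4 * (Q / c * ‖ξ‖) := by ring
    rw [e]; linarith
  have hWfar : ∫ ξ in (Metric.ball (0 : E n) ρ)ᶜ, |W ξ| * jumpKernel s ξ
      ≤ (4 / c * Q) ^ ((n : ℝ) + 2 * s) * (2 * K₀) := by
    have hC0 : 0 ≤ 4 / c * Q := by positivity
    have h1 := (integral_abs_shift_le hs0 huw hcu hR1 hC0 (hfar x (by linarith))).trans
      (mul_le_mul_of_nonneg_left (hRu t htI) (by positivity))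
    have h2 := fun i => (integral_abs_shift_le hs0 (hvw i) (hcv i) hR1 hC0 (hfar (y i) (hyR i))).trans
      (mul_le_mul_of_nonneg_left (hRv i (τ i) (hτI i)) (by positivity))
    have iu : IntegrableOn (fun ξ => |u t (x + ξ)| * jumpKernel s ξ) (Metric.ball (0 : E n) ρ)ᶜ := by
      refine (huw.integrableOn_shift hs0 hcu x hρpos).norm.congr (.of_forall fun ξ => ?_)
      simp only [norm_mul, Real.norm_of_nonneg (jumpKernel_nonneg ξ), Real.norm_eq_abs]
    have iv : ∀ i, IntegrableOn (fun ξ => lam i * (|v i (τ i) (y i + ξ)| * jumpKernel s ξ))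
        (Metric.ball (0 : E n) ρ)ᶜ := by
      intro i
      refine Integrable.const_mul ?_ _
      refine ((hvw i).integrableOn_shift hs0 (hcv i) (y i) hρpos).norm.congr (.of_forall fun ξ => ?_)
      simp only [norm_mul, Real.norm_of_nonneg (jumpKernel_nonneg ξ), Real.norm_eq_abs]
    calc _ ≤ ∫ ξ in (Metric.ball (0 : E n) ρ)ᶜ, (|u t (x + ξ)| * jumpKernel s ξ
              + ∑ i, lam i * (|v i (τ i) (y i + ξ)| * jumpKernel s ξ)) := by
          refine integral_mono_of_nonneg
            (.of_forall fun ξ => mul_nonneg (abs_nonneg _) (jumpKernel_nonneg _))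
            (iu.add (integrable_finsetSum _ fun i _ => iv i)) (.of_forall fun ξ => ?_)
          simp only [← mul_assoc]
          rw [← Finset.sum_mul, ← add_mul]
          refine mul_le_mul_of_nonneg_right ?_ (jumpKernel_nonneg _)
          refine (abs_sub _ _).trans (add_le_add le_rfl ((Finset.abs_sum_le_sum_abs _ _).trans
            (Finset.sum_le_sum fun i _ => ?_)))
          rw [abs_mul, abs_of_pos (hlam i)]
      _ = (∫ ξ in (Metric.ball (0 : E n) ρ)ᶜ, |u t (x + ξ)| * jumpKernel s ξ)
          + ∑ i, lam i * ∫ ξ in (Metric.ball (0 : E n) ρ)ᶜ, |v i (τ i) (y i + ξ)| * jumpKernel s ξ := by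
          rw [integral_add iu (integrable_finsetSum _ fun i _ => iv i),
            integral_finsetSum _ fun i _ => iv i]
          simp only [integral_const_mul]
      _ ≤ (4 / c * Q) ^ ((n : ℝ) + 2 * s) * K₀
          + ∑ i, lam i * ((4 / c * Q) ^ ((n : ℝ) + 2 * s) * K₀) :=
          add_le_add h1 (Finset.sum_le_sum fun i _ => mul_le_mul_of_nonneg_left (h2 i) (hlam i).le)
      _ = _ := by rw [← Finset.sum_mul, hsum]; ring
  -- collect the terms
  have hmain : ε + (-(A * (innerMoment n s * ρ ^ (2 - 2 * s))) + W 0 * (outerMass n s * ρ ^ (-(2 * s)))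
      - (4 / c * Q) ^ ((n : ℝ) + 2 * s) * (2 * K₀)) ≤ 0 := by
    refine le_of_forall_pos_le_add fun η hη => ?_
    obtain ⟨r, hr1, hr2⟩ := ((hineq η hη).and (Ioo_mem_nhdsGT hρpos)).exists
    have h1 := le_integral_of_le_quadratic hn hs0 hs1 hA0 hr2.1 hr2.2.le (hWi r hr2.1) hWq
    rw [← htr r hr2.1] at h1
    have h2 : 0 ≤ γ / (T - t) ^ 2 := by positivity
    linarith
  have hpos' := barrier_dominates hn hs0 hs1 hQ1 hδpos hκpos hc0 hR hk2 hc hκ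
    (show ε = 64 * (δ * κ) by rw [hδ]; field_simp) hK₀ hW0
  rw [← hρ, ← hA] at hpos'
  linarith

/-! ### Convolutions and second differences -/

/-- Convolution `f * η` of a continuous function with a compactly supported one. -/
noncomputable def conv {n : ℕ} (f η : E n → ℝ) (x : E n) : ℝ := ∫ y, f (x - y) * η y

/-- The centred second difference `f(x+h) + f(x-h) - 2 f(x)`. -/
def secondDiff {n : ℕ} (h : E n) (f : E n → ℝ) (x : E n) : ℝ := f (x + h) + f (x - h) - 2 * f x

lemma secondDiff_continuous {f : E n → ℝ} (hf : Continuous f) (h : E n) :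
    Continuous (secondDiff h f) := by
  unfold secondDiff; fun_prop

lemma secondDiff_hasCompactSupport {η : E n → ℝ} (hη : HasCompactSupport η) (h : E n) :
    HasCompactSupport (secondDiff h η) := by
  have h1 : HasCompactSupport fun x => η (x + h) := hη.comp_homeomorph (Homeomorph.addRight h)
  have h2 : HasCompactSupport fun x => η (x - h) := hη.comp_homeomorph (Homeomorph.subRight h)
  exact (h1.add h2).sub (hη.mul_left (f := fun _ => (2 : ℝ)))

lemma conv_integrable {f η : E n → ℝ} (hf : Continuous f) (hη : Continuous η)
    (hs : HasCompactSupport η) (x : E n) : Integrable fun y => f (x - y) * η y :=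
  Continuous.integrable_of_hasCompactSupport (by fun_prop) (hs.mul_left)

lemma conv_sub {f g η : E n → ℝ} (hf : Continuous f) (hg : Continuous g) (hη : Continuous η)
    (hs : HasCompactSupport η) (x : E n) :
    conv (fun x => f x - g x) η x = conv f η x - conv g η x := by
  unfold conv
  rw [← integral_sub (conv_integrable hf hη hs x) (conv_integrable hg hη hs x)]
  simp only [sub_mul]

lemma conv_neg (f η : E n → ℝ) (x : E n) : conv (fun x => -f x) η x = -conv f η x := by
  unfold conv
  rw [← integral_neg]
  simp only [neg_mul]

lemma conv_secondDiff {f η : E n → ℝ} (hf : Continuous f) (hη : Continuous η)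
    (hs : HasCompactSupport η) (h x : E n) :
    conv (secondDiff h f) η x = secondDiff h (conv f η) x := by
  unfold conv secondDiff
  have hi : Integrable fun y => f (x + h - y) * η y + f (x - h - y) * η y :=
    (conv_integrable hf hη hs _).add (conv_integrable hf hη hs _)
  rw [← integral_add (conv_integrable hf hη hs _) (conv_integrable hf hη hs _), ← integral_const_mul,
    ← integral_sub hi ((conv_integrable hf hη hs _).const_mul 2)]
  refine integral_congr_ae (.of_forall fun y => ?_)
  simp only
  rw [sub_add_eq_add_sub, sub_right_comm x y h]
  ring

lemma conv_secondDiff_right {f η : E n → ℝ} (hf : Continuous f) (hη : Continuous η)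
    (hs : HasCompactSupport η) (h x : E n) :
    conv f (secondDiff h η) x = secondDiff h (conv f η) x := by
  have e1 : conv f η (x + h) = ∫ y, f (x - y) * η (y + h) := by
    unfold conv
    rw [← integral_add_right_eq_self _ h]
    refine integral_congr_ae (.of_forall fun y => ?_)
    simp only [add_sub_add_right_eq_sub]
  have e2 : conv f η (x - h) = ∫ y, f (x - y) * η (y - h) := by
    unfold conv
    rw [← integral_sub_right_eq_self _ h]
    refine integral_congr_ae (.of_forall fun y => ?_)
    simp only [sub_sub_sub_cancel_right]
  have h1 : HasCompactSupport fun x => η (x + h) := hs.comp_homeomorph (Homeomorph.addRight h)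
  have h2 : HasCompactSupport fun x => η (x - h) := hs.comp_homeomorph (Homeomorph.subRight h)
  have i1 := conv_integrable hf (η := fun x => η (x + h)) (by fun_prop) h1 x
  have i2 := conv_integrable hf (η := fun x => η (x - h)) (by fun_prop) h2 x
  unfold secondDiff
  rw [e1, e2]
  unfold conv
  have hi : Integrable fun y => f (x - y) * η (y + h) + f (x - y) * η (y - h) := i1.add i2
  rw [← integral_add i1 i2, ← integral_const_mul, ← integral_sub hi
      ((conv_integrable hf hη hs _).const_mul 2)]
  refine integral_congr_ae (.of_forall fun y => ?_)
  simp only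
  ring

/-- A function with a Lipschitz bound, in the form used below. -/
def LipBound {n : ℕ} (K : ℝ) (f : E n → ℝ) : Prop := ∀ x y, |f x - f y| ≤ K * ‖x - y‖

lemma LipBound.continuous {K : ℝ} {f : E n → ℝ} (hf : LipBound K f) : Continuous f := by
  have : LipschitzWith (Real.toNNReal K) f := LipschitzWith.of_dist_le_mul fun x y => by
    rw [Real.dist_eq, dist_eq_norm]
    exact (hf x y).trans (by gcongr; exact Real.le_coe_toNNReal K)
  exact this.continuous

lemma abs_conv_le {g η : E n → ℝ} (hη : Continuous η) (hs : HasCompactSupport η) {m : ℝ}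
    (hg : ∀ x, |g x| ≤ m) (x : E n) : |conv g η x| ≤ m * ∫ y, |η y| := by
  unfold conv
  rw [← integral_const_mul, ← Real.norm_eq_abs]
  refine norm_integral_le_of_norm_le ((hη.integrable_of_hasCompactSupport hs).norm.const_mul m)
    (.of_forall fun y => ?_)
  rw [norm_mul, Real.norm_eq_abs, Real.norm_eq_abs]
  gcongr
  exact hg _

lemma LipBound.conv {K : ℝ} {f η : E n → ℝ} (hf : LipBound K f) (hη : Continuous η)
    (hs : HasCompactSupport η) : LipBound (K * ∫ y, |η y|) (conv f η) := by
  intro x x'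
  have hc := hf.continuous
  unfold FracObstacle.conv
  rw [← integral_sub (conv_integrable hc hη hs x) (conv_integrable hc hη hs x'), mul_right_comm,
    ← integral_const_mul, ← Real.norm_eq_abs]
  refine norm_integral_le_of_norm_le
    ((hη.integrable_of_hasCompactSupport hs).norm.const_mul _) (.of_forall fun y => ?_)
  rw [← sub_mul, norm_mul, Real.norm_eq_abs, Real.norm_eq_abs]
  gcongr
  simpa using hf (x - y) (x' - y)

/-- `f * η - (∫ η) f` is bounded by the Lipschitz constant times the first moment of `η`. -/
lemma LipBound.abs_conv_sub_le {K : ℝ} {f η : E n → ℝ} (hf : LipBound K f) (hη : Continuous η)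
    (hs : HasCompactSupport η) (x : E n) :
    |FracObstacle.conv f η x - f x * ∫ y, η y| ≤ K * ∫ y, ‖y‖ * |η y| := by
  have hc := hf.continuous
  unfold FracObstacle.conv
  rw [← integral_const_mul, ← integral_sub (conv_integrable hc hη hs x)
    ((hη.integrable_of_hasCompactSupport hs).const_mul _), ← integral_const_mul, ← Real.norm_eq_abs]
  refine norm_integral_le_of_norm_le ((Continuous.integrable_of_hasCompactSupport (by fun_prop)
    (HasCompactSupport.mul_left (f := fun y => ‖y‖) hs.norm)).const_mul K) (.of_forall fun y => ?_)
  rw [← sub_mul, norm_mul, Real.norm_eq_abs, Real.norm_eq_abs, ← mul_assoc]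
  gcongr
  simpa using hf (x - y) x

lemma WeightedIntegrable.of_le (hs : 0 < s) {f g : E n → ℝ} (hf : WeightedIntegrable s f)
    (hg : Continuous g) {a b : ℝ} (h : ∀ x, |g x| ≤ a * |f x| + b) : WeightedIntegrable s g := by
  have hb : Integrable fun x : E n => b * ((1 + ‖x‖) ^ ((n : ℝ) + 2 * s))⁻¹ :=
    (integrable_inv_weight (n := n) hs one_pos).const_mul b
  have hf' : Integrable fun x : E n => a * (|f x| / (1 + ‖x‖) ^ ((n : ℝ) + 2 * s)) :=
    Integrable.const_mul hf a
  refine (hf'.add hb).mono' ?_ (.of_forall fun x => ?_)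
  · refine hg.norm.aestronglyMeasurable.mul (Measurable.aestronglyMeasurable ?_)
    fun_prop
  · rw [Real.norm_of_nonneg (by positivity)]
    simp only [Pi.add_apply]
    rw [div_eq_mul_inv, div_eq_mul_inv, ← mul_assoc, ← add_mul]
    gcongr
    exact h x

lemma WeightedIntegrable.conv (hs0 : 0 < s) {K : ℝ} {f η : E n → ℝ} (hw : WeightedIntegrable s f)
    (hf : LipBound K f) (hη : Continuous η) (hs : HasCompactSupport η) :
    WeightedIntegrable s (conv f η) := by
  refine hw.of_le hs0 (hf.conv hη hs).continuous (a := |∫ y, η y|) (b := K * ∫ y, ‖y‖ * |η y|)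
    fun x => ?_
  have h1 := hf.abs_conv_sub_le hη hs x
  have h2 := abs_sub_abs_le_abs_sub (FracObstacle.conv f η x) (f x * ∫ y, η y)
  rw [abs_mul, mul_comm] at h2
  linarith

/-- Convolutions commute. -/
lemma conv_conv_comm {K : ℝ} {f a b : E n → ℝ} (hf : LipBound K f) (ha : Continuous a)
    (hsa : HasCompactSupport a) (hb : Continuous b) (hsb : HasCompactSupport b) (x : E n) :
    conv (conv f a) b x = conv (conv f b) a x := by
  unfold conv
  simp only [← integral_mul_const]
  rw [integral_integral_swap]
  · refine integral_congr_ae (.of_forall fun y => integral_congr_ae (.of_forall fun z => ?_))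
    simp only
    rw [sub_right_comm]; ring
  · have hc := hf.continuous
    have h1 : Integrable (fun p : E n × E n => (K * ‖p.1‖ + K * ‖p.2‖ + |f x|) * (|b p.1| * |a p.2|))
        (volume.prod volume) := by
      have ib := hb.integrable_of_hasCompactSupport (μ := volume) hsb
      have ia := ha.integrable_of_hasCompactSupport (μ := volume) hsa
      have ib' : Integrable fun y => ‖y‖ * |b y| := Continuous.integrable_of_hasCompactSupport
        (by fun_prop) (HasCompactSupport.mul_left (f := fun y => ‖y‖) hsb.norm)
      have ia' : Integrable fun y => ‖y‖ * |a y| := Continuous.integrable_of_hasCompactSupport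
        (by fun_prop) (HasCompactSupport.mul_left (f := fun y => ‖y‖) hsa.norm)
      have := (((ib'.mul_prod ia.norm).const_mul K).add ((ib.norm.mul_prod ia').const_mul K)).add
        ((ib.norm.mul_prod ia.norm).const_mul |f x|)
      refine this.congr (.of_forall fun p => ?_)
      simp only [Pi.add_apply, Real.norm_eq_abs]; ring
    refine h1.mono' (Continuous.aestronglyMeasurable (by unfold Function.uncurry; fun_prop))
      (.of_forall fun p => ?_)
    simp only [Function.uncurry, norm_mul, Real.norm_eq_abs]
    rw [mul_assoc, mul_comm |a p.2|]
    gcongr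
    have h2 := hf (x - p.1 - p.2) x
    have h3 : ‖x - p.1 - p.2 - x‖ ≤ ‖p.1‖ + ‖p.2‖ := by
      rw [show x - p.1 - p.2 - x = -(p.1 + p.2) by abel, norm_neg]
      exact norm_add_le _ _
    have h4 := abs_sub_abs_le_abs_sub (f (x - p.1 - p.2)) (f x)
    have hK : 0 ≤ K ∨ K < 0 := le_or_gt 0 K
    rcases hK with hK | hK
    · have := mul_le_mul_of_nonneg_left h3 hK
      linarith
    · -- a negative Lipschitz constant is only possible when there is nothing to prove
      have h5 : ∀ z w : E n, z = w := by
        intro z w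
        by_contra hne
        have h6 := hf z w
        have : 0 < ‖z - w‖ := norm_pos_iff.2 (sub_ne_zero.2 hne)
        nlinarith [abs_nonneg (f z - f w)]
      rw [h5 p.1 0, h5 p.2 0]
      simp

lemma trunc_integrand_bound {K : ℝ} {f : E n → ℝ} (hf : LipBound K f) (z ξ : E n) :
    |f z - f (z + ξ)| ≤ |f 0 - f (0 + ξ)| + 2 * K * ‖z‖ := by
  have h1 := hf z 0
  have h2 := hf (0 + ξ) (z + ξ)
  rw [add_sub_add_right_eq_sub, zero_sub, norm_neg] at h2
  rw [sub_zero] at h1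
  calc |f z - f (z + ξ)| = |(f 0 - f (0 + ξ)) + (f z - f 0) + (f (0 + ξ) - f (z + ξ))| := by
        congr 1; ring
    _ ≤ |f 0 - f (0 + ξ)| + |f z - f 0| + |f (0 + ξ) - f (z + ξ)| := abs_add_three _ _ _
    _ ≤ _ := by linarith

/-- The truncated operator commutes with convolution. -/
lemma trunc_conv (hs0 : 0 < s) {K : ℝ} {f η : E n → ℝ} (hw : WeightedIntegrable s f)
    (hf : LipBound K f) (hη : Continuous η) (hs : HasCompactSupport η) {r : ℝ} (hr : 0 < r)
    (x : E n) : trunc s r (conv f η) x = conv (trunc s r f) η x := by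
  have hc := hf.continuous
  have e1 : ∀ ξ, (conv f η x - conv f η (x + ξ)) * jumpKernel s ξ
      = ∫ y, (f (x - y) - f (x - y + ξ)) * jumpKernel s ξ * η y := by
    intro ξ
    unfold conv
    rw [← integral_sub (conv_integrable hc hη hs _) (conv_integrable hc hη hs _),
      ← integral_mul_const]
    refine integral_congr_ae (.of_forall fun y => ?_)
    simp only
    rw [sub_add_eq_add_sub]; ring
  unfold trunc
  simp only [e1]
  rw [integral_integral_swap]
  · unfold conv
    simp only [integral_mul_const]
  · have i1 : IntegrableOn (fun ξ => |f 0 - f (0 + ξ)| * jumpKernel s ξ) (Metric.ball (0 : E n) r)ᶜ := by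
      refine (hw.integrableOn_sub hs0 hc 0 hr).norm.congr (.of_forall fun ξ => ?_)
      simp only [norm_mul, Real.norm_of_nonneg (jumpKernel_nonneg ξ), Real.norm_eq_abs]
    have i2 := integrableOn_jumpKernel (n := n) hs0 hr
    have iη := hη.integrable_of_hasCompactSupport (μ := volume) hs
    have iη1 : Integrable fun y => |η y| := iη.norm
    have iη2 : Integrable fun y => 2 * K * ‖x - y‖ * |η y| :=
      Continuous.integrable_of_hasCompactSupport (by fun_prop)
        (HasCompactSupport.mul_left (f := fun y => 2 * K * ‖x - y‖) hs.norm)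
    have := (i1.mul_prod iη1).add (i2.mul_prod iη2)
    refine this.mono' ?_ (.of_forall fun p => ?_)
    · refine Measurable.aestronglyMeasurable ?_
      have hJ := measurable_jumpKernel (n := n) (s := s)
      have hcm := hc.measurable
      have hηm := hη.measurable
      unfold Function.uncurry
      fun_prop
    · simp only [Function.uncurry, norm_mul, Real.norm_eq_abs, Pi.add_apply]
      rw [abs_of_nonneg (jumpKernel_nonneg p.1)]
      have h1 := trunc_integrand_bound hf (x - p.2) p.1
      have h2 := jumpKernel_nonneg (s := s) p.1
      calc _ ≤ (|f 0 - f (0 + p.1)| + 2 * K * ‖x - p.2‖) * jumpKernel s p.1 * |η p.2| := by gcongr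
        _ = _ := by ring

/-- Changing the truncation radius, for functions whose second differences are bounded below. -/
lemma trunc_le_add (hn : 0 < n) (hs0 : 0 < s) (hs1 : s < 1) {f : E n → ℝ}
    (hw : WeightedIntegrable s f) (hc : Continuous f) {C : ℝ} (hC : 0 ≤ C) {x : E n} {r' r : ℝ}
    (hr' : 0 < r') (h : r' ≤ r) (hdd : ∀ ξ ∈ Metric.ball (0 : E n) r, -(C * ‖ξ‖ ^ 2) ≤ secondDiff ξ f x) :
    trunc s r' f x ≤ trunc s r f x + C * (innerMoment n s * r ^ (2 - 2 * s)) := by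
  have hr : 0 < r := hr'.trans_le h
  set A := Metric.ball (0 : E n) r \ Metric.ball (0 : E n) r' with hA
  have hmd : MeasurableSet A := measurableSet_ball.diff measurableSet_ball
  have i0 := hw.integrableOn_sub hs0 hc x hr'
  have iA : IntegrableOn (fun ξ => (f x - f (x + ξ)) * jumpKernel s ξ) A :=
    i0.mono_set fun ξ h => h.2
  have hneg : ∫ ξ in A, (f x - f (x + ξ)) * jumpKernel s ξ
      = ∫ ξ in A, (f x - f (x - ξ)) * jumpKernel s ξ := by
    rw [← integral_indicator hmd, ← integral_indicator hmd, ← integral_neg_eq_self]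
    refine integral_congr_ae (.of_forall fun ξ => ?_)
    have : -ξ ∈ A ↔ ξ ∈ A := by simp [hA]
    by_cases hξ : ξ ∈ A
    · simp only [indicator_of_mem hξ, indicator_of_mem (this.2 hξ), jumpKernel_neg, sub_eq_add_neg]
    · simp only [indicator_of_notMem hξ, indicator_of_notMem (mt this.1 hξ)]
  have iA' : IntegrableOn (fun ξ => (f x - f (x - ξ)) * jumpKernel s ξ) A := by
    rw [← integrable_indicator_iff hmd] at iA ⊢
    refine iA.comp_neg.congr (.of_forall fun ξ => ?_)
    have : -ξ ∈ A ↔ ξ ∈ A := by simp [hA]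
    by_cases hξ : ξ ∈ A
    · simp only [indicator_of_mem hξ, indicator_of_mem (this.2 hξ), jumpKernel_neg, sub_eq_add_neg]
    · simp only [indicator_of_notMem hξ, indicator_of_notMem (mt this.1 hξ)]
  have i2 : IntegrableOn (fun ξ => C * (‖ξ‖ ^ 2 * jumpKernel s ξ)) A :=
    ((integrableOn_sq_jumpKernel hn hs1 r).mono_set sdiff_subset).const_mul C
  have h2 : 2 * ∫ ξ in A, (f x - f (x + ξ)) * jumpKernel s ξ ≤ C * (innerMoment n s * r ^ (2 - 2 * s)) := by
    calc _ = ∫ ξ in A, ((f x - f (x + ξ)) * jumpKernel s ξ + (f x - f (x - ξ)) * jumpKernel s ξ) := by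
          rw [integral_add iA iA', ← hneg, two_mul]
      _ ≤ ∫ ξ in A, C * (‖ξ‖ ^ 2 * jumpKernel s ξ) := by
          refine setIntegral_mono_on (iA.add iA') i2 hmd fun ξ hξ => ?_
          have := mul_le_mul_of_nonneg_right (hdd ξ hξ.1) (jumpKernel_nonneg (s := s) ξ)
          unfold secondDiff at this
          linarith
      _ ≤ _ := by
          rw [integral_const_mul, integral_sq_jumpKernel_annulus hn hs1 hr' h]
          have := mul_nonneg (innerMoment_nonneg (n := n) (s := s)) (Real.rpow_nonneg hr'.le (2 - 2 * s))
          gcongr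
          linarith
  have h3 : trunc s r' f x = trunc s r f x + ∫ ξ in A, (f x - f (x + ξ)) * jumpKernel s ξ := by
    unfold trunc
    rw [compl_ball_eq_union h, setIntegral_union
      (disjoint_left.2 fun _ h1 h2 => (mem_compl_iff _ _).1 h1 h2.1) hmd
      (hw.integrableOn_sub hs0 hc x hr) iA]
  have h4 : 0 ≤ C * (innerMoment n s * r ^ (2 - 2 * s)) :=
    mul_nonneg hC (mul_nonneg innerMoment_nonneg (by positivity))
  linarith

lemma trunc_neg (r : ℝ) (f : E n → ℝ) (x : E n) : trunc s r (fun x => -f x) x = -trunc s r f x := by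
  unfold trunc
  rw [← integral_neg]
  congr 1
  funext ξ
  ring

lemma trunc_sub (hs : 0 < s) {f g : E n → ℝ} (hf : WeightedIntegrable s f) (hfc : Continuous f)
    (hg : WeightedIntegrable s g) (hgc : Continuous g) {r : ℝ} (hr : 0 < r) (x : E n) :
    trunc s r (fun x => f x - g x) x = trunc s r f x - trunc s r g x := by
  unfold trunc
  rw [← integral_sub (hf.integrableOn_sub hs hfc x hr) (hg.integrableOn_sub hs hgc x hr)]
  congr 1
  funext ξ
  ring

lemma abs_trunc_le_of_bounded (hs : 0 < s) {f : E n → ℝ} {V r : ℝ} (hr : 0 < r)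
    (hf : ∀ x, |f x| ≤ V) (x : E n) :
    |trunc s r f x| ≤ 2 * V * (outerMass n s * r ^ (-(2 * s))) := by
  unfold trunc
  rw [← integral_jumpKernel_compl hr, ← integral_const_mul, ← Real.norm_eq_abs]
  refine norm_integral_le_of_norm_le ((integrableOn_jumpKernel hs hr).const_mul _)
    (.of_forall fun ξ => ?_)
  rw [norm_mul, Real.norm_of_nonneg (jumpKernel_nonneg ξ), Real.norm_eq_abs]
  have := jumpKernel_nonneg (s := s) ξ
  gcongr
  refine (abs_sub _ _).trans ?_
  linarith [hf x, hf (x + ξ)]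

/-- The truncated operator of a Lipschitz function is Lipschitz, with a constant that depends on the
radius. -/
lemma LipBound.trunc (hs : 0 < s) {K : ℝ} {f : E n → ℝ} (hw : WeightedIntegrable s f)
    (hf : LipBound K f) {r : ℝ} (hr : 0 < r) :
    LipBound (2 * K * (outerMass n s * r ^ (-(2 * s)))) (trunc s r f) := by
  intro x x'
  have hc := hf.continuous
  unfold FracObstacle.trunc
  rw [← integral_sub (hw.integrableOn_sub hs hc x hr) (hw.integrableOn_sub hs hc x' hr),
    ← integral_jumpKernel_compl hr, mul_right_comm, ← integral_const_mul, ← Real.norm_eq_abs]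
  refine norm_integral_le_of_norm_le ((integrableOn_jumpKernel hs hr).const_mul _)
    (.of_forall fun ξ => ?_)
  rw [← sub_mul, norm_mul, Real.norm_of_nonneg (jumpKernel_nonneg ξ), Real.norm_eq_abs]
  refine mul_le_mul_of_nonneg_right ?_ (jumpKernel_nonneg ξ)
  have h1 := hf x x'
  have h2 := hf (x + ξ) (x' + ξ)
  rw [add_sub_add_right_eq_sub] at h2
  calc _ = |(f x - f x') - (f (x + ξ) - f (x' + ξ))| := by congr 1; ring
    _ ≤ _ := (abs_sub _ _).trans (by linarith)

/-! ### Mollifiers at a given scale -/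

/-- An even mollifier of scale `R` supported in the annulus `R/2 ≤ |y| ≤ R`, which is dominated by
the jump kernel and has second differences of the natural size in `L¹`. -/
structure IsMollifier {n : ℕ} (s c R : ℝ) (A : E n → ℝ) : Prop where
  cont : Continuous A
  supp : HasCompactSupport A
  nonneg : ∀ y, 0 ≤ A y
  even : ∀ y, A (-y) = A y
  integral_one : ∫ y, A y = 1
  zero_near : ∀ y, ‖y‖ < R / 2 → A y = 0
  zero_far : ∀ y, R < ‖y‖ → A y = 0
  le_kernel : ∀ y, A y ≤ c * R ^ (2 * s) * jumpKernel s y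
  integral_secondDiff_le : ∀ h, ‖h‖ ≤ R → ∫ y, |secondDiff h A y| ≤ c * (‖h‖ / R) ^ 2

/-- Second differences of a `C²` function with compact support are quadratically small. -/
lemma exists_secondDiff_le {φ : E n → ℝ} (hφ : ContDiff ℝ 2 φ) (hs : HasCompactSupport φ) :
    ∃ c, 0 ≤ c ∧ ∀ h x, |secondDiff h φ x| ≤ c * ‖h‖ ^ 2 := by
  have h1 : ContDiff ℝ 1 (fderiv ℝ φ) := hφ.fderiv_right (by norm_num)
  obtain ⟨L, hL⟩ := h1.lipschitzWith_of_hasCompactSupport (hs.fderiv ℝ) (by norm_num)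
  refine ⟨2 * L, by positivity, fun h x => ?_⟩
  have hd : Differentiable ℝ φ := hφ.differentiable (by norm_num)
  have key := (convex_closedBall (0 : E n) ‖h‖).norm_image_sub_le_of_norm_hasFDerivWithin_le
    (f := fun z => φ (x + z) + φ (x - z))
    (f' := fun z => fderiv ℝ φ (x + z) - fderiv ℝ φ (x - z)) (C := 2 * L * ‖h‖) (x := 0) (y := h)
    (fun z _ => ?_) (fun z hz => ?_) (by simp) (by simp)
  · simp only [sub_zero, add_zero] at key
    rw [Real.norm_eq_abs] at key
    unfold secondDiff
    calc _ = |φ (x + h) + φ (x - h) - (φ x + φ x)| := by rw [two_mul]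
      _ ≤ _ := key
      _ = _ := by ring
  · have e1 : HasFDerivAt (fun z => φ (x + z)) (fderiv ℝ φ (x + z)) z := by
      have := (hd (x + z)).hasFDerivAt.comp z ((hasFDerivAt_id z).const_add x)
      exact this.congr_fderiv (by ext; simp)
    have e2 : HasFDerivAt (fun z => φ (x - z)) (-fderiv ℝ φ (x - z)) z := by
      have := (hd (x - z)).hasFDerivAt.comp z ((hasFDerivAt_id z).const_sub x)
      refine this.congr_fderiv ?_
      ext; simp
    rw [sub_eq_add_neg]
    exact (e1.add e2).hasFDerivWithinAt
  · have h3 := hL.dist_le_mul (x + z) (x - z)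
    rw [dist_eq_norm, dist_eq_norm, add_sub_sub_cancel, ← two_smul ℝ z, norm_smul] at h3
    have h4 : ‖z‖ ≤ ‖h‖ := by simpa using hz
    have h5 : ‖(2 : ℝ)‖ = 2 := by norm_num
    rw [h5] at h3
    calc _ ≤ L * (2 * ‖z‖) := h3
      _ ≤ L * (2 * ‖h‖) := by gcongr
      _ = _ := by ring

lemma exists_unit_bump (hn : 0 < n) : ∃ A : E n → ℝ, ContDiff ℝ 2 A ∧ HasCompactSupport A ∧
    (∀ y, 0 ≤ A y) ∧ (∀ y, A (-y) = A y) ∧ ∫ y, A y = 1 ∧ (∀ y, ‖y‖ < 1 / 2 → A y = 0) ∧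
    (∀ y, 1 < ‖y‖ → A y = 0) := by
  have : Nontrivial (E n) := by
    have : Nonempty (Fin n) := ⟨⟨0, hn⟩⟩
    infer_instance
  obtain ⟨e, he⟩ := exists_norm_eq (E n) (c := 3 / 4) (by norm_num)
  let b : ContDiffBump e := ⟨1 / 8, 1 / 4, by norm_num, by norm_num⟩
  set φ := b.normed volume with hφ
  have hc : ContDiff ℝ 2 φ := b.contDiff_normed
  have hs : HasCompactSupport φ := b.hasCompactSupport_normed
  have hz : ∀ y, 1 / 4 ≤ dist y e → φ y = 0 := by
    intro y hy
    have : y ∉ Function.support φ := by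
      rw [hφ, b.support_normed_eq]
      simpa [b] using hy
    simpa using this
  have h1 : ∫ y, φ y = 1 := b.integral_normed
  have h2 : ∫ y, φ (-y) = 1 := by rw [integral_neg_eq_self, h1]
  have hs' : HasCompactSupport fun y => φ (-y) := hs.comp_homeomorph (Homeomorph.neg (E n))
  have hcn : ContDiff ℝ 2 fun y => φ (-y) := hc.comp contDiff_neg
  have hz' : ∀ y, ‖y‖ < 1 / 2 ∨ 1 < ‖y‖ → φ y = 0 := by
    intro y hy
    refine hz y ?_
    rw [dist_eq_norm]
    rcases hy with hy | hy
    · have := norm_sub_norm_le e y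
      rw [norm_sub_rev]; linarith
    · have := norm_sub_norm_le y e
      linarith
  have hp : ∀ y, 0 ≤ φ y := fun y => b.nonneg_normed y
  refine ⟨fun y => (φ y + φ (-y)) / 2, (hc.add hcn).div_const 2, ?_, fun y => ?_, fun y => ?_, ?_,
    fun y hy => ?_, fun y hy => ?_⟩
  · simp only [div_eq_mul_inv]
    exact (hs.add hs').mul_right (f' := fun _ => (2⁻¹ : ℝ))
  · have := hp y; have := hp (-y); positivity
  · simp only [neg_neg]; ring
  · rw [integral_div, integral_add (hc.continuous.integrable_of_hasCompactSupport hs)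
      (hcn.continuous.integrable_of_hasCompactSupport hs'), h1, h2]; norm_num
  · beta_reduce
    rw [hz' y (.inl hy), hz' (-y) (.inl (by simpa using hy))]; simp
  · beta_reduce
    rw [hz' y (.inr hy), hz' (-y) (.inr (by simpa using hy))]; simp

/-- Mollifiers of all scales exist, with one constant. -/
lemma exists_mollifier (hn : 0 < n) (hs0 : 0 < s) : ∃ c, 0 < c ∧ ∃ A : ℝ → E n → ℝ,
    ∀ R, 0 < R → IsMollifier s c R (A R) := by
  obtain ⟨A, hA2, hAs, hA0, hAe, hA1, hAn, hAf⟩ := exists_unit_bump hn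
  obtain ⟨c₁, hc₁, hdd⟩ := exists_secondDiff_le hA2 hAs
  obtain ⟨c₂, hc₂⟩ := hA2.continuous.bounded_above_of_compact_support hAs
  set ν := volume.real (Metric.closedBall (0 : E n) 2) with hν
  set c := 1 + |c₂| + c₁ * ν with hc
  have hν0 : 0 ≤ ν := measureReal_nonneg
  have hc0 : 0 ≤ c₁ * ν := by positivity
  refine ⟨c, by positivity, fun R y => (R ^ n)⁻¹ * A (R⁻¹ • y), fun R hR => ?_⟩
  have hcont : Continuous fun y => A (R⁻¹ • y) := hA2.continuous.comp (continuous_const_smul R⁻¹)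
  have hsc : ∀ g : E n → ℝ, ∫ y, (R ^ n)⁻¹ * g (R⁻¹ • y) = ∫ y, g y := by
    intro g
    rw [integral_const_mul, Measure.integral_comp_inv_smul_of_nonneg _ _ hR.le, smul_eq_mul,
      finrank_euclideanSpace, Fintype.card_fin, ← mul_assoc, inv_mul_cancel₀ (by positivity), one_mul]
  have hnorm : ∀ y : E n, ‖R⁻¹ • y‖ = ‖y‖ / R := by
    intro y
    rw [norm_smul, norm_inv, Real.norm_of_nonneg hR.le, inv_mul_eq_div]
  refine ⟨continuous_const.mul hcont, ?_, fun y => ?_, fun y => ?_, ?_, fun y hy => ?_,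
    fun y hy => ?_, fun y => ?_, fun h hh => ?_⟩
  · have h1 : HasCompactSupport fun y => A (R⁻¹ • y) :=
      hAs.comp_homeomorph (Homeomorph.smulOfNeZero R⁻¹ (inv_ne_zero hR.ne'))
    exact h1.mul_left (f := fun _ => (R ^ n)⁻¹)
  · have := hA0 (R⁻¹ • y); positivity
  · beta_reduce
    rw [smul_neg, hAe]
  · rw [hsc, hA1]
  · beta_reduce
    rw [hAn, mul_zero]
    rw [hnorm, div_lt_iff₀ hR]; linarith
  · beta_reduce
    rw [hAf, mul_zero]
    rw [hnorm, lt_div_iff₀ hR]; linarith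
  · beta_reduce
    by_cases hy : ‖y‖ < R / 2 ∨ R < ‖y‖
    · have : A (R⁻¹ • y) = 0 := by
        rcases hy with hy | hy
        · apply hAn; rw [hnorm, div_lt_iff₀ hR]; linarith
        · apply hAf; rw [hnorm, lt_div_iff₀ hR]; linarith
      rw [this, mul_zero]
      have := jumpKernel_nonneg (s := s) y
      positivity
    · push Not at hy
      have hy0 : 0 < ‖y‖ := by linarith [hy.1]
      have h1 : A (R⁻¹ • y) ≤ c := by
        have := (le_abs_self _).trans (hc₂ (R⁻¹ • y))
        have := le_abs_self c₂
        linarith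
      have h2 : (R ^ ((n : ℝ) + 2 * s))⁻¹ ≤ jumpKernel s y := by
        unfold jumpKernel
        gcongr
        exact hy.2
      have h3 : (R ^ n)⁻¹ = R ^ (2 * s) * (R ^ ((n : ℝ) + 2 * s))⁻¹ := by
        rw [Real.rpow_add hR, Real.rpow_natCast]
        have : R ^ (2 * s) ≠ 0 := by positivity
        field_simp
      calc _ ≤ (R ^ n)⁻¹ * c := mul_le_mul_of_nonneg_left h1 (by positivity)
        _ = c * R ^ (2 * s) * (R ^ ((n : ℝ) + 2 * s))⁻¹ := by rw [h3]; ring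
        _ ≤ _ := by gcongr
  · have e1 : ∀ y, |secondDiff h (fun y => (R ^ n)⁻¹ * A (R⁻¹ • y)) y|
        = (R ^ n)⁻¹ * |secondDiff (R⁻¹ • h) A (R⁻¹ • y)| := by
      intro y
      unfold secondDiff
      beta_reduce
      rw [← abs_of_nonneg (show 0 ≤ (R ^ n)⁻¹ by positivity), ← abs_mul,
        abs_of_nonneg (show 0 ≤ (R ^ n)⁻¹ by positivity), smul_add, smul_sub]
      congr 1; ring
    simp only [e1]
    rw [hsc fun y => |secondDiff (R⁻¹ • h) A y|]
    have hh' : ‖R⁻¹ • h‖ ≤ 1 := by rw [hnorm]; exact div_le_one_of_le₀ hh hR.le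
    have e2 : ∫ y, |secondDiff (R⁻¹ • h) A y|
        = ∫ y in Metric.closedBall (0 : E n) 2, |secondDiff (R⁻¹ • h) A y| := by
      symm
      apply setIntegral_eq_integral_of_forall_compl_eq_zero
      intro y hy
      have hy2 : 2 < ‖y‖ := by simpa using hy
      have hfar : ∀ z : E n, ‖z‖ ≤ 1 → A (y + z) = 0 := by
        intro z hz
        apply hAf
        have := norm_sub_norm_le y (-z)
        rw [sub_neg_eq_add, norm_neg] at this
        linarith
      unfold secondDiff
      have h1 := hfar _ hh'
      have h2 := hfar (-(R⁻¹ • h)) (by rwa [norm_neg])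
      have h3 := hfar 0 (by simp)
      rw [add_zero] at h3
      rw [← sub_eq_add_neg] at h2
      rw [h1, h2, h3]; simp
    rw [e2]
    have h4 := norm_setIntegral_le_of_norm_le_const (μ := volume)
      (s := Metric.closedBall (0 : E n) 2) (f := fun y => |secondDiff (R⁻¹ • h) A y|)
      (C := c₁ * ‖R⁻¹ • h‖ ^ 2) measure_closedBall_lt_top
      (fun y _ => by rw [Real.norm_eq_abs, abs_abs]; exact hdd _ _)
    refine (le_abs_self _).trans (h4.trans ?_)
    rw [hnorm, ← hν, mul_right_comm]
    gcongr
    rw [hc]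
    linarith [abs_nonneg c₂]

namespace IsMollifier

variable {c R : ℝ} {A : E n → ℝ}

lemma integral_abs (hA : IsMollifier s c R A) : ∫ y, |A y| = 1 := by
  simp only [abs_of_nonneg (hA.nonneg _)]
  exact hA.integral_one

lemma integrable (hA : IsMollifier s c R A) : Integrable A :=
  hA.cont.integrable_of_hasCompactSupport hA.supp

lemma integral_norm_mul_le (hA : IsMollifier s c R A) : ∫ y, ‖y‖ * |A y| ≤ R := by
  calc _ ≤ ∫ y, R * A y := by
        refine integral_mono (Continuous.integrable_of_hasCompactSupport
          (by have := hA.cont; fun_prop) (HasCompactSupport.mul_left (f := fun y => ‖y‖) hA.supp.norm))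
          (hA.integrable.const_mul R) fun y => ?_
        simp only
        rw [abs_of_nonneg (hA.nonneg _)]
        rcases le_or_gt ‖y‖ R with h | h
        · have := hA.nonneg y; gcongr
        · rw [hA.zero_far y h]; simp
    _ = R := by rw [integral_const_mul, hA.integral_one, mul_one]

lemma abs_conv_sub_le (hA : IsMollifier s c R A) {K : ℝ} (hK : 0 ≤ K) {f : E n → ℝ}
    (hf : LipBound K f) (x : E n) : |conv f A x - f x| ≤ K * R := by
  have := hf.abs_conv_sub_le hA.cont hA.supp x
  rw [hA.integral_one, mul_one] at this
  exact this.trans (by gcongr; exact hA.integral_norm_mul_le)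

lemma lipBound_conv (hA : IsMollifier s c R A) {K : ℝ} {f : E n → ℝ} (hf : LipBound K f) :
    LipBound K (conv f A) := by
  have := hf.conv hA.cont hA.supp
  rwa [hA.integral_abs, mul_one] at this

/-- Second differences of `f * A_R` are controlled by the Lipschitz constant of `f`, with a gain
as `R → ∞`. -/
lemma abs_secondDiff_conv_le (hA : IsMollifier s c R A) {K : ℝ} (hK : 0 ≤ K)
    {f : E n → ℝ} (hf : LipBound K f) {h : E n} (hh : ‖h‖ ≤ R) (x : E n) :
    |secondDiff h (conv f A) x| ≤ K * (2 * R * (c * (‖h‖ / R) ^ 2)) := by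
  have hc := hf.continuous
  have hdc := secondDiff_continuous hA.cont h
  have hds := secondDiff_hasCompactSupport hA.supp h
  rw [← conv_secondDiff_right hc hA.cont hA.supp]
  have h0 : ∫ y, secondDiff h A y = 0 := by
    unfold secondDiff
    have i1 : Integrable fun y => A (y + h) := hA.integrable.comp_add_right h
    have i2 : Integrable fun y => A (y - h) := hA.integrable.comp_sub_right h
    have i3 : Integrable fun y => A (y + h) + A (y - h) := i1.add i2
    rw [integral_sub i3 (hA.integrable.const_mul 2), integral_add i1 i2,
      integral_add_right_eq_self A h, integral_sub_right_eq_self A h, integral_const_mul]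
    ring
  have h1 := hf.abs_conv_sub_le hdc hds x
  rw [h0, mul_zero, sub_zero] at h1
  refine h1.trans ?_
  gcongr
  calc _ ≤ ∫ y, 2 * R * |secondDiff h A y| := by
        refine integral_mono (Continuous.integrable_of_hasCompactSupport (by fun_prop)
          (HasCompactSupport.mul_left (f := fun y => ‖y‖) hds.norm))
          ((hdc.integrable_of_hasCompactSupport hds).norm.const_mul _) fun y => ?_
        simp only
        rcases le_or_gt ‖y‖ (2 * R) with h2 | h2
        · gcongr
        · have hfar : ∀ z : E n, ‖z‖ ≤ R → A (y + z) = 0 := by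
            intro z hz
            apply hA.zero_far
            have := norm_sub_norm_le y (-z)
            rw [sub_neg_eq_add, norm_neg] at this
            linarith
          have h1 := hfar _ hh
          have h2 := hfar (-h) (by rwa [norm_neg])
          have h3 := hfar 0 (by simpa using (norm_nonneg h).trans hh)
          rw [add_zero] at h3
          rw [← sub_eq_add_neg] at h2
          unfold secondDiff
          rw [h1, h2, h3]; simp
    _ ≤ _ := by
      rw [integral_const_mul]
      have : 0 ≤ R := (norm_nonneg h).trans hh
      gcongr
      exact hA.integral_secondDiff_le h hh

end IsMollifier

/-! ### Two-sided bounds on the truncated operators -/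

lemma tendsto_rpow_sub_zero (hs1 : s < 1) (a b : ℝ) :
    Tendsto (fun r : ℝ => a + b * r ^ (2 - 2 * s)) (𝓝[>] 0) (𝓝 a) := by
  have h := (tendsto_rpow_nhdsGT_zero (a := 2 - 2 * s) (by linarith) b).const_add a
  simpa using h

/-- A maximum principle: a bounded function whose truncated operators are at most `m` exceeds its
averages against a kernel below `Γ J` by at most `Γ m`. -/
lemma le_of_conv_le (hs0 : 0 < s) (hs1 : s < 1) {v G : E n → ℝ} (hvc : Continuous v)
    (hv : WeightedIntegrable s v) {V : ℝ} (hV : ∀ x, v x ≤ V) {m B : ℝ}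
    (htr : ∀ r, 0 < r → ∀ x, trunc s r v x ≤ m + B * r ^ (2 - 2 * s))
    (hGc : Continuous G) (hGs : HasCompactSupport G) (hG1 : ∫ y, G y = 1)
    {ρ : ℝ} (hρ : 0 < ρ) (hGρ : ∀ y, ‖y‖ < ρ → G y = 0) {Γ : ℝ} (hΓ : 0 ≤ Γ)
    (hGΓ : ∀ y, G y ≤ Γ * jumpKernel s y) {b : ℝ} (hav : ∀ x, conv v G x ≤ b) (x : E n) :
    v x ≤ b + Γ * m := by
  set S := ⨆ x, v x with hS
  have hbdd : BddAbove (range v) := ⟨V, by rintro _ ⟨x, rfl⟩; exact hV x⟩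
  have hle : ∀ x, v x ≤ S := fun x => le_ciSup hbdd x
  -- evaluate at a point where `v` is within `ε` of its supremum `S`: there `S - v` is nonnegative, so
  -- its integral against `G` is at most `Γ` times its integral against the kernel
  have key : ∀ r, 0 < r → r < ρ → ∀ ε, 0 < ε →
      S - b ≤ Γ * (m + B * r ^ (2 - 2 * s)) + Γ * (outerMass n s * r ^ (-(2 * s))) * ε := by
    intro r hr hrρ ε hε
    obtain ⟨x, hx⟩ := exists_lt_of_lt_ciSup (show S - ε < ⨆ x, v x by rw [← hS]; linarith)
    have iG := hGc.integrable_of_hasCompactSupport (μ := volume) hGs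
    have iv := conv_integrable hvc hGc hGs x
    have e1 : S - conv v G x = ∫ y, (S - v (x - y)) * G y := by
      simp only [sub_mul]
      rw [integral_sub (iG.const_mul S) iv, integral_const_mul, hG1, mul_one]
      rfl
    have iJ := integrableOn_jumpKernel (n := n) hs0 hr
    have isub := hv.integrableOn_sub hs0 hvc x hr
    have e2 : ∫ y in (Metric.ball (0 : E n) r)ᶜ, (S - v (x + y)) * jumpKernel s y
        = trunc s r v x + (S - v x) * (outerMass n s * r ^ (-(2 * s))) := by
      rw [← integral_jumpKernel_compl hr, ← integral_const_mul]
      unfold trunc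
      rw [← integral_add isub (iJ.const_mul _)]
      congr 1; funext y; ring
    have i2 : IntegrableOn (fun y => (S - v (x + y)) * jumpKernel s y) (Metric.ball (0 : E n) r)ᶜ := by
      refine (isub.add (iJ.const_mul (S - v x))).congr (.of_forall fun y => ?_)
      simp only [Pi.add_apply]; ring
    have e3 : ∫ y, (S - v (x - y)) * G y = ∫ y, (S - v (x + y)) * G (-y) := by
      rw [← integral_neg_eq_self]
      simp only [sub_neg_eq_add]
    have e4 : ∫ y, (S - v (x + y)) * G (-y)
        = ∫ y in (Metric.ball (0 : E n) r)ᶜ, (S - v (x + y)) * G (-y) := by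
      symm
      apply setIntegral_eq_integral_of_forall_compl_eq_zero
      intro y hy
      have : ‖y‖ < r := by simpa using hy
      rw [hGρ _ (by rw [norm_neg]; linarith), mul_zero]
    have i3 : Integrable fun y => (S - v (x + y)) * G (-y) := by
      refine Continuous.integrable_of_hasCompactSupport (by fun_prop) ?_
      exact HasCompactSupport.mul_left (hGs.comp_homeomorph (Homeomorph.neg (E n)))
    have e5 : ∫ y in (Metric.ball (0 : E n) r)ᶜ, (S - v (x + y)) * G (-y)
        ≤ ∫ y in (Metric.ball (0 : E n) r)ᶜ, Γ * ((S - v (x + y)) * jumpKernel s y) := by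
      refine integral_mono i3.integrableOn (i2.const_mul Γ) fun y => ?_
      have h1 := hGΓ (-y)
      rw [jumpKernel_neg] at h1
      have h2 := mul_le_mul_of_nonneg_left h1 (sub_nonneg.2 (hle (x + y)))
      simp only
      linarith
    rw [integral_const_mul, e2] at e5
    have h1 := hav x
    have h2 := mul_le_mul_of_nonneg_left (htr r hr x) hΓ
    have h3 : 0 ≤ outerMass n s * r ^ (-(2 * s)) := by
      rw [← integral_jumpKernel_compl hr]
      exact integral_nonneg fun y => jumpKernel_nonneg y
    have h4 : (S - v x) * (outerMass n s * r ^ (-(2 * s))) ≤ ε * (outerMass n s * r ^ (-(2 * s))) := by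
      gcongr; linarith
    have h5 := mul_le_mul_of_nonneg_left h4 hΓ
    nlinarith [e1, e3, e4, e5]
  have key2 : ∀ r, 0 < r → r < ρ → S - b ≤ Γ * (m + B * r ^ (2 - 2 * s)) := by
    intro r hr hrρ
    have ht : Tendsto (fun ε : ℝ => Γ * (m + B * r ^ (2 - 2 * s))
        + Γ * (outerMass n s * r ^ (-(2 * s))) * ε) (𝓝[>] 0) (𝓝 (Γ * (m + B * r ^ (2 - 2 * s)))) := by
      refine Tendsto.mono_left (Continuous.tendsto' (by fun_prop) _ _ (by simp)) nhdsWithin_le_nhds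
    exact ge_of_tendsto ht (eventually_mem_nhdsWithin.mono fun ε hε => key r hr hrρ ε hε)
  have h6 : S - b ≤ Γ * m := by
    refine ge_of_tendsto ((tendsto_rpow_sub_zero hs1 m B).const_mul Γ) ?_
    filter_upwards [Ioo_mem_nhdsGT hρ] with r hr
    exact key2 r hr.1 hr.2
  linarith [hle x]

/-- Lipschitz functions with bounded second differences (constants `K`, `B`), all of whose
truncated operators are bounded by `M` up to the error due to the second differences. -/
structure Tame {n : ℕ} (s M K B : ℝ) (f : E n → ℝ) : Prop where
  M_nonneg : 0 ≤ M
  K_nonneg : 0 ≤ K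
  B_nonneg : 0 ≤ B
  lip : LipBound K f
  weighted : WeightedIntegrable s f
  abs_secondDiff_le : ∀ ξ x, |secondDiff ξ f x| ≤ B * ‖ξ‖ ^ 2
  abs_trunc_le : ∀ r, 0 < r → ∀ x, |trunc s r f x| ≤ M + B * (innerMoment n s * r ^ (2 - 2 * s))

lemma WeightedIntegrable.neg {f : E n → ℝ} (hf : WeightedIntegrable s f) :
    WeightedIntegrable s fun x => -f x := by
  unfold WeightedIntegrable at *
  simpa only [abs_neg] using hf

namespace Tame

variable {M K B : ℝ} {f : E n → ℝ}

lemma neg (hf : Tame s M K B f) : Tame s M K B fun x => -f x where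
  M_nonneg := hf.M_nonneg
  K_nonneg := hf.K_nonneg
  B_nonneg := hf.B_nonneg
  lip x y := by
    have := hf.lip x y
    rwa [show -f x - -f y = -(f x - f y) by ring, abs_neg]
  weighted := hf.weighted.neg
  abs_secondDiff_le ξ x := by
    have := hf.abs_secondDiff_le ξ x
    unfold secondDiff at *
    rwa [show -f (x + ξ) + -f (x - ξ) - 2 * -f x = -(f (x + ξ) + f (x - ξ) - 2 * f x) by ring,
      abs_neg]
  abs_trunc_le r hr x := by
    rw [trunc_neg, abs_neg]
    exact hf.abs_trunc_le r hr x

lemma abs_trunc_conv_le (hs0 : 0 < s) (hf : Tame s M K B f) {η : E n → ℝ} (hη : Continuous η)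
    (hs : HasCompactSupport η) {r : ℝ} (hr : 0 < r) (x : E n) :
    |trunc s r (conv f η) x|
      ≤ (M + B * (innerMoment n s * r ^ (2 - 2 * s))) * ∫ y, |η y| := by
  rw [trunc_conv hs0 hf.weighted hf.lip hη hs hr]
  exact abs_conv_le hη hs (hf.abs_trunc_le r hr) x

variable {c : ℝ} {A : ℝ → E n → ℝ}

/-- One step of the iteration over dyadic scales for second differences of mollifications. -/
lemma secondDiff_conv_le_step (hs0 : 0 < s) (hs1 : s < 1) (hf : Tame s M K B f) (hc : 0 < c)
    (hA : ∀ R, 0 < R → IsMollifier s c R (A R)) {R : ℝ} (hR : 0 < R) {h : E n} (hh : ‖h‖ ≤ R)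
    {b : ℝ} (hb : ∀ x, secondDiff h (conv f (A (2 * R))) x ≤ b) (x : E n) :
    secondDiff h (conv f (A R)) x
      ≤ b + c * (2 * R) ^ (2 * s) * (M * (c * (‖h‖ / R) ^ 2)) := by
  have h1 := hA R hR
  have h2 := hA (2 * R) (by positivity)
  have hfc := hf.lip.continuous
  have hg1 := h1.lipBound_conv hf.lip
  have hg2 := h2.lipBound_conv hf.lip
  have hgc1 := hg1.continuous
  have hgc2 := hg2.continuous
  have hdc := secondDiff_continuous h1.cont h
  have hds := secondDiff_hasCompactSupport h1.supp h
  have heq : secondDiff h (conv f (A R)) = conv f (secondDiff h (A R)) := by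
    funext x; rw [conv_secondDiff_right hfc h1.cont h1.supp]
  have hm : ∫ y, |secondDiff h (A R) y| ≤ c * (‖h‖ / R) ^ 2 := h1.integral_secondDiff_le h hh
  have hM := hf.M_nonneg
  have hB := hf.B_nonneg
  have hk := innerMoment_nonneg (n := n) (s := s)
  have hmp := le_of_conv_le hs0 hs1 (v := secondDiff h (conv f (A R))) (G := A (2 * R))
    (secondDiff_continuous hgc1 h)
    (by rw [heq]; exact hf.weighted.conv hs0 hf.lip hdc hds)
    (fun x => (le_abs_self _).trans (h1.abs_secondDiff_conv_le hf.K_nonneg hf.lip hh x))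
    (m := M * (c * (‖h‖ / R) ^ 2)) (B := B * innerMoment n s * (c * (‖h‖ / R) ^ 2))
    (fun r hr x => ?_) h2.cont h2.supp h2.integral_one (ρ := R) hR
    (fun y hy => h2.zero_near y (by linarith)) (Γ := c * (2 * R) ^ (2 * s)) (by positivity)
    h2.le_kernel (b := b) (fun x => ?_) x
  · exact hmp
  · rw [heq]
    refine (le_abs_self _).trans ((hf.abs_trunc_conv_le hs0 hdc hds hr x).trans ?_)
    calc _ ≤ (M + B * (innerMoment n s * r ^ (2 - 2 * s))) * (c * (‖h‖ / R) ^ 2) := by gcongr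
      _ = _ := by ring
  · rw [conv_secondDiff hgc1 h2.cont h2.supp]
    -- exchange the two averages, so that the assumption on the scale `2 * R` applies
    have e : conv (conv f (A R)) (A (2 * R)) = conv (conv f (A (2 * R))) (A R) := by
      funext x; exact conv_conv_comm hf.lip h1.cont h1.supp h2.cont h2.supp x
    rw [e, ← conv_secondDiff hgc2 h1.cont h1.supp]
    calc conv (secondDiff h (conv f (A (2 * R)))) (A R) x
        ≤ ∫ y, b * A R y := by
          refine integral_mono (conv_integrable (secondDiff_continuous hgc2 h) h1.cont h1.supp x)
            (h1.integrable.const_mul b) fun y => ?_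
          exact mul_le_mul_of_nonneg_right (hb _) (h1.nonneg y)
      _ = b := by rw [integral_const_mul, h1.integral_one, mul_one]

/-- The bound after `N` doublings of the scale: the crude Lipschitz bound at scale `2 ^ N * R`, and the
errors of the `N` steps. -/
lemma secondDiff_conv_le_iterate (hs0 : 0 < s) (hs1 : s < 1) (hf : Tame s M K B f) (hc : 0 < c)
    (hA : ∀ R, 0 < R → IsMollifier s c R (A R)) {h : E n} (N : ℕ) :
    ∀ R, 0 < R → ‖h‖ ≤ R → ∀ x, secondDiff h (conv f (A R)) x
      ≤ 2 * K * c * ‖h‖ ^ 2 / (2 ^ N * R)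
        + c ^ 2 * 2 ^ (2 * s) * M * (R ^ (2 * s - 2) * ‖h‖ ^ 2)
          * ∑ j ∈ Finset.range N, ((2 : ℝ) ^ (2 * s - 2)) ^ j := by
  induction N with
  | zero =>
    intro R hR hh x
    refine ((le_abs_self _).trans ((hA R hR).abs_secondDiff_conv_le hf.K_nonneg hf.lip hh x)).trans
      (le_of_eq ?_)
    simp only [Finset.range_zero, Finset.sum_empty]
    field_simp
    ring
  | succ N ih =>
    intro R hR hh x
    have h2 : ‖h‖ ≤ 2 * R := by linarith
    refine (hf.secondDiff_conv_le_step hs0 hs1 hc hA hR hh (ih (2 * R) (by positivity) h2) x).trans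
      (le_of_eq ?_)
    rw [Finset.sum_range_succ', pow_zero]
    simp only [pow_succ]
    rw [← Finset.sum_mul, Real.mul_rpow (by norm_num) hR.le, Real.mul_rpow (by norm_num) hR.le,
      show R ^ (2 * s - 2) = R ^ (2 * s) / R ^ 2 by
        rw [Real.rpow_sub hR]; norm_cast]
    field_simp
    ring

/-- Second differences of `f * A_R` are of size `M R^(2s-2) |h|²`, independently of the constants
`K` and `B`: sum the geometric series over the dyadic scales above `R`. -/
lemma abs_secondDiff_conv_le (hs0 : 0 < s) (hs1 : s < 1) (hf : Tame s M K B f) (hc : 0 < c)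
    (hA : ∀ R, 0 < R → IsMollifier s c R (A R)) {R : ℝ} (hR : 0 < R) {h : E n} (hh : ‖h‖ ≤ R)
    (x : E n) : |secondDiff h (conv f (A R)) x|
      ≤ c ^ 2 * 2 ^ (2 * s) * (1 - 2 ^ (2 * s - 2))⁻¹ * M * R ^ (2 * s - 2) * ‖h‖ ^ 2 := by
  have hq0 : (0 : ℝ) < 2 ^ (2 * s - 2) := by positivity
  have hq1 : (2 : ℝ) ^ (2 * s - 2) < 1 := Real.rpow_lt_one_of_one_lt_of_neg (by norm_num) (by linarith)
  have key : ∀ g : E n → ℝ, Tame s M K B g → secondDiff h (conv g (A R)) x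
      ≤ c ^ 2 * 2 ^ (2 * s) * (1 - 2 ^ (2 * s - 2))⁻¹ * M * R ^ (2 * s - 2) * ‖h‖ ^ 2 := by
    intro g hg
    have h1 : Tendsto (fun N : ℕ => 2 * K * c * ‖h‖ ^ 2 / (2 ^ N * R)) atTop (𝓝 0) := by
      refine Tendsto.div_atTop tendsto_const_nhds ?_
      exact (tendsto_pow_atTop_atTop_of_one_lt (by norm_num)).atTop_mul_const hR
    have h2 := (hasSum_geometric_of_lt_one hq0.le hq1).tendsto_sum_nat
    have h3 := h1.add (h2.const_mul (c ^ 2 * 2 ^ (2 * s) * M * (R ^ (2 * s - 2) * ‖h‖ ^ 2)))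
    have := ge_of_tendsto' h3 fun N => hg.secondDiff_conv_le_iterate hs0 hs1 hc hA N R hR hh x
    refine this.trans (le_of_eq ?_)
    ring
  refine abs_le.2 ⟨?_, key f hf⟩
  have h1 := key _ hf.neg
  have h2 : conv (fun x => -f x) (A R) = fun x => -conv f (A R) x := by
    funext x; exact conv_neg _ _ _
  rw [h2] at h1
  unfold secondDiff at *
  linarith

/-- `f - f * A_R` is of size `M R^(2s)`. -/
lemma abs_sub_conv_le (hs0 : 0 < s) (hs1 : s < 1) (hf : Tame s M K B f) (hc : 0 < c)
    (hA : ∀ R, 0 < R → IsMollifier s c R (A R)) {R : ℝ} (hR : 0 < R) (x : E n) :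
    |f x - conv f (A R) x|
      ≤ (c ^ 2 * 2 ^ (2 * s) * (1 - 2 ^ (2 * s - 2))⁻¹ + 2 * c) * M * R ^ (2 * s) := by
  have h1 := hA R hR
  set c₁ := c ^ 2 * 2 ^ (2 * s) * (1 - 2 ^ (2 * s - 2))⁻¹ with hc₁
  have hM := hf.M_nonneg
  have hc1 : 0 ≤ c₁ := by
    have hq1 : (2 : ℝ) ^ (2 * s - 2) < 1 :=
      Real.rpow_lt_one_of_one_lt_of_neg (by norm_num) (by linarith)
    have : 0 < 1 - (2 : ℝ) ^ (2 * s - 2) := by linarith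
    positivity
  have key : ∀ g : E n → ℝ, Tame s M K B g →
      g x - conv g (A R) x ≤ (c₁ + 2 * c) * M * R ^ (2 * s) := by
    intro g hg
    have hgc := hg.lip.continuous
    have hl := h1.lipBound_conv hg.lip
    have hw := hg.weighted.conv hs0 hg.lip h1.cont h1.supp
    have hlc := hl.continuous
    have hRs : R ^ (2 * s - 2) * R ^ 2 = R ^ (2 * s) := by
      rw [← Real.rpow_natCast R 2, ← Real.rpow_add hR]; norm_num
    have hmp := le_of_conv_le hs0 hs1 (v := fun x => g x - conv g (A R) x) (G := A R)
      (hgc.sub hlc) (V := K * R) ?_ (fun x => ?_) (m := 2 * M) (B := 2 * (B * innerMoment n s))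
      (fun r hr x => ?_) h1.cont h1.supp h1.integral_one (ρ := R / 2) (by positivity)
      h1.zero_near (Γ := c * R ^ (2 * s)) (by positivity) h1.le_kernel
      (b := c₁ * M * R ^ (2 * s)) (fun x => ?_) x
    · refine hmp.trans (le_of_eq ?_); ring
    · have i := (Integrable.add (f := fun x => |g x| / (1 + ‖x‖) ^ ((n : ℝ) + 2 * s))
        (g := fun x => |conv g (A R) x| / (1 + ‖x‖) ^ ((n : ℝ) + 2 * s)) hg.weighted hw)
      refine i.mono' (Measurable.aestronglyMeasurable ?_) (.of_forall fun x => ?_)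
      · have := hgc.measurable
        have := hlc.measurable
        fun_prop
      · rw [Real.norm_of_nonneg (by positivity)]
        simp only [Pi.add_apply]
        rw [← add_div]
        gcongr
        exact abs_sub _ _
    · have := (abs_le.1 (h1.abs_conv_sub_le hg.K_nonneg hg.lip x)).1
      linarith
    · rw [trunc_sub hs0 hg.weighted hgc hw hlc hr]
      have e1 := (abs_le.1 (hg.abs_trunc_le r hr x)).2
      have e2 := (abs_le.1 (hg.abs_trunc_conv_le hs0 h1.cont h1.supp hr x)).1
      rw [h1.integral_abs] at e2
      linarith
    · rw [conv_sub hgc hlc h1.cont h1.supp]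
      -- by evenness of the mollifier this is an average of second differences
      have e1 : conv (conv g (A R)) (A R) x = ∫ y, conv g (A R) (x + y) * A R y := by
        unfold conv
        rw [← integral_neg_eq_self]
        simp only [sub_neg_eq_add, h1.even]
      have i1 : Integrable fun y => conv g (A R) (x - y) * A R y :=
        conv_integrable hlc h1.cont h1.supp x
      have i2 : Integrable fun y => conv g (A R) (x + y) * A R y :=
        Continuous.integrable_of_hasCompactSupport
          (by have := h1.cont; fun_prop) (h1.supp.mul_left)
      have e2 : 2 * (conv g (A R) x - conv (conv g (A R)) (A R) x)
          = ∫ y, -secondDiff y (conv g (A R)) x * A R y := by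
        have i3 : Integrable fun y => conv g (A R) (x - y) * A R y + conv g (A R) (x + y) * A R y :=
          i1.add i2
        calc _ = 2 * conv g (A R) x * (∫ y, A R y) - (conv (conv g (A R)) (A R) x
              + ∫ y, conv g (A R) (x + y) * A R y) := by
              rw [← e1, h1.integral_one]; ring
          _ = _ := by
              rw [show conv (conv g (A R)) (A R) x = ∫ y, conv g (A R) (x - y) * A R y from rfl,
                ← integral_add i1 i2, ← integral_const_mul,
                ← integral_sub (h1.integrable.const_mul _) i3]
              refine integral_congr_ae (.of_forall fun y => ?_)
              simp only [secondDiff]; ring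
      have e3 : ∫ y, -secondDiff y (conv g (A R)) x * A R y ≤ ∫ y, c₁ * M * R ^ (2 * s) * A R y := by
        refine integral_mono ?_ (h1.integrable.const_mul _) fun y => ?_
        · refine Continuous.integrable_of_hasCompactSupport ?_ h1.supp.mul_left
          have := h1.cont
          unfold secondDiff
          fun_prop
        · simp only
          rcases le_or_gt ‖y‖ R with hy | hy
          · refine mul_le_mul_of_nonneg_right ?_ (h1.nonneg y)
            have h3 := (abs_le.1 (hg.abs_secondDiff_conv_le hs0 hs1 hc hA hR hy x)).1
            rw [← hc₁] at h3
            calc _ ≤ c₁ * M * R ^ (2 * s - 2) * ‖y‖ ^ 2 := by linarith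
              _ ≤ c₁ * M * R ^ (2 * s - 2) * R ^ 2 := by gcongr
              _ = _ := by rw [mul_assoc, hRs]
          · rw [h1.zero_far y hy]; simp
      rw [integral_const_mul, h1.integral_one, mul_one] at e3
      have : 0 ≤ c₁ * M * R ^ (2 * s) := by positivity
      linarith
  refine abs_le.2 ⟨?_, key f hf⟩
  have h2 := key _ hf.neg
  rw [conv_neg] at h2
  linarith

/-- The truncated operators of all radii are bounded by a multiple of `M`. -/
lemma abs_trunc_le_mul (hn : 0 < n) (hs0 : 0 < s) (hs1 : s < 1) (hf : Tame s M K B f) (hc : 0 < c)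
    (hA : ∀ R, 0 < R → IsMollifier s c R (A R)) {R : ℝ} (hR : 0 < R) (x : E n) :
    |trunc s R f x|
      ≤ (2 * (c ^ 2 * 2 ^ (2 * s) * (1 - 2 ^ (2 * s - 2))⁻¹ + 2 * c) * outerMass n s + 1
        + c ^ 2 * 2 ^ (2 * s) * (1 - 2 ^ (2 * s - 2))⁻¹ * innerMoment n s) * M := by
  have h1 := hA R hR
  set c₁ := c ^ 2 * 2 ^ (2 * s) * (1 - 2 ^ (2 * s - 2))⁻¹ with hc₁
  have hM := hf.M_nonneg
  have hc1 : 0 ≤ c₁ := by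
    have hq1 : (2 : ℝ) ^ (2 * s - 2) < 1 :=
      Real.rpow_lt_one_of_one_lt_of_neg (by norm_num) (by linarith)
    have : 0 < 1 - (2 : ℝ) ^ (2 * s - 2) := by linarith
    positivity
  have hlip := h1.lipBound_conv hf.lip
  have hw := hf.weighted.conv hs0 hf.lip h1.cont h1.supp
  have e1 := abs_trunc_le_of_bounded (s := s) hs0 hR
    (fun x => hf.abs_sub_conv_le hs0 hs1 hc hA hR x) x
  rw [trunc_sub hs0 hf.weighted hf.lip.continuous hw hlip.continuous hR, ← hc₁] at e1
  have hRs : R ^ (2 * s) * R ^ (-(2 * s)) = 1 := by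
    rw [← Real.rpow_add hR]; norm_num
  have hRs' : R ^ (2 * s - 2) * R ^ (2 - 2 * s) = 1 := by
    rw [← Real.rpow_add hR]; norm_num
  have e1' : |trunc s R f x - trunc s R (conv f (A R)) x|
      ≤ 2 * (c₁ + 2 * c) * outerMass n s * M := by
    refine e1.trans (le_of_eq ?_)
    linear_combination (2 * (c₁ + 2 * c) * outerMass n s * M) * hRs
  have key : ∀ g : E n → ℝ, Tame s M K B g →
      trunc s R (conv g (A R)) x ≥ -(M + c₁ * innerMoment n s * M) := by
    intro g hg
    have hglip := h1.lipBound_conv hg.lip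
    have hgw := hg.weighted.conv hs0 hg.lip h1.cont h1.supp
    have h4 : ∀ r ∈ Ioo 0 R, -(M + B * innerMoment n s * r ^ (2 - 2 * s))
        ≤ trunc s R (conv g (A R)) x + c₁ * innerMoment n s * M := by
      intro r hr
      have e2 := trunc_le_add hn hs0 hs1 hgw hglip.continuous (C := c₁ * M * R ^ (2 * s - 2))
        (by positivity) (x := x) hr.1 hr.2.le fun ξ hξ => by
          have hξ' : ‖ξ‖ ≤ R := le_of_lt (by simpa using hξ)
          exact (abs_le.1 (hg.abs_secondDiff_conv_le hs0 hs1 hc hA hR hξ' x)).1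
      have e3 := (abs_le.1 (hg.abs_trunc_conv_le hs0 h1.cont h1.supp hr.1 x)).1
      rw [h1.integral_abs, mul_one] at e3
      have e4 : c₁ * M * R ^ (2 * s - 2) * (innerMoment n s * R ^ (2 - 2 * s))
          = c₁ * innerMoment n s * M := by
        linear_combination (c₁ * innerMoment n s * M) * hRs'
      linarith
    have h5 := le_of_tendsto ((tendsto_rpow_sub_zero hs1 M (B * innerMoment n s)).neg)
      (by filter_upwards [Ioo_mem_nhdsGT hR] with r hr using h4 r hr)
    linarith
  have k1 := key f hf
  have k2 := key _ hf.neg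
  have h2 : conv (fun x => -f x) (A R) = fun x => -conv f (A R) x := by
    funext x; exact conv_neg _ _ _
  rw [h2, trunc_neg] at k2
  have := abs_le.1 e1'
  refine abs_le.2 ⟨?_, ?_⟩ <;> linarith

end Tame

/-! ### Bounds on the truncated operators from the `L^∞` norm of the fractional Laplacian -/

lemma HasFracLapAt.tendsto_trunc {f : E n → ℝ} {x : E n} {L : ℝ} (h : HasFracLapAt s f x L) :
    Tendsto (fun r => trunc s r f x) (𝓝[>] 0) (𝓝 L) := by
  have := h.2
  simpa only [integral_fracKernel] using this

/-- A continuous function with a fractional Laplacian at one point is integrable against the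
weight `(1+|x|)^(-n-2s)`. -/
lemma HasFracLapAt.weightedIntegrable (hs : 0 < s) {f : E n → ℝ} (hc : Continuous f) {x : E n}
    {L : ℝ} (h : HasFracLapAt s f x L) : WeightedIntegrable s f := by
  have h1 := h.1 1 one_pos
  have hp : 0 ≤ (n : ℝ) + 2 * s := by positivity
  have hm : Measurable fun y : E n => |f y| / (1 + ‖y‖) ^ ((n : ℝ) + 2 * s) := by
    have := hc.measurable
    fun_prop
  have i1 : IntegrableOn (fun y : E n => |f y| / (1 + ‖y‖) ^ ((n : ℝ) + 2 * s)) (Metric.ball x 1) := by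
    refine IntegrableOn.mono_set ?_ Metric.ball_subset_closedBall
    refine ContinuousOn.integrableOn_compact (isCompact_closedBall x 1) (Continuous.continuousOn ?_)
    refine Continuous.div (by fun_prop) ?_ fun y => by positivity
    exact Continuous.rpow_const (by fun_prop) fun y => .inr hp
  have i2 : IntegrableOn (fun y : E n => |f y| / (1 + ‖y‖) ^ ((n : ℝ) + 2 * s)) (Metric.ball x 1)ᶜ := by
    have i3 := ((integrable_inv_weight (n := n) hs one_pos).const_mul |f x|).integrableOn
      (s := (Metric.ball x 1)ᶜ)
    refine (i3.add (h1.norm.const_mul ((1 + ‖x‖) ^ ((n : ℝ) + 2 * s)))).mono'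
      hm.aestronglyMeasurable ?_
    filter_upwards [self_mem_ae_restrict measurableSet_ball.compl] with y hy
    have hy1 : 1 ≤ ‖y - x‖ := by simpa [dist_eq_norm] using hy
    rw [Real.norm_of_nonneg (by positivity)]
    simp only [Pi.add_apply, fracKernel, norm_div, Real.norm_eq_abs]
    rw [abs_of_nonneg (show 0 ≤ ‖y - x‖ ^ ((n : ℝ) + 2 * s) by positivity)]
    have e1 : ‖y - x‖ ^ ((n : ℝ) + 2 * s)
        ≤ (1 + ‖x‖) ^ ((n : ℝ) + 2 * s) * (1 + ‖y‖) ^ ((n : ℝ) + 2 * s) := by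
      rw [← Real.mul_rpow (by positivity) (by positivity)]
      refine Real.rpow_le_rpow (norm_nonneg _) ?_ hp
      have := norm_sub_le y x
      nlinarith [norm_nonneg x, norm_nonneg y]
    have e2 : ((1 + ‖y‖) ^ ((n : ℝ) + 2 * s))⁻¹
        ≤ (1 + ‖x‖) ^ ((n : ℝ) + 2 * s) / ‖y - x‖ ^ ((n : ℝ) + 2 * s) := by
      rw [le_div_iff₀ (by positivity), inv_mul_le_iff₀ (by positivity)]
      linarith
    have e3 : |f y| ≤ |f x| + |f x - f y| := by
      have := abs_sub_abs_le_abs_sub (f y) (f x)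
      rw [abs_sub_comm] at this
      linarith
    calc |f y| / (1 + ‖y‖) ^ ((n : ℝ) + 2 * s)
        ≤ (|f x| + |f x - f y|) * ((1 + ‖y‖) ^ ((n : ℝ) + 2 * s))⁻¹ := by
          rw [div_eq_mul_inv]; gcongr
      _ ≤ |f x| * ((1 + ‖y‖) ^ ((n : ℝ) + 2 * s))⁻¹
          + |f x - f y| * ((1 + ‖x‖) ^ ((n : ℝ) + 2 * s) / ‖y - x‖ ^ ((n : ℝ) + 2 * s)) := by
          rw [add_mul]; gcongr
      _ = _ := by ring
  exact (integrableOn_univ.1 (by simpa using i1.union i2))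

/-- If `(-Δ)^s f` is bounded by `M` almost everywhere and `f` is semiconvex, then the truncated
operators of a mollification converge to a limit of absolute value at most `M`: the truncated
operators of `f` are bounded below by semiconvexity, and above by the one of radius `1`. -/
lemma exists_tendsto_trunc_conv (hn : 0 < n) (hs0 : 0 < s) (hs1 : s < 1) {f : E n → ℝ} {K C M : ℝ}
    (hf : LipBound K f) (hw : WeightedIntegrable s f) (hC : 0 ≤ C)
    (hdd : ∀ h x, -(C * ‖h‖ ^ 2) ≤ secondDiff h f x)
    (hL : ∀ᵐ x, ∃ L, HasFracLapAt s f x L ∧ |L| ≤ M) {η : E n → ℝ} (hη : Continuous η)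
    (hs : HasCompactSupport η) (x : E n) :
    ∃ ℓ, |ℓ| ≤ M * (∫ y, |η y|) ∧
      Tendsto (fun r => trunc s r (conv f η) x) (𝓝[>] 0) (𝓝 ℓ) := by
  have hk := innerMoment_nonneg (n := n) (s := s)
  have hae : ∀ᵐ y, ∃ L, HasFracLapAt s f (x - y) L ∧ |L| ≤ M :=
    (Measure.measurePreserving_sub_left (volume : Measure (E n)) x).quasiMeasurePreserving.ae hL
  have hae' : ∀ᵐ y, ∃ L, Tendsto (fun r => trunc s r f (x - y)) (𝓝[>] 0) (𝓝 L) ∧ |L| ≤ M :=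
    hae.mono fun y ⟨L, h1, h2⟩ => ⟨L, h1.tendsto_trunc, h2⟩
  set Λ : E n → ℝ := fun y => limUnder (𝓝[>] (0 : ℝ)) fun r => trunc s r f (x - y) with hΛ
  have hlim : ∀ᵐ y, Tendsto (fun r => trunc s r f (x - y)) (𝓝[>] 0) (𝓝 (Λ y)) ∧ |Λ y| ≤ M := by
    filter_upwards [hae'] with y ⟨L, h1, h2⟩
    have : Λ y = L := h1.limUnder_eq
    rw [this]
    exact ⟨h1, h2⟩
  have hc1 := (hf.trunc hs0 hw one_pos).continuous
  have iη := hη.integrable_of_hasCompactSupport (μ := volume) hs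
  have hbound : ∀ᶠ r in 𝓝[>] (0 : ℝ), ∀ᵐ y, ‖trunc s r f (x - y) * η y‖
      ≤ (M + C * innerMoment n s + |trunc s 1 f (x - y)|) * |η y| := by
    filter_upwards [Ioo_mem_nhdsGT one_pos] with r hr
    filter_upwards [hlim] with y hy
    rw [norm_mul, Real.norm_eq_abs, Real.norm_eq_abs]
    gcongr
    have h1 := trunc_le_add hn hs0 hs1 hw hf.continuous hC (x := x - y) hr.1 hr.2.le
      fun ξ _ => hdd ξ _
    rw [Real.one_rpow, mul_one] at h1
    have h2 : ∀ r' ∈ Ioo 0 r, trunc s r' f (x - y)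
        ≤ trunc s r f (x - y) + C * innerMoment n s := by
      intro r' hr'
      have h3 := trunc_le_add hn hs0 hs1 hw hf.continuous hC (x := x - y) hr'.1 hr'.2.le
        fun ξ _ => hdd ξ _
      have h4 : r ^ (2 - 2 * s) ≤ 1 := Real.rpow_le_one hr.1.le hr.2.le (by linarith)
      have h5 : C * (innerMoment n s * r ^ (2 - 2 * s)) ≤ C * innerMoment n s := by
        gcongr; exact mul_le_of_le_one_right hk h4
      linarith
    have h6 := le_of_tendsto hy.1 (by filter_upwards [Ioo_mem_nhdsGT hr.1] with r' hr' using h2 r' hr')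
    have h7 := (abs_le.1 hy.2).1
    have h8 := le_abs_self (trunc s 1 f (x - y))
    have h9 := abs_nonneg (trunc s 1 f (x - y))
    have h10 := (abs_nonneg _).trans hy.2
    refine abs_le.2 ⟨?_, ?_⟩ <;> linarith
  have hmeas : ∀ᶠ r in 𝓝[>] (0 : ℝ), AEStronglyMeasurable (fun y => trunc s r f (x - y) * η y) := by
    filter_upwards [self_mem_nhdsWithin] with r hr
    have := (hf.trunc hs0 hw hr).continuous
    exact Continuous.aestronglyMeasurable (by fun_prop)
  have hint : Integrable fun y => (M + C * innerMoment n s + |trunc s 1 f (x - y)|) * |η y| :=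
    Continuous.integrable_of_hasCompactSupport (by fun_prop) (hs.norm.mul_left)
  refine ⟨∫ y, Λ y * η y, ?_, ?_⟩
  · rw [← integral_const_mul, ← Real.norm_eq_abs]
    refine norm_integral_le_of_norm_le (iη.norm.const_mul M) ?_
    filter_upwards [hlim] with y hy
    rw [norm_mul, Real.norm_eq_abs, Real.norm_eq_abs]
    gcongr
    exact hy.2
  · have := tendsto_integral_filter_of_dominated_convergence _ hmeas hbound hint
      (f := fun y => Λ y * η y) (hlim.mono fun y hy => hy.1.mul_const _)
    refine this.congr' ?_
    filter_upwards [self_mem_nhdsWithin] with r hr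
    rw [trunc_conv hs0 hw hf hη hs hr]
    rfl

/-- Mollifications of a semiconvex function with bounded fractional Laplacian are tame. -/
lemma tame_conv (hn : 0 < n) (hs0 : 0 < s) (hs1 : s < 1) {f : E n → ℝ} {K C M : ℝ} (hK : 0 ≤ K)
    (hf : LipBound K f) (hw : WeightedIntegrable s f) (hC : 0 ≤ C) (hM : 0 ≤ M)
    (hdd : ∀ h x, -(C * ‖h‖ ^ 2) ≤ secondDiff h f x)
    (hL : ∀ᵐ x, ∃ L, HasFracLapAt s f x L ∧ |L| ≤ M) {c ε : ℝ} (hc : 0 < c) (hε : 0 < ε)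
    {A : E n → ℝ} (hA : IsMollifier s c ε A) :
    Tame s M K (2 * K * (c + 1) / ε) (conv f A) := by
  have hlip := hA.lipBound_conv hf
  have hw' := hw.conv hs0 hf hA.cont hA.supp
  have hB : 0 ≤ 2 * K * (c + 1) / ε := by positivity
  have hsd : ∀ ξ x, |secondDiff ξ (conv f A) x| ≤ 2 * K * (c + 1) / ε * ‖ξ‖ ^ 2 := by
    intro ξ x
    rcases le_or_gt ‖ξ‖ ε with hξ | hξ
    · refine (hA.abs_secondDiff_conv_le hK hf hξ x).trans ?_
      rw [show K * (2 * ε * (c * (‖ξ‖ / ε) ^ 2)) = 2 * K * c / ε * ‖ξ‖ ^ 2 by field_simp]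
      gcongr
      linarith
    · have h1 := hlip (x + ξ) x
      have h2 := hlip (x - ξ) x
      rw [add_sub_cancel_left] at h1
      rw [sub_sub_cancel_left, norm_neg] at h2
      have h3 : |secondDiff ξ (conv f A) x| ≤ 2 * K * ‖ξ‖ := by
        unfold secondDiff
        calc _ = |(conv f A (x + ξ) - conv f A x) + (conv f A (x - ξ) - conv f A x)| := by
              congr 1; ring
          _ ≤ _ := (abs_add_le _ _).trans (by linarith)
      refine h3.trans ?_
      rw [div_mul_eq_mul_div, le_div_iff₀ hε]
      have h4 : ‖ξ‖ * ε ≤ ‖ξ‖ ^ 2 := by rw [sq]; gcongr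
      have h5 : 2 * K * (‖ξ‖ * ε) ≤ 2 * K * ‖ξ‖ ^ 2 := by gcongr
      have h6 : 0 ≤ 2 * K * c * ‖ξ‖ ^ 2 := by positivity
      linarith
  refine ⟨hM, hK, hB, hlip, hw', hsd, fun r hr x => ?_⟩
  obtain ⟨ℓ, hℓ, hlim⟩ := exists_tendsto_trunc_conv hn hs0 hs1 hf hw hC hdd hL hA.cont hA.supp x
  rw [hA.integral_abs, mul_one] at hℓ
  have h1 : ∀ r' ∈ Ioo 0 r, trunc s r' (conv f A) x ≤ trunc s r (conv f A) x
      + 2 * K * (c + 1) / ε * (innerMoment n s * r ^ (2 - 2 * s)) := fun r' hr' =>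
    trunc_le_add hn hs0 hs1 hw' hlip.continuous hB hr'.1 hr'.2.le
      fun ξ _ => (abs_le.1 (hsd ξ x)).1
  have h2 : ∀ r' ∈ Ioo 0 r, -trunc s r' (conv f A) x ≤ -trunc s r (conv f A) x
      + 2 * K * (c + 1) / ε * (innerMoment n s * r ^ (2 - 2 * s)) := by
    intro r' hr'
    rw [← trunc_neg, ← trunc_neg]
    refine trunc_le_add hn hs0 hs1 hw'.neg hlip.continuous.neg hB hr'.1 hr'.2.le fun ξ _ => ?_
    have := (abs_le.1 (hsd ξ x)).2
    unfold secondDiff at *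
    linarith
  have h3 := le_of_tendsto hlim (by filter_upwards [Ioo_mem_nhdsGT hr] with r' hr' using h1 r' hr')
  have h4 := le_of_tendsto hlim.neg
    (by filter_upwards [Ioo_mem_nhdsGT hr] with r' hr' using h2 r' hr')
  have h5 := abs_le.1 hℓ
  refine abs_le.2 ⟨?_, ?_⟩ <;> linarith

/-- A bound on `(-Δ)^s f`, for `f` Lipschitz and semiconvex, bounds the truncated operators of all
radii at all points. -/
theorem exists_abs_trunc_le (hn : 0 < n) (hs0 : 0 < s) (hs1 : s < 1) :
    ∃ c, 0 ≤ c ∧ ∀ (f : E n → ℝ) (K C M : ℝ), 0 ≤ K → 0 ≤ C → 0 ≤ M → LipBound K f →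
      (∀ h x, -(C * ‖h‖ ^ 2) ≤ secondDiff h f x) →
      (∀ᵐ x, ∃ L, HasFracLapAt s f x L ∧ |L| ≤ M) →
      WeightedIntegrable s f ∧ ∀ r, 0 < r → ∀ x, |trunc s r f x| ≤ c * M := by
  obtain ⟨c, hc, A, hA⟩ := exists_mollifier (n := n) (s := s) hn hs0
  refine ⟨2 * (c ^ 2 * 2 ^ (2 * s) * (1 - 2 ^ (2 * s - 2))⁻¹ + 2 * c) * outerMass n s + 1
        + c ^ 2 * 2 ^ (2 * s) * (1 - 2 ^ (2 * s - 2))⁻¹ * innerMoment n s, ?_,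
    fun f K C M hK hC hM hf hdd hL => ?_⟩
  · have hq1 : (2 : ℝ) ^ (2 * s - 2) < 1 :=
      Real.rpow_lt_one_of_one_lt_of_neg (by norm_num) (by linarith)
    have : 0 < 1 - (2 : ℝ) ^ (2 * s - 2) := by linarith
    have := innerMoment_nonneg (n := n) (s := s)
    have := (outerMass_pos hn hs0 : 0 < outerMass n s)
    positivity
  · obtain ⟨x₀, L₀, hL₀, -⟩ := hL.exists
    have hw := hL₀.weightedIntegrable hs0 hf.continuous
    refine ⟨hw, fun r hr x => ?_⟩
    set c₃ := 2 * (c ^ 2 * 2 ^ (2 * s) * (1 - 2 ^ (2 * s - 2))⁻¹ + 2 * c) * outerMass n s + 1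
        + c ^ 2 * 2 ^ (2 * s) * (1 - 2 ^ (2 * s - 2))⁻¹ * innerMoment n s with hc₃
    have h1 : ∀ ε, 0 < ε → |trunc s r f x|
        ≤ c₃ * M + 2 * (K * ε) * (outerMass n s * r ^ (-(2 * s))) := by
      intro ε hε
      have ht := tame_conv hn hs0 hs1 hK hf hw hC hM hdd hL hc hε (hA ε hε)
      have h2 := ht.abs_trunc_le_mul hn hs0 hs1 hc hA hr x
      have h3 := abs_trunc_le_of_bounded (s := s) hs0 hr (V := K * ε)
        (f := fun x => conv f (A ε) x - f x) (fun x => (hA ε hε).abs_conv_sub_le hK hf x) x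
      rw [trunc_sub hs0 ht.weighted ht.lip.continuous hw hf.continuous hr] at h3
      have h4 := abs_sub_abs_le_abs_sub (trunc s r f x) (trunc s r (conv f (A ε)) x)
      rw [abs_sub_comm] at h4
      linarith
    have ht : Tendsto (fun ε : ℝ => c₃ * M + 2 * (K * ε) * (outerMass n s * r ^ (-(2 * s))))
        (𝓝[>] 0) (𝓝 (c₃ * M)) :=
      Tendsto.mono_left (Continuous.tendsto' (by fun_prop) _ _ (by simp)) nhdsWithin_le_nhds
    exact ge_of_tendsto ht (eventually_mem_nhdsWithin.mono fun ε hε => h1 ε hε)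

lemma Semiconvex.le_secondDiff {C : ℝ} {f : E n → ℝ} (hf : Semiconvex C f) (h x : E n) :
    -(|C| * ‖h‖ ^ 2) ≤ secondDiff h f x := by
  have h1 := hf.2 (mem_univ (x + h)) (mem_univ (x - h)) (show (0 : ℝ) ≤ 1 / 2 by norm_num)
    (show (0 : ℝ) ≤ 1 / 2 by norm_num) (by norm_num)
  have h2 : (1 / 2 : ℝ) • (x + h) + (1 / 2 : ℝ) • (x - h) = x := by
    rw [← smul_add, add_add_sub_cancel, ← two_smul ℝ x, smul_smul]; norm_num
  rw [h2] at h1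
  simp only [smul_eq_mul] at h1
  have h3 : ‖x + h‖ ^ 2 + ‖x - h‖ ^ 2 = 2 * ‖x‖ ^ 2 + 2 * ‖h‖ ^ 2 := by
    have := parallelogram_law_with_norm ℝ x h
    linarith [sq ‖x + h‖, sq ‖x - h‖, sq ‖x‖, sq ‖h‖]
  have h4 : C * ‖h‖ ^ 2 ≤ |C| * ‖h‖ ^ 2 := by gcongr; exact le_abs_self C
  have h5 : C * ‖x + h‖ ^ 2 + C * ‖x - h‖ ^ 2 = C * (2 * ‖x‖ ^ 2 + 2 * ‖h‖ ^ 2) := by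
    rw [← mul_add, h3]
  unfold secondDiff
  linarith

/-- The bound `M + 1` is used because the infimum defining `fracLapNorm` is not shown to be attained. -/
lemma ae_hasFracLapAt_of_fracLapNorm_le {f : E n → ℝ} {M : ℝ≥0} (h : fracLapNorm s f ≤ M) :
    ∀ᵐ x, ∃ L, HasFracLapAt s f x L ∧ |L| ≤ M + 1 := by
  have h1 : fracLapNorm s f < ((M + 1 : ℝ≥0) : ℝ≥0∞) :=
    h.trans_lt (by exact_mod_cast lt_add_one M)
  obtain ⟨a, ha, hlt⟩ := sInf_lt_iff.1 h1
  filter_upwards [ha] with x ⟨L, h2, h3⟩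
  refine ⟨L, h2, ?_⟩
  have h4 : ‖L‖ₑ ≤ ((M + 1 : ℝ≥0) : ℝ≥0∞) := h3.trans hlt.le
  rw [enorm_le_coe] at h4
  exact_mod_cast h4

/-! ### From semiconvexity to a modulus of continuity for the gradient -/

/-- `p` is a subgradient of `g` at `x`. -/
def IsSubgradient {n : ℕ} (g : E n → ℝ) (x p : E n) : Prop := ∀ y, g x + inner ℝ p (y - x) ≤ g y

/-- A continuous convex function has a subgradient at each point. -/
lemma exists_isSubgradient {g : E n → ℝ} (hg : ConvexOn ℝ univ g) (hc : Continuous g) (x : E n) :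
    ∃ p, IsSubgradient g x p := by
  have ho : IsOpen {q : E n × ℝ | q.1 ∈ univ ∧ g q.1 < q.2} := by
    simp only [mem_univ, true_and]
    exact isOpen_lt (hc.comp continuous_fst) continuous_snd
  obtain ⟨F, hF⟩ := geometric_hahn_banach_open_point hg.convex_strict_epigraph ho
    (x := (x, g x)) (by simp)
  have hsplit : ∀ z t, F (z, t) = F (z, 0) + t * F (0, 1) := by
    intro z t
    have : ((z, t) : E n × ℝ) = (z, 0) + t • ((0 : E n), (1 : ℝ)) := by simp
    rw [this, map_add, map_smul, smul_eq_mul]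
  have hc0 : F (0, 1) < 0 := by
    have := hF (x, g x + 1) (by simp)
    rw [hsplit, hsplit x (g x)] at this
    linarith
  set ℓ : E n →L[ℝ] ℝ := (-(F (0, 1)))⁻¹ • F.comp (ContinuousLinearMap.inl ℝ (E n) ℝ) with hℓ
  refine ⟨(InnerProductSpace.toDual ℝ (E n)).symm ℓ, fun y => ?_⟩
  rw [InnerProductSpace.toDual_symm_apply]
  have h1 : ∀ ε, 0 < ε → F (y, 0) + (g y + ε) * F (0, 1) < F (x, 0) + g x * F (0, 1) := by
    intro ε hε
    have := hF (y, g y + ε) (by simp [hε])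
    rwa [hsplit, hsplit x (g x)] at this
  have h2 : F (y, 0) + g y * F (0, 1) ≤ F (x, 0) + g x * F (0, 1) := by
    have ht : Tendsto (fun ε : ℝ => F (y, 0) + (g y + ε) * F (0, 1)) (𝓝[>] 0)
        (𝓝 (F (y, 0) + g y * F (0, 1))) :=
      Tendsto.mono_left (Continuous.tendsto' (by fun_prop) _ _ (by simp)) nhdsWithin_le_nhds
    exact le_of_tendsto ht (eventually_mem_nhdsWithin.mono fun ε hε => (h1 ε hε).le)
  have h3 : ℓ (y - x) = (-(F (0, 1)))⁻¹ * (F (y, 0) - F (x, 0)) := by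
    rw [hℓ, map_sub]
    simp only [smul_apply, ContinuousLinearMap.comp_apply,
      ContinuousLinearMap.inl_apply, smul_eq_mul]
    ring
  rw [h3]
  have h4 : (-(F (0, 1)))⁻¹ * (F (y, 0) - F (x, 0)) ≤ g y - g x := by
    rw [inv_mul_le_iff₀ (by linarith)]
    linarith
  linarith

/-- In each dyadic shell the function `κ (⟨e,ξ⟩ - d)⁺ J` has mass at least `c κ`, as long as `d` is
small compared with the radius. This is where `2s ≥ 1` is used. -/
lemma shell_lower_bound (hs : 1 / 2 ≤ s) {F : E n → ℝ} {κ d ρ : ℝ} {e : E n}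
    (he : ‖e‖ = 1) (hκ : 0 ≤ κ) (hρ : 0 < ρ) (hρ1 : ρ ≤ 1) (hd : d ≤ ρ / 8)
    (hF0 : ∀ ξ, 0 ≤ F ξ) (hF : ∀ ξ, κ * (inner ℝ e ξ - d) ≤ F ξ)
    (hi : IntegrableOn (fun ξ => F ξ * jumpKernel s ξ)
      (Metric.ball (0 : E n) ρ \ Metric.ball (0 : E n) (ρ / 2))) :
    κ * (volume.real (Metric.ball (0 : E n) 1) * (1 / 8) ^ n / 2)
      ≤ ∫ ξ in Metric.ball (0 : E n) ρ \ Metric.ball (0 : E n) (ρ / 2), F ξ * jumpKernel s ξ := by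
  -- on this ball, which lies in the shell, `⟨e,ξ⟩ - d` is at least `ρ / 2`
  set D := Metric.ball (((3 / 4) * ρ) • e) (ρ / 8) with hD
  have hnorm : ‖((3 / 4) * ρ) • e‖ = 3 / 4 * ρ := by
    rw [norm_smul, he, mul_one, Real.norm_of_nonneg (by positivity)]
  have hDn : ∀ ξ ∈ D, 5 / 8 * ρ ≤ ‖ξ‖ ∧ ‖ξ‖ < 7 / 8 * ρ := by
    intro ξ hξ
    have h1 : ‖ξ - ((3 / 4) * ρ) • e‖ < ρ / 8 := by simpa [hD, dist_eq_norm] using hξ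
    have h2 := abs_norm_sub_norm_le ξ (((3 / 4) * ρ) • e)
    rw [hnorm] at h2
    have := abs_le.1 h2
    constructor <;> linarith
  have hsub : D ⊆ Metric.ball (0 : E n) ρ \ Metric.ball (0 : E n) (ρ / 2) := by
    intro ξ hξ
    have := hDn ξ hξ
    simp only [Set.mem_sdiff, Metric.mem_ball, dist_zero_right, not_lt]
    constructor <;> linarith
  have h1 : ∫ ξ in D, F ξ * jumpKernel s ξ
      ≤ ∫ ξ in Metric.ball (0 : E n) ρ \ Metric.ball (0 : E n) (ρ / 2), F ξ * jumpKernel s ξ :=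
    setIntegral_mono_set hi (.of_forall fun ξ => mul_nonneg (hF0 ξ) (jumpKernel_nonneg ξ))
      hsub.eventuallyLE
  refine le_trans ?_ h1
  have hpt : ∀ ξ ∈ D, κ / 2 * (ρ ^ n)⁻¹ ≤ F ξ * jumpKernel s ξ := by
    intro ξ hξ
    have h2 := hDn ξ hξ
    have h3 : 5 / 8 * ρ ≤ inner ℝ e ξ := by
      have h4 : ‖ξ - ((3 / 4) * ρ) • e‖ < ρ / 8 := by simpa [hD, dist_eq_norm] using hξ
      have h5 := abs_le.1 (abs_real_inner_le_norm e (ξ - ((3 / 4) * ρ) • e))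
      rw [inner_sub_right, inner_smul_right, real_inner_self_eq_norm_sq, he] at h5
      linarith [h5.1]
    have h4 : κ * (ρ / 2) ≤ F ξ := by
      refine le_trans ?_ (hF ξ)
      gcongr; linarith
    -- `‖ξ‖ ≤ 1` and `n + 2 * s ≥ n + 1`
    have h5 : (ρ ^ (n + 1))⁻¹ ≤ jumpKernel s ξ := by
      unfold jumpKernel
      have h6 : 0 < ‖ξ‖ := by linarith
      have h7 : ‖ξ‖ ^ ((n : ℝ) + 2 * s) ≤ ρ ^ (n + 1) := by
        calc _ ≤ ‖ξ‖ ^ (((n + 1 : ℕ) : ℝ)) := by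
              refine Real.rpow_le_rpow_of_exponent_ge h6 (by linarith) ?_
              push_cast; linarith
          _ = ‖ξ‖ ^ (n + 1) := Real.rpow_natCast _ _
          _ ≤ _ := by gcongr; linarith
      gcongr
    calc κ / 2 * (ρ ^ n)⁻¹ = κ * (ρ / 2) * (ρ ^ (n + 1))⁻¹ := by
          rw [pow_succ]; field_simp
      _ ≤ _ := mul_le_mul h4 h5 (by positivity) (hF0 ξ)
  have hvol : volume.real D = (ρ / 8) ^ n * volume.real (Metric.ball (0 : E n) 1) := by
    rw [measureReal_def, hD, Measure.addHaar_ball_of_pos _ _ (by positivity), ENNReal.toReal_mul,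
      ENNReal.toReal_ofReal (by positivity), finrank_euclideanSpace, Fintype.card_fin, measureReal_def]
  have h2 : ∫ ξ in D, κ / 2 * (ρ ^ n)⁻¹ ≤ ∫ ξ in D, F ξ * jumpKernel s ξ :=
    setIntegral_mono_on (integrableOn_const measure_ball_lt_top.ne) (hi.mono_set hsub)
      measurableSet_ball hpt
  refine le_trans (le_of_eq ?_) h2
  rw [setIntegral_const, hvol, smul_eq_mul, div_pow, div_pow, one_pow]
  field_simp

/-- Summing over the dyadic shells down to the scale of `|x - y|` bounds the jump of the
subgradients of a convex function between `x` and `y`. -/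
lemma norm_subgradient_sub_le (hs : 1 / 2 ≤ s) {g : E n → ℝ} {x y p q : E n} {m : ℝ}
    (hp : IsSubgradient g x p) (hq : IsSubgradient g y q)
    (hi : ∀ r, 0 < r → IntegrableOn (fun ξ => (g (x + ξ) - g x - inner ℝ p ξ) * jumpKernel s ξ)
      (Metric.ball (0 : E n) 1 \ Metric.ball (0 : E n) r))
    (hm : ∀ r, 0 < r → r ≤ 1 → ∫ ξ in Metric.ball (0 : E n) 1 \ Metric.ball (0 : E n) r,
      (g (x + ξ) - g x - inner ℝ p ξ) * jumpKernel s ξ ≤ m) {N : ℕ}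
    (hd : ‖x - y‖ ≤ (1 / 2) ^ (N + 2)) :
    N * (volume.real (Metric.ball (0 : E n) 1) * (1 / 8) ^ n / 2) * ‖q - p‖ ≤ m := by
  rcases eq_or_ne q p with rfl | hne
  · rw [sub_self, norm_zero, mul_zero]
    refine le_trans (integral_nonneg fun ξ => mul_nonneg ?_ (jumpKernel_nonneg ξ)) (hm 1 one_pos le_rfl)
    have := hp (x + ξ)
    rw [add_sub_cancel_left] at this
    simp only
    linarith
  set κ := ‖q - p‖ with hκ
  have hκ0 : 0 < κ := norm_pos_iff.2 (sub_ne_zero.2 hne)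
  set e := κ⁻¹ • (q - p) with he
  have he1 : ‖e‖ = 1 := by
    rw [he, norm_smul, norm_inv, Real.norm_of_nonneg hκ0.le, ← hκ, inv_mul_cancel₀ hκ0.ne']
  have hκe : ∀ ξ, inner ℝ (q - p) ξ = κ * inner ℝ e ξ := by
    intro ξ
    rw [he, real_inner_smul_left, ← mul_assoc, mul_inv_cancel₀ hκ0.ne', one_mul]
  set F : E n → ℝ := fun ξ => g (x + ξ) - g x - inner ℝ p ξ with hF
  have hF0 : ∀ ξ, 0 ≤ F ξ := by
    intro ξ
    have := hp (x + ξ)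
    rw [add_sub_cancel_left] at this
    simp only [hF]
    linarith
  -- the affine support of `g` at `y`, seen from `x`
  have hFκ : ∀ ξ, κ * (inner ℝ e ξ - ‖x - y‖) ≤ F ξ := by
    intro ξ
    have h1 := hp y
    have h2 := hq (x + ξ)
    rw [add_sub_right_comm, inner_add_right] at h2
    have h3 : inner ℝ q ξ - inner ℝ p ξ = κ * inner ℝ e ξ := by rw [← hκe, inner_sub_left]
    have h4 := (abs_le.1 (abs_real_inner_le_norm (q - p) (x - y))).1
    rw [inner_sub_left] at h4
    have h5 : inner ℝ p (y - x) = -inner ℝ p (x - y) := by rw [← inner_neg_right, neg_sub]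
    simp only [hF]
    rw [mul_sub]
    linarith
  set c := volume.real (Metric.ball (0 : E n) 1) * (1 / 8) ^ n / 2 with hc
  have key : ∀ j ≤ N, j * (κ * c) ≤ ∫ ξ in Metric.ball (0 : E n) 1 \ Metric.ball (0 : E n)
      ((1 / 2) ^ j), F ξ * jumpKernel s ξ := by
    intro j
    induction j with
    | zero =>
      intro _
      simp
    | succ j ih =>
      intro hj
      have h1 := ih (by omega)
      have hr1 : ((1 : ℝ) / 2) ^ (j + 1) = (1 / 2) ^ j / 2 := by rw [pow_succ]; ring
      have hr2 : ((1 : ℝ) / 2) ^ j ≤ 1 := pow_le_one₀ (by norm_num) (by norm_num)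
      have hr3 : (0 : ℝ) < (1 / 2) ^ j := by positivity
      have hU : Metric.ball (0 : E n) 1 \ Metric.ball (0 : E n) ((1 / 2) ^ (j + 1))
          = (Metric.ball (0 : E n) 1 \ Metric.ball (0 : E n) ((1 / 2) ^ j)) ∪
            (Metric.ball (0 : E n) ((1 / 2) ^ j) \ Metric.ball (0 : E n) ((1 / 2) ^ (j + 1))) := by
        ext ξ
        simp only [Set.mem_sdiff, Metric.mem_ball, dist_zero_right, mem_union]
        constructor
        · rintro ⟨h1, h2⟩
          by_cases h3 : ‖ξ‖ < (1 / 2) ^ j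
          · exact .inr ⟨h3, h2⟩
          · exact .inl ⟨h1, h3⟩
        · rintro (⟨h1, h2⟩ | ⟨h1, h2⟩)
          · exact ⟨h1, fun h => h2 (by rw [hr1] at h; linarith)⟩
          · exact ⟨h1.trans_le hr2, h2⟩
      have hmd : MeasurableSet (Metric.ball (0 : E n) ((1 / 2) ^ j)
          \ Metric.ball (0 : E n) ((1 / 2) ^ (j + 1))) := measurableSet_ball.diff measurableSet_ball
      have hisub : IntegrableOn (fun ξ => F ξ * jumpKernel s ξ) (Metric.ball (0 : E n) ((1 / 2) ^ j)
          \ Metric.ball (0 : E n) ((1 / 2) ^ (j + 1))) :=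
        (hi _ (by positivity)).mono_set (sdiff_subset_sdiff_left (Metric.ball_subset_ball hr2))
      rw [hU, setIntegral_union (disjoint_left.2 fun ξ h1 h2 => h1.2 h2.1) hmd
        (hi _ (by positivity)) hisub]
      have h2 : ‖x - y‖ ≤ (1 / 2) ^ j / 8 := by
        refine hd.trans ?_
        calc ((1 : ℝ) / 2) ^ (N + 2) ≤ (1 / 2) ^ (j + 1 + 2) :=
              pow_le_pow_of_le_one (by norm_num) (by norm_num) (by omega)
          _ = _ := by rw [pow_add, pow_succ]; ring
      rw [hr1] at hisub ⊢
      have h3 := shell_lower_bound hs he1 hκ0.le hr3 hr2 h2 hF0 hFκ hisub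
      refine le_trans (le_of_eq ?_) (add_le_add h1 h3)
      push_cast
      ring
  have h1 := (key N le_rfl).trans (hm _ (by positivity) (pow_le_one₀ (by norm_num) (by norm_num)))
  linarith

/-- A continuous choice of subgradients is the gradient. -/
lemma hasGradientAt_of_isSubgradient {g : E n → ℝ} {P : E n → E n}
    (hP : ∀ x, IsSubgradient g x (P x)) (hc : Continuous P) (x : E n) : HasGradientAt g (P x) x := by
  rw [hasGradientAt_iff_isLittleO, Asymptotics.isLittleO_iff]
  intro ε hε
  have h1 := Metric.tendsto_nhds.1 (hc.tendsto x) ε hε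
  filter_upwards [h1] with y hy
  have h2 := hP x y
  have h3 := hP y x
  have h4 := (abs_le.1 (abs_real_inner_le_norm (P y - P x) (y - x))).2
  rw [inner_sub_left] at h4
  have h5 : inner ℝ (P y) (x - y) = -inner ℝ (P y) (y - x) := by rw [← inner_neg_right, neg_sub]
  rw [dist_eq_norm] at hy
  have h6 : ‖P y - P x‖ * ‖y - x‖ ≤ ε * ‖y - x‖ := by gcongr
  rw [Real.norm_eq_abs, abs_of_nonneg (by linarith)]
  linarith

/-- Increments at a small scale control increments at all scales. -/
lemma norm_sub_le_of_small_scale {P : E n → E n} {δ κ : ℝ} (hδ : 0 < δ) (hκ : 0 ≤ κ)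
    (h : ∀ x y, ‖x - y‖ ≤ δ → ‖P x - P y‖ ≤ κ) (x y : E n) :
    ‖P x - P y‖ ≤ κ * (‖x - y‖ / δ + 1) := by
  have key : ∀ m : ℕ, ∀ x y, ‖x - y‖ ≤ m * δ → ‖P x - P y‖ ≤ m * κ := by
    intro m
    induction m with
    | zero =>
      intro x y hxy
      have : x - y = 0 := norm_le_zero_iff.1 (by simpa using hxy)
      rw [sub_eq_zero.1 this]; simp
    | succ m ih =>
      intro x y hxy
      push_cast at hxy ⊢
      set z := x - ((m : ℝ) + 1)⁻¹ • (x - y) with hz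
      have e1 : x - z = ((m : ℝ) + 1)⁻¹ • (x - y) := by rw [hz]; abel
      have e2 : z - y = ((m : ℝ) * ((m : ℝ) + 1)⁻¹) • (x - y) := by
        have h1 : (m : ℝ) * ((m : ℝ) + 1)⁻¹ = 1 - ((m : ℝ) + 1)⁻¹ := by field_simp; ring
        rw [h1, sub_smul, one_smul, hz]; abel
      have h1 : ‖x - z‖ ≤ δ := by
        rw [e1, norm_smul, norm_inv, Real.norm_of_nonneg (by positivity),
          inv_mul_le_iff₀ (by positivity)]
        exact hxy
      have h2 : ‖z - y‖ ≤ m * δ := by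
        rw [e2, norm_smul, Real.norm_of_nonneg (by positivity), mul_assoc]
        gcongr
        rw [inv_mul_le_iff₀ (by positivity)]
        exact hxy
      have h3 := h x z h1
      have h4 := ih z y h2
      have h5 := norm_sub_le_norm_sub_add_norm_sub (P x) (P z) (P y)
      linarith
  have h1 := key ⌈‖x - y‖ / δ⌉₊ x y (by rw [← div_le_iff₀ hδ]; exact Nat.le_ceil _)
  refine h1.trans ?_
  rw [mul_comm]
  gcongr
  exact (Nat.ceil_lt_add_one (by positivity)).le

/-- The modulus of continuity obtained from `|∇f(x) - ∇f(y)| ≤ a / (N+1)` at scale `2^(-N-3)`. -/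
noncomputable def modulus (a C : ℝ) (d : ℝ≥0) : ℝ≥0 :=
  ⨅ N : ℕ, Real.toNNReal (a / (N + 1) * (d / (1 / 2) ^ (N + 3) + 1) + C * d)

lemma modulus_mono {a C : ℝ} (ha : 0 ≤ a) (hC : 0 ≤ C) : Monotone (modulus a C) := by
  intro d d' h
  refine ciInf_mono (OrderBot.bddBelow _) fun N => Real.toNNReal_mono ?_
  have : (d : ℝ) ≤ d' := h
  gcongr

lemma tendsto_modulus {a : ℝ} (ha : 0 ≤ a) (C : ℝ) : Tendsto (modulus a C) (𝓝 0) (𝓝 0) := by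
  rw [tendsto_order]
  refine ⟨fun b hb => absurd hb not_lt_zero, fun ε hε => ?_⟩
  have h1 : Tendsto (fun N : ℕ => a / ((N : ℝ) + 1)) atTop (𝓝 0) := by
    simpa [div_eq_mul_inv] using (tendsto_one_div_add_atTop_nhds_zero_nat (𝕜 := ℝ)).const_mul a
  obtain ⟨N, hN⟩ := (h1.eventually (gt_mem_nhds (show (0 : ℝ) < ε from hε))).exists
  have h2 : Tendsto (fun d : ℝ≥0 => Real.toNNReal (a / ((N : ℝ) + 1) * (d / (1 / 2) ^ (N + 3) + 1)
      + C * d)) (𝓝 0) (𝓝 (Real.toNNReal (a / ((N : ℝ) + 1)))) :=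
    Continuous.tendsto' (by fun_prop) _ _ (by simp)
  have h3 : Real.toNNReal (a / ((N : ℝ) + 1)) < ε := by
    rw [Real.toNNReal_lt_iff_lt_coe (by positivity)]
    exact hN
  filter_upwards [h2.eventually (gt_mem_nhds h3)] with d hd
  exact (ciInf_le (OrderBot.bddBelow _) N).trans_lt hd

/-- Semiconvex functions with a one-sided bound on the inner part of the fractional Laplacian are `C¹`,
and their gradients have a common modulus of continuity. Take the subgradients of the convex function
`f + C|x|²/2`: their increments are small at small scales by `norm_subgradient_sub_le`. -/
theorem exists_modulus (hn : 0 < n) (hs : 1 / 2 ≤ s) (hs1 : s < 1) {C m : ℝ} (hC : 0 ≤ C) :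
    ∃ ω : ℝ≥0 → ℝ≥0, Monotone ω ∧ Tendsto ω (𝓝 0) (𝓝 0) ∧ ∀ f : E n → ℝ, Continuous f →
      WeightedIntegrable s f → Semiconvex C f →
      (∀ r, 0 < r → r ≤ 1 → ∀ x, trunc s 1 f x - trunc s r f x ≤ m) →
      ContDiff ℝ 1 f ∧ ∀ x y, ‖gradient f x - gradient f y‖₊ ≤ ω ‖x - y‖₊ := by
  have hs0 : 0 < s := by linarith
  set c := volume.real (Metric.ball (0 : E n) 1) * (1 / 8) ^ n / 2 with hc
  have hc0 : 0 < c := by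
    have : 0 < volume.real (Metric.ball (0 : E n) 1) :=
      ENNReal.toReal_pos (Metric.measure_ball_pos _ _ one_pos).ne' measure_ball_lt_top.ne
    positivity
  set a := (|m| + C / 2 * innerMoment n s) / c with ha
  have hk := innerMoment_nonneg (n := n) (s := s)
  have ha0 : 0 ≤ a := by positivity
  refine ⟨modulus a C, modulus_mono ha0 hC, tendsto_modulus ha0 C, fun f hfc hw hconv hm => ?_⟩
  set g : E n → ℝ := fun x => f x + C * ‖x‖ ^ 2 / 2 with hg
  have hgc : Continuous g := by fun_prop
  choose P hP using exists_isSubgradient (g := g) hconv hgc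
  have hexp : ∀ x ξ, (g (x + ξ) - g x - inner ℝ (P x) ξ) * jumpKernel s ξ
      = -((f x - f (x + ξ)) * jumpKernel s ξ) + (inner ℝ (C • x - P x) ξ * jumpKernel s ξ
        + C / 2 * (‖ξ‖ ^ 2 * jumpKernel s ξ)) := by
    intro x ξ
    simp only [hg]
    rw [norm_add_sq_real, inner_sub_left, real_inner_smul_left]
    ring
  have i1 : ∀ x r, 0 < r → IntegrableOn (fun ξ => -((f x - f (x + ξ)) * jumpKernel s ξ))
      (Metric.ball (0 : E n) 1 \ Metric.ball (0 : E n) r) := fun x r hr =>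
    ((hw.integrableOn_sub hs0 hfc x hr).mono_set fun ξ h => h.2).neg
  have i2 : ∀ x r, 0 < r → IntegrableOn (fun ξ => inner ℝ (C • x - P x) ξ * jumpKernel s ξ)
      (Metric.ball (0 : E n) 1 \ Metric.ball (0 : E n) r) := fun x r hr =>
    integrableOn_inner_annulus hs0 _ hr
  have i3 : ∀ r, IntegrableOn (fun ξ => C / 2 * (‖ξ‖ ^ 2 * jumpKernel s ξ))
      (Metric.ball (0 : E n) 1 \ Metric.ball (0 : E n) r) := fun r =>
    ((integrableOn_sq_jumpKernel hn hs1 1).mono_set sdiff_subset).const_mul _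
  have hi : ∀ x r, 0 < r → IntegrableOn
      (fun ξ => (g (x + ξ) - g x - inner ℝ (P x) ξ) * jumpKernel s ξ)
      (Metric.ball (0 : E n) 1 \ Metric.ball (0 : E n) r) := by
    intro x r hr
    simp only [hexp]
    exact (i1 x r hr).add ((i2 x r hr).add (i3 r))
  -- the linear terms integrate to zero over the annulus, and the quadratic one costs a second moment
  have hint : ∀ x r, 0 < r → r ≤ 1 → ∫ ξ in Metric.ball (0 : E n) 1 \ Metric.ball (0 : E n) r,
      (g (x + ξ) - g x - inner ℝ (P x) ξ) * jumpKernel s ξ ≤ |m| + C / 2 * innerMoment n s := by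
    intro x r hr hr1
    have i23 : IntegrableOn (fun ξ => inner ℝ (C • x - P x) ξ * jumpKernel s ξ
        + C / 2 * (‖ξ‖ ^ 2 * jumpKernel s ξ))
        (Metric.ball (0 : E n) 1 \ Metric.ball (0 : E n) r) := (i2 x r hr).add (i3 r)
    have hmd : MeasurableSet (Metric.ball (0 : E n) 1 \ Metric.ball (0 : E n) r) :=
      measurableSet_ball.diff measurableSet_ball
    simp only [hexp]
    rw [integral_add (i1 x r hr) i23, integral_add (i2 x r hr) (i3 r), integral_const_mul,
      integral_inner_jumpKernel (fun ξ => by simp) hmd, integral_neg,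
      integral_sq_jumpKernel_annulus hn hs1 hr hr1, Real.one_rpow]
    have h1 : trunc s r f x = trunc s 1 f x + ∫ ξ in Metric.ball (0 : E n) 1 \ Metric.ball (0 : E n) r,
        (f x - f (x + ξ)) * jumpKernel s ξ := by
      unfold trunc
      rw [compl_ball_eq_union hr1, setIntegral_union
        (disjoint_left.2 fun _ h1 h2 => (mem_compl_iff _ _).1 h1 h2.1) hmd
        (hw.integrableOn_sub hs0 hfc x one_pos)
        ((hw.integrableOn_sub hs0 hfc x hr).mono_set fun ξ h => h.2)]
    have h2 := hm r hr hr1 x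
    have h3 := le_abs_self m
    have h4 : 0 ≤ C / 2 * (innerMoment n s * r ^ (2 - 2 * s)) := by positivity
    linarith
  have hsmall : ∀ (N : ℕ) x y, ‖x - y‖ ≤ (1 / 2) ^ (N + 3) → ‖P x - P y‖ ≤ a / (N + 1) := by
    intro N x y hxy
    have h1 := norm_subgradient_sub_le hs (hP x) (hP y) (hi x) (hint x) (N := N + 1) hxy
    rw [← hc, norm_sub_rev] at h1
    push_cast at h1
    rw [ha, div_div, le_div_iff₀ (by positivity)]
    linarith
  have hPc : Continuous P := by
    refine continuous_iff_continuousAt.2 fun x => Metric.tendsto_nhds.2 fun ε hε => ?_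
    have h1 : Tendsto (fun N : ℕ => a / ((N : ℝ) + 1)) atTop (𝓝 0) := by
      simpa [div_eq_mul_inv] using (tendsto_one_div_add_atTop_nhds_zero_nat (𝕜 := ℝ)).const_mul a
    obtain ⟨N, hN⟩ := (h1.eventually (gt_mem_nhds hε)).exists
    filter_upwards [Metric.closedBall_mem_nhds x (show (0 : ℝ) < (1 / 2) ^ (N + 3) by positivity)]
      with y hy
    rw [dist_eq_norm]
    exact (hsmall N y x (by simpa [dist_eq_norm] using hy)).trans_lt hN
  have hgrad : ∀ x, HasGradientAt f (P x - C • x) x := by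
    intro x
    have h1 := (hasGradientAt_of_isSubgradient hP hPc x).hasFDerivAt
    have h2 : HasFDerivAt (fun x : E n => C * ‖x‖ ^ 2 / 2)
        (InnerProductSpace.toDual ℝ (E n) (C • x)) x := by
      have h3 := (hasStrictFDerivAt_norm_sq x).hasFDerivAt.const_mul (C / 2)
      have h4 : (fun x : E n => C * ‖x‖ ^ 2 / 2) = fun x => C / 2 * ‖x‖ ^ 2 := by funext x; ring
      rw [h4]
      refine h3.congr_fderiv ?_
      ext v
      simp [InnerProductSpace.toDual_apply_apply]
      ring
    have h3 := h1.sub h2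
    rw [← map_sub] at h3
    have h4 : (g - fun x : E n => C * ‖x‖ ^ 2 / 2) = f := by
      funext x; simp [hg]
    rw [h4] at h3
    exact h3
  have hgr : ∀ x, gradient f x = P x - C • x := fun x => (hgrad x).gradient
  refine ⟨?_, fun x y => ?_⟩
  · rw [contDiff_one_iff_fderiv]
    refine ⟨fun x => (hgrad x).hasFDerivAt.differentiableAt, ?_⟩
    have : fderiv ℝ f = fun x => InnerProductSpace.toDual ℝ (E n) (P x - C • x) := by
      funext x; exact (hgrad x).hasFDerivAt.fderiv
    rw [this]
    fun_prop
  · rw [hgr, hgr]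
    refine le_ciInf fun N => ?_
    rw [← NNReal.coe_le_coe, coe_nnnorm]
    refine le_trans ?_ (Real.le_coe_toNNReal _)
    have h1 := norm_sub_le_of_small_scale (P := P) (δ := (1 / 2) ^ (N + 3)) (κ := a / (N + 1))
      (by positivity) (by positivity) (hsmall N) x y
    rw [coe_nnnorm]
    calc ‖P x - C • x - (P y - C • y)‖ = ‖(P x - P y) - C • (x - y)‖ := by
          congr 1; rw [smul_sub]; abel
      _ ≤ ‖P x - P y‖ + ‖C • (x - y)‖ := norm_sub_le _ _
      _ = ‖P x - P y‖ + C * ‖x - y‖ := by rw [norm_smul, Real.norm_of_nonneg hC]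
      _ ≤ _ := by linarith

/-! ### Consequences of the comparison principle for solutions -/

lemma trunc_shift_add (r : ℝ) (f : E n → ℝ) (h : E n) (b : ℝ) (x : E n) :
    trunc s r (fun x => f (x + h) + b) x = trunc s r f (x + h) := by
  unfold trunc
  refine integral_congr_ae (.of_forall fun ξ => ?_)
  simp only
  rw [add_right_comm x ξ h]
  ring

/-- Space translates and vertical shifts of a supersolution are supersolutions for the obstacle that
is moved along. -/
lemma PointwiseSuper.shift {T : ℝ} {ψ : E n → ℝ} {v : ℝ → E n → ℝ} (hv : PointwiseSuper s T ψ v)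
    (h : E n) (b : ℝ) :
    PointwiseSuper s T (fun x => ψ (x + h) + b) (fun t x => v t (x + h) + b) := by
  intro t₀ ht₀ x₀ a B p A ht
  have hmap : Tendsto (fun q : ℝ × E n => (q.1, q.2 - h)) (𝓝 (t₀, x₀ + h)) (𝓝 (t₀, x₀)) :=
    Continuous.tendsto' (by fun_prop) _ _ (by simp)
  have h1 := hv t₀ ht₀ (x₀ + h) a B p A (by
    filter_upwards [hmap.eventually ht] with q hq
    simp only [quadTest, sub_add_cancel] at hq ⊢
    rw [show q.2 - (x₀ + h) = q.2 - h - x₀ by abel]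
    linarith)
  refine ⟨by linarith [h1.1], fun η hη => ?_⟩
  simpa only [trunc_shift_add] using h1.2 η hη

lemma PointwiseSub.timeShift {T : ℝ} {ψ : E n → ℝ} {v : ℝ → E n → ℝ} (hv : PointwiseSub s T ψ v)
    {τ : ℝ} (hτ : 0 ≤ τ) : PointwiseSub s (T - τ) ψ (fun t => v (t + τ)) := by
  intro t₀ ht₀ x₀ a B p A ht hψ
  have hmap : Tendsto (fun q : ℝ × E n => (q.1 - τ, q.2)) (𝓝 (t₀ + τ, x₀)) (𝓝 (t₀, x₀)) :=
    Continuous.tendsto' (by fun_prop) _ _ (by simp)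
  refine hv (t₀ + τ) ⟨by linarith [ht₀.1], by linarith [ht₀.2]⟩ x₀ a B p A ?_ hψ
  filter_upwards [hmap.eventually ht] with q hq
  simp only [quadTest, sub_add_cancel] at hq ⊢
  rw [show q.1 - (t₀ + τ) = q.1 - τ - t₀ by ring]
  linarith

lemma nonneg_Icc_of_Ioo {T : ℝ} (hT : 0 < T) {F : ℝ → ℝ} (hF : ContinuousOn F (Icc 0 T))
    (h : ∀ t ∈ Ioo 0 T, 0 ≤ F t) : ∀ t ∈ Icc 0 T, 0 ≤ F t := by
  intro t ht
  have hcl : t ∈ closure (Ioo 0 T) := by rwa [closure_Ioo hT.ne]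
  have := mem_closure_iff_nhdsWithin_neBot.1 hcl
  exact ge_of_tendsto ((hF t ht).mono_left (nhdsWithin_mono _ Ioo_subset_Icc_self))
    (eventually_mem_nhdsWithin.mono h)

namespace IsObstacleSolution

variable {T : ℝ} {u₀ ψ : E n → ℝ} {u : ℝ → E n → ℝ}

lemma pointwiseSuper (hn : 0 < n) (hs0 : 0 < s) (hs1 : s < 1) (h : IsObstacleSolution s T u₀ ψ u) :
    PointwiseSuper s T ψ u :=
  h.supersolution.pointwiseSuper hn hs0 hs1 h.weighted fun _ ht => h.continuous ht

lemma pointwiseSub (hn : 0 < n) (hs0 : 0 < s) (hs1 : s < 1) (h : IsObstacleSolution s T u₀ ψ u) :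
    PointwiseSub s T ψ u :=
  h.subsolution.pointwiseSub hn hs0 hs1 h.weighted fun _ ht => h.continuous ht

lemma continuousOn_time (h : IsObstacleSolution s T u₀ ψ u) (x : E n) :
    ContinuousOn (fun t => u t x) (Icc 0 T) :=
  h.continuousOn.comp (f := fun t : ℝ => (t, x)) (by fun_prop) fun _ ht => ⟨ht, mem_univ _⟩

/-- Inequalities between a function and averages of its translates pass from the data to the
solution. -/
theorem le_sum_shift (hn : 0 < n) (hs0 : 0 < s) (hs1 : s < 1) (hT : 0 < T)
    (h : IsObstacleSolution s T u₀ ψ u) (hψc : Continuous ψ) {ι : Type*} [Fintype ι] {lam : ι → ℝ}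
    {k : ι → E n} {b : ℝ} (hlam : ∀ i, 0 < lam i) (hsum : ∑ i, lam i = 1)
    (hψ : ∀ x, ψ x ≤ ∑ i, lam i * ψ (x + k i) + b)
    (hu₀ : ∀ x, u₀ x ≤ ∑ i, lam i * u₀ (x + k i) + b) {t : ℝ} (ht : t ∈ Icc 0 T) (x : E n) :
    u t x ≤ ∑ i, lam i * u t (x + k i) + b := by
  have hb : ∀ g : ι → ℝ, ∑ i, lam i * (g i + b) = ∑ i, lam i * g i + b := by
    intro g
    simp only [mul_add, Finset.sum_add_distrib, ← Finset.sum_mul, hsum, one_mul]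
  have hcv : ∀ i, ContinuousOn (fun p : ℝ × E n => u p.1 (p.2 + k i) + b) (Icc 0 T ×ˢ univ) :=
    fun i => (h.continuousOn.comp (f := fun p : ℝ × E n => (p.1, p.2 + k i)) (by fun_prop)
      fun _ hp => ⟨hp.1, mem_univ _⟩).add continuousOn_const
  have key : ∀ t ∈ Ico 0 T, u t x ≤ ∑ i, lam i * (u t (x + k i) + b) := fun t ht =>
    comparison hn hs0 hs1 (v := fun i t x => u t (x + k i) + b) (ψ := fun i x => ψ (x + k i) + b)
      hlam hsum h.continuousOn hcv (h.tailsVanish hs0)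
      (fun i => (h.tailsVanish hs0).shift hs0 (fun t ht => h.continuous ht)
        (fun t ht => by have := h.continuous ht; fun_prop) id (fun _ ht => ht) (k i) |b|
        fun t _ x => abs_add_le _ _)
      (h.pointwiseSub hn hs0 hs1) (fun i => (h.pointwiseSuper hn hs0 hs1).shift (k i) b)
      (fun i => by fun_prop) (fun x => by rw [hb]; exact hψ x)
      (fun x => by simp only [hb, h.initial]; exact hu₀ x) ht x
  have := nonneg_Icc_of_Ioo hT (F := fun t => ∑ i, lam i * u t (x + k i) + b - u t x)
    (((continuousOn_finsetSum _ fun i _ => continuousOn_const.mul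
      (h.continuousOn_time (x + k i))).add continuousOn_const).sub (h.continuousOn_time x))
    (fun t ht => by
      have := key t ⟨ht.1.le, ht.2⟩
      rw [hb] at this
      linarith) t ht
  linarith

/-- The solution grows at most linearly in time. -/
lemma le_initial_add (hn : 0 < n) (hs0 : 0 < s) (hs1 : s < 1) (hT : 0 < T)
    (h : IsObstacleSolution s T u₀ ψ u) (hψc : Continuous ψ) (hψu₀ : ∀ x, ψ x ≤ u₀ x) {D : ℝ}
    (hD : 0 ≤ D) (htr : ∀ r, 0 < r → ∀ x, -D ≤ trunc s r u₀ x) {t : ℝ} (ht : t ∈ Icc 0 T)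
    (x : E n) : u t x ≤ u₀ x + D * t := by
  have hu₀c : Continuous u₀ := by
    have := h.continuous (t := 0) ⟨le_rfl, hT.le⟩
    rwa [show u 0 = u₀ from funext h.initial] at this
  have hsup : PointwiseSuper s T ψ (fun t x => u₀ x + D * t) := by
    intro t₀ ht₀ x₀ a B p A htouch
    refine ⟨by have := hψu₀ x₀; have := mul_nonneg hD ht₀.1.le; linarith, fun η hη => ?_⟩
    have haD : a = D := by
      -- at `x = x₀` the parabola `(a-D)(t-t₀) - B(t-t₀)²` has a local maximum at `t₀`
      have hmap : Tendsto (fun t : ℝ => (t, x₀)) (𝓝 t₀) (𝓝 (t₀, x₀)) :=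
        Continuous.tendsto' (by fun_prop) _ _ rfl
      have hmax : IsLocalMax (fun t => (a - D) * (t - t₀) - B * (t - t₀) ^ 2) t₀ := by
        filter_upwards [hmap.eventually htouch] with t ht
        simp only [quadTest, sub_self, inner_zero_right, norm_zero] at ht ⊢
        linarith
      have h1 : HasDerivAt (fun t : ℝ => t - t₀) 1 t₀ := (hasDerivAt_id t₀).sub_const t₀
      have h2 := (h1.const_mul (a - D)).sub ((h1.pow 2).const_mul B)
      have h3 := hmax.hasDerivAt_eq_zero h2
      simp at h3
      linarith
    rw [haD]
    filter_upwards [self_mem_nhdsWithin] with r hr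
    have h1 : trunc s r (fun x => u₀ x + D * t₀) x₀ = trunc s r u₀ x₀ := by
      have := trunc_shift_add (s := s) r u₀ 0 (D * t₀) x₀
      simpa using this
    rw [h1]
    have := htr r hr x₀
    linarith
  have key : ∀ t ∈ Ico 0 T, u t x ≤ u₀ x + D * t := by
    intro t ht
    have := comparison hn hs0 hs1 (ι := Unit) (lam := fun _ => 1) (v := fun _ t x => u₀ x + D * t)
      (ψ := fun _ => ψ) (fun _ => one_pos) (by simp) h.continuousOn
      (fun _ => Continuous.continuousOn (by fun_prop)) (h.tailsVanish hs0)
      (fun _ => (h.tailsVanish hs0).shift hs0 (fun t ht => h.continuous ht)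
        (fun t ht => by fun_prop) (fun _ => 0) (fun _ _ => ⟨le_rfl, hT.le⟩) 0 (D * T)
        fun t ht x => by
          rw [add_zero, h.initial]
          refine (abs_add_le _ _).trans ?_
          rw [abs_of_nonneg (mul_nonneg hD ht.1)]
          have := mul_le_mul_of_nonneg_left ht.2 hD
          linarith)
      (h.pointwiseSub hn hs0 hs1) (fun _ => hsup) (fun _ => hψc) (fun x => by simp)
      (fun x => by simp [h.initial]) ht x
    simpa using this
  have := nonneg_Icc_of_Ioo hT (F := fun t => u₀ x + D * t - u t x)
    ((Continuous.continuousOn (by fun_prop)).sub (h.continuousOn_time x))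
    (fun t ht => by have := key t ⟨ht.1.le, ht.2⟩; linarith) t ht
  linarith

/-- The function `u - D t` is nonincreasing in time. -/
lemma le_add_time (hn : 0 < n) (hs0 : 0 < s) (hs1 : s < 1) (hT : 0 < T)
    (h : IsObstacleSolution s T u₀ ψ u) (hψc : Continuous ψ) (hψu₀ : ∀ x, ψ x ≤ u₀ x) {D : ℝ}
    (hD : 0 ≤ D) (htr : ∀ r, 0 < r → ∀ x, -D ≤ trunc s r u₀ x) {t t' : ℝ} (ht : t ∈ Icc 0 T)
    (ht' : t' ∈ Icc 0 T) (htt' : t ≤ t') (x : E n) : u t' x ≤ u t x + D * (t' - t) := by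
  have key : ∀ τ, 0 ≤ τ → ∀ t ∈ Ico 0 (T - τ), u (t + τ) x ≤ u t x + D * τ := by
    intro τ hτ t ht
    have hτT : τ ∈ Icc 0 T := ⟨hτ, by linarith [ht.1, ht.2]⟩
    have hm : ∀ t ∈ Icc 0 (T - τ), t + τ ∈ Icc 0 T := fun t ht =>
      ⟨by linarith [ht.1], by linarith [ht.2]⟩
    have hm' : ∀ t ∈ Icc 0 (T - τ), t ∈ Icc 0 T := fun t ht => ⟨ht.1, by linarith [ht.2]⟩
    have hsup : PointwiseSuper s (T - τ) (fun x => ψ x + D * τ) (fun t x => u t x + D * τ) := by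
      have := (h.pointwiseSuper hn hs0 hs1).shift 0 (D * τ)
      simp only [add_zero] at this
      exact fun t₀ ht₀ => this t₀ ⟨ht₀.1, by linarith [ht₀.2]⟩
    have := comparison hn hs0 hs1 (ι := Unit) (lam := fun _ => 1) (T := T - τ)
      (u := fun t => u (t + τ)) (ψu := ψ)
      (v := fun _ t x => u t x + D * τ) (ψ := fun _ x => ψ x + D * τ) (fun _ => one_pos) (by simp)
      (h.continuousOn.comp (f := fun p : ℝ × E n => (p.1 + τ, p.2)) (by fun_prop)
        fun p hp => ⟨hm _ hp.1, mem_univ _⟩)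
      (fun _ => (h.continuousOn.mono (prod_mono (fun t ht => hm' t ht) subset_rfl)).add
        continuousOn_const)
      ((h.tailsVanish hs0).shift hs0 (fun t ht => h.continuous ht)
        (fun t ht => h.continuous (hm t ht)) (fun t => t + τ) hm 0 0 fun t _ x => by simp)
      (fun _ => (h.tailsVanish hs0).shift hs0 (fun t ht => h.continuous ht)
        (fun t ht => by have := h.continuous (hm' t ht); fun_prop) id hm' 0 |D * τ| fun t _ x => by
          rw [add_zero]; exact abs_add_le _ _)
      ((h.pointwiseSub hn hs0 hs1).timeShift hτ) (fun _ => hsup) (fun _ => by fun_prop)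
      (fun x => by have := mul_nonneg hD hτ; simp; linarith)
      (fun x => by
        simp only [zero_add, Finset.univ_unique, Finset.sum_const, Finset.card_singleton, one_smul,
          one_mul, h.initial]
        exact h.le_initial_add hn hs0 hs1 hT hψc hψu₀ hD htr hτT x) ht x
    simpa using this
  rcases htt'.eq_or_lt with rfl | hlt
  · simp
  have hmem : ∀ τ ∈ Icc 0 (T - t), t + τ ∈ Icc 0 T := fun τ hτ =>
    ⟨by linarith [hτ.1, ht.1], by linarith [hτ.2]⟩
  have h1 := nonneg_Icc_of_Ioo (T := T - t) (by linarith [ht'.2])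
    (F := fun τ => u t x + D * τ - u (t + τ) x)
    ((Continuous.continuousOn (by fun_prop)).sub
      ((h.continuousOn_time x).comp (f := fun τ : ℝ => t + τ) (by fun_prop) hmem))
    (fun τ hτ => by
      have := key τ hτ.1.le t ⟨ht.1, by linarith [hτ.2]⟩
      linarith) (t' - t) ⟨by linarith, by linarith [ht'.2]⟩
  simp only [add_sub_cancel] at h1
  linarith

end IsObstacleSolution

/-! ### Quadrature, and the upper bound for the far part of the operator -/

/-- Quadrature with positive weights: Lipschitz functions can be integrated against a finite measure
by finite sums, with an error proportional to the Lipschitz constant. -/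
lemma exists_quadrature (μ : Measure (E n)) [IsFiniteMeasure μ] (hμ : Integrable (fun ξ : E n => ξ) μ)
    {ε : ℝ} (hε : 0 < ε) : ∃ (ι : Type) (_ : Fintype ι) (w : ι → ℝ) (k : ι → E n),
      (∀ i, 0 < w i) ∧ ∑ i, w i = μ.real univ ∧
        ∀ (f : E n → ℝ) (K : ℝ), 0 ≤ K → LipBound K f → |∫ ξ, f ξ ∂μ - ∑ i, w i * f (k i)| ≤ K * ε := by
  have hlim := SimpleFunc.tendsto_approxOn_L1_enorm (f := fun ξ : E n => ξ) (s := univ) measurable_id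
    (mem_univ (0 : E n)) (μ := μ) (by simp) (by simpa using hμ.2)
  obtain ⟨j, hj⟩ := (hlim.eventually (gt_mem_nhds (ENNReal.ofReal_pos.2 hε))).exists
  set φ := SimpleFunc.approxOn (fun ξ : E n => ξ) measurable_id univ 0 (mem_univ _) j with hφ
  have hφi : Integrable φ μ := SimpleFunc.integrable_approxOn measurable_id hμ (mem_univ _)
    (integrable_const _) j
  have herr : ∫ ξ, ‖φ ξ - ξ‖ ∂μ ≤ ε := by
    have hd : Integrable (fun ξ => φ ξ - ξ) μ := hφi.sub hμ
    rw [integral_norm_eq_lintegral_enorm hd.aestronglyMeasurable]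
    exact ENNReal.toReal_le_of_le_ofReal hε.le hj.le
  classical
  set S := φ.range.filter fun y => 0 < μ.real (φ ⁻¹' {y}) with hS
  have hsumS : ∀ g : E n → ℝ, ∑ i : S, μ.real (φ ⁻¹' {(i : E n)}) * g i
      = ∑ y ∈ φ.range, μ.real (φ ⁻¹' {y}) * g y := by
    intro g
    rw [Finset.sum_coe_sort S fun y => μ.real (φ ⁻¹' {y}) * g y, hS]
    refine Finset.sum_filter_of_ne fun y _ hy => ?_
    exact lt_of_le_of_ne measureReal_nonneg (Ne.symm (left_ne_zero_of_mul hy))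
  refine ⟨S, inferInstance, fun i => μ.real (φ ⁻¹' {(i : E n)}), fun i => i, fun i => ?_, ?_,
    fun f K hK hf => ?_⟩
  · exact (Finset.mem_filter.1 i.2).2
  · have h1 := hsumS fun _ => 1
    simp only [mul_one] at h1
    rw [h1, sum_measureReal_preimage_singleton _ fun y _ => φ.measurableSet_fiber y,
      SimpleFunc.coe_range, preimage_range]
  · have e1 : ∫ ξ, f (φ ξ) ∂μ = ∑ y ∈ φ.range, μ.real (φ ⁻¹' {y}) * f y := by
      have h1 : ∀ ξ, f (φ ξ) = ∑ y ∈ φ.range, (φ ⁻¹' {y}).indicator (fun _ => f y) ξ := by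
        intro ξ
        rw [Finset.sum_eq_single (φ ξ)]
        · simp
        · intro y _ hy
          exact indicator_of_notMem (fun h => hy h.symm) _
        · intro h
          exact absurd (φ.mem_range_self ξ) h
      simp only [h1]
      rw [integral_finsetSum _ fun y _ => (integrable_const _).indicator (φ.measurableSet_fiber y)]
      refine Finset.sum_congr rfl fun y _ => ?_
      rw [integral_indicator_const _ (φ.measurableSet_fiber y), smul_eq_mul]
    rw [hsumS f, ← e1]
    have hfi : Integrable f μ := by
      have : Integrable (fun ξ : E n => |f 0| + K * ‖ξ‖) μ := (integrable_const _).add (hμ.norm.const_mul K)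
      refine this.mono' hf.continuous.aestronglyMeasurable (.of_forall fun ξ => ?_)
      have h1 := hf ξ 0
      rw [sub_zero] at h1
      have h2 := abs_sub_abs_le_abs_sub (f ξ) (f 0)
      rw [Real.norm_eq_abs]
      linarith
    have hfφ : Integrable (fun ξ => f (φ ξ)) μ := by
      have : Integrable (fun ξ : E n => |f 0| + K * ‖φ ξ‖) μ :=
        (integrable_const _).add (hφi.norm.const_mul K)
      refine this.mono' (hf.continuous.comp_aestronglyMeasurable hφi.aestronglyMeasurable)
        (.of_forall fun ξ => ?_)
      have h1 := hf (φ ξ) 0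
      rw [sub_zero] at h1
      have h2 := abs_sub_abs_le_abs_sub (f (φ ξ)) (f 0)
      rw [Real.norm_eq_abs]
      linarith
    rw [← integral_sub hfi hfφ, ← Real.norm_eq_abs]
    refine (norm_integral_le_of_norm_le ((hφi.sub hμ).norm.const_mul K) (.of_forall fun ξ => ?_)).trans
      (by rw [integral_const_mul]; exact mul_le_mul_of_nonneg_left herr hK)
    rw [Real.norm_eq_abs, Pi.sub_apply, norm_sub_rev]
    exact hf _ _

/-- The jump kernel on the annulus `1 ≤ |ξ| < R`, as a finite measure. -/
noncomputable def annulusMeasure (n : ℕ) (s R : ℝ) : Measure (E n) :=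
  (volume.restrict (Metric.ball (0 : E n) R \ Metric.ball (0 : E n) 1)).withDensity
    fun ξ => ENNReal.ofReal (jumpKernel s ξ)

lemma integral_annulusMeasure (R : ℝ) (g : E n → ℝ) : ∫ ξ, g ξ ∂annulusMeasure n s R
    = ∫ ξ in Metric.ball (0 : E n) R \ Metric.ball (0 : E n) 1, g ξ * jumpKernel s ξ := by
  unfold annulusMeasure
  rw [integral_withDensity_eq_integral_toReal_smul measurable_jumpKernel.ennreal_ofReal
    (.of_forall fun ξ => ENNReal.ofReal_lt_top)]
  refine integral_congr_ae (.of_forall fun ξ => ?_)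
  simp only [smul_eq_mul]
  rw [ENNReal.toReal_ofReal (jumpKernel_nonneg ξ), mul_comm]

lemma isFiniteMeasure_annulusMeasure (hs : 0 < s) (R : ℝ) : IsFiniteMeasure (annulusMeasure n s R) :=
  isFiniteMeasure_withDensity_ofReal
    ((integrableOn_jumpKernel (n := n) hs one_pos).mono_set fun _ h => h.2).2

lemma integrable_id_annulusMeasure (hs : 0 < s) (R : ℝ) :
    Integrable (fun ξ : E n => ξ) (annulusMeasure n s R) := by
  have := isFiniteMeasure_annulusMeasure (n := n) hs R
  refine (integrable_const R).mono' measurable_id.aestronglyMeasurable ?_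
  have h1 : ∀ᵐ ξ ∂volume.restrict (Metric.ball (0 : E n) R \ Metric.ball (0 : E n) 1), ‖ξ‖ ≤ R := by
    filter_upwards [self_mem_ae_restrict (measurableSet_ball.diff measurableSet_ball)] with ξ hξ
    exact le_of_lt (by simpa using hξ.1)
  exact (withDensity_absolutelyContinuous _ _).ae_le h1

lemma trunc_sub_trunc_eq (hs : 0 < s) {f : E n → ℝ} (hw : WeightedIntegrable s f)
    (hc : Continuous f) {R : ℝ} (hR : 1 ≤ R) (x : E n) (hfi : Integrable (fun ξ => f (x + ξ))
      (annulusMeasure n s R)) :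
    trunc s 1 f x - trunc s R f x
      = (annulusMeasure n s R).real univ * f x - ∫ ξ, f (x + ξ) ∂annulusMeasure n s R := by
  have := isFiniteMeasure_annulusMeasure (n := n) hs R
  have e1 : (annulusMeasure n s R).real univ * f x = ∫ ξ, f x ∂annulusMeasure n s R := by
    rw [integral_const, smul_eq_mul]
  rw [e1, ← integral_sub (integrable_const _) hfi, integral_annulusMeasure]
  unfold trunc
  rw [compl_ball_eq_union hR, setIntegral_union
    (disjoint_left.2 fun _ h1 h2 => (mem_compl_iff _ _).1 h1 h2.1)
    (measurableSet_ball.diff measurableSet_ball)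
    (hw.integrableOn_sub hs hc x (by linarith))
    ((hw.integrableOn_sub hs hc x one_pos).mono_set fun ξ h => h.2)]
  ring

lemma LipBound.integrable_annulusMeasure (hs : 0 < s) {K : ℝ} {f : E n → ℝ} (hf : LipBound K f)
    (R : ℝ) (x : E n) : Integrable (fun ξ => f (x + ξ)) (annulusMeasure n s R) := by
  have := isFiniteMeasure_annulusMeasure (n := n) hs R
  have hi : Integrable (fun ξ : E n => |f x| + K * ‖ξ‖) (annulusMeasure n s R) :=
    (integrable_const _).add ((integrable_id_annulusMeasure hs R).norm.const_mul K)
  have hc := hf.continuous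
  refine hi.mono' (Continuous.aestronglyMeasurable (by fun_prop)) (.of_forall fun ξ => ?_)
  have h1 := hf (x + ξ) x
  rw [add_sub_cancel_left] at h1
  have h2 := abs_sub_abs_le_abs_sub (f (x + ξ)) (f x)
  rw [Real.norm_eq_abs]
  linarith

/-- The truncated operators vanish in the limit of infinite radius. -/
lemma WeightedIntegrable.tendsto_trunc_atTop (hs : 0 < s) {f : E n → ℝ} (hw : WeightedIntegrable s f)
    (hc : Continuous f) (x : E n) :
    Tendsto (fun k : ℕ => trunc s (k + 1) f x) atTop (𝓝 0) := by
  have h := tendsto_setIntegral_of_antitone (μ := (volume : Measure (E n)))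
    (s := fun k : ℕ => (Metric.ball (0 : E n) ((k : ℝ) + 1))ᶜ)
    (f := fun ξ => (f x - f (x + ξ)) * jumpKernel s ξ) (fun k => measurableSet_ball.compl)
    (fun k l hkl => compl_subset_compl.2 (Metric.ball_subset_ball (by gcongr)))
    ⟨0, hw.integrableOn_sub hs hc x (by positivity)⟩
  have he : ⋂ k : ℕ, (Metric.ball (0 : E n) ((k : ℝ) + 1))ᶜ = ∅ := by
    refine eq_empty_iff_forall_notMem.2 fun ξ hξ => ?_
    obtain ⟨k, hk⟩ := exists_nat_gt ‖ξ‖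
    have := mem_iInter.1 hξ k
    simp only [mem_compl_iff, Metric.mem_ball, dist_zero_right, not_lt] at this
    linarith
  rw [he, Measure.restrict_empty, integral_zero_measure] at h
  exact h

namespace IsObstacleSolution

variable {T : ℝ} {u₀ ψ : E n → ℝ} {u : ℝ → E n → ℝ}

/-- A common Lipschitz bound of the data is preserved, by comparison with a single translate. -/
lemma lipBound (hn : 0 < n) (hs0 : 0 < s) (hs1 : s < 1) (hT : 0 < T)
    (h : IsObstacleSolution s T u₀ ψ u) {K : ℝ} (hu₀ : LipBound K u₀) (hψ : LipBound K ψ) {t : ℝ}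
    (ht : t ∈ Icc 0 T) : LipBound K (u t) := by
  have key : ∀ x y, u t x ≤ u t y + K * ‖x - y‖ := by
    intro x y
    have hb : ∀ f : E n → ℝ, LipBound K f → ∀ z, f z ≤ f (z + (y - x)) + K * ‖x - y‖ := by
      intro f hf z
      have := (abs_le.1 (hf z (z + (y - x)))).2
      rw [sub_add_cancel_left, norm_neg, norm_sub_rev y x] at this
      linarith
    have := h.le_sum_shift hn hs0 hs1 hT hψ.continuous (ι := Unit) (lam := fun _ => 1)
      (k := fun _ => y - x) (b := K * ‖x - y‖) (fun _ => one_pos) (by simp)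
      (fun z => by simpa using hb ψ hψ z) (fun z => by simpa using hb u₀ hu₀ z) ht x
    simpa using this
  intro x y
  have h1 := key x y
  have h2 := key y x
  rw [norm_sub_rev] at h2
  exact abs_le.2 ⟨by linarith, by linarith⟩

/-- Semiconvexity of the data is preserved: it is an inequality between the value at a point and a
barycenter of two translates. -/
lemma semiconvex (hn : 0 < n) (hs0 : 0 < s) (hs1 : s < 1) (hT : 0 < T)
    (h : IsObstacleSolution s T u₀ ψ u) (hψc : Continuous ψ) {C : ℝ}
    (hu₀ : Semiconvex C u₀) (hψ : Semiconvex C ψ) {t : ℝ} (ht : t ∈ Icc 0 T) :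
    Semiconvex C (u t) := by
  refine convexOn_iff_forall_pos.2 ⟨convex_univ, fun x _ y _ a b ha hb hab => ?_⟩
  set z := a • x + b • y with hz
  have hbar : a • (x - z) + b • (y - z) = 0 := by
    rw [smul_sub, smul_sub, sub_add_sub_comm, ← hz, ← add_smul, hab, one_smul, sub_self]
  have hsq : ∀ w, a * ‖w + (x - z)‖ ^ 2 + b * ‖w + (y - z)‖ ^ 2
      = ‖w‖ ^ 2 + (a * ‖x - z‖ ^ 2 + b * ‖y - z‖ ^ 2) := by
    intro w
    have h1 : a * inner ℝ w (x - z) + b * inner ℝ w (y - z) = 0 := by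
      rw [← real_inner_smul_right, ← real_inner_smul_right, ← inner_add_right, hbar, inner_zero_right]
    rw [norm_add_sq_real, norm_add_sq_real]
    linear_combination 2 * h1 + ‖w‖ ^ 2 * hab
  have hstep : ∀ f : E n → ℝ, Semiconvex C f → ∀ w, f w ≤ a * f (w + (x - z)) + b * f (w + (y - z))
      + C / 2 * (a * ‖x - z‖ ^ 2 + b * ‖y - z‖ ^ 2) := by
    intro f hf w
    have h1 := hf.2 (mem_univ (w + (x - z))) (mem_univ (w + (y - z))) ha.le hb.le hab
    have h2 : a • (w + (x - z)) + b • (w + (y - z)) = w := by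
      rw [smul_add, smul_add, add_add_add_comm, hbar, add_zero, ← add_smul, hab, one_smul]
    rw [h2] at h1
    simp only [smul_eq_mul] at h1
    have h3 := hsq w
    linear_combination h1 + C / 2 * h3
  have := h.le_sum_shift hn hs0 hs1 hT hψc (ι := Fin 2) (lam := ![a, b]) (k := ![x - z, y - z])
    (b := C / 2 * (a * ‖x - z‖ ^ 2 + b * ‖y - z‖ ^ 2))
    (fun i => by fin_cases i <;> simpa) (by simpa using hab)
    (fun w => by simpa using hstep ψ hψ w) (fun w => by simpa using hstep u₀ hu₀ w) ht z
  simp only [Fin.sum_univ_two, Matrix.cons_val_zero, Matrix.cons_val_one, add_sub_cancel] at this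
  have h3 := hsq z
  simp only [add_sub_cancel] at h3
  simp only [smul_eq_mul]
  linear_combination this - C / 2 * h3

/-- The far part of the operator is bounded above along the flow: it compares the value at a point
with an average of translates. -/
lemma trunc_one_sub_trunc_le (hn : 0 < n) (hs0 : 0 < s) (hs1 : s < 1) (hT : 0 < T)
    (h : IsObstacleSolution s T u₀ ψ u) {K : ℝ} (hK : 0 ≤ K) (hu₀ : LipBound K u₀)
    (hψ : LipBound K ψ) (hψw : WeightedIntegrable s ψ) {R : ℝ} (hR : 1 ≤ R) {m : ℝ}
    (hmu : ∀ x, trunc s 1 u₀ x - trunc s R u₀ x ≤ m)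
    (hmψ : ∀ x, trunc s 1 ψ x - trunc s R ψ x ≤ m) {t : ℝ} (ht : t ∈ Icc 0 T) (x : E n) :
    trunc s 1 (u t) x - trunc s R (u t) x ≤ m := by
  have hfin := isFiniteMeasure_annulusMeasure (n := n) hs0 R
  set μ := annulusMeasure n s R with hμ
  have hut := h.lipBound hn hs0 hs1 hT hu₀ hψ ht
  have hu₀w : WeightedIntegrable s u₀ := by
    have := h.weighted 0 ⟨le_rfl, hT.le⟩
    rwa [show u 0 = u₀ from funext h.initial] at this
  have hshift : ∀ f : E n → ℝ, LipBound K f → ∀ z, LipBound K fun ξ => f (z + ξ) := by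
    intro f hf z ξ ξ'
    have := hf (z + ξ) (z + ξ')
    rwa [add_sub_add_left_eq_sub] at this
  simp only [trunc_sub_trunc_eq hs0 hu₀w hu₀.continuous hR _ (hu₀.integrable_annulusMeasure hs0 R _),
    ← hμ] at hmu
  simp only [trunc_sub_trunc_eq hs0 hψw hψ.continuous hR _ (hψ.integrable_annulusMeasure hs0 R _),
    ← hμ] at hmψ
  rw [trunc_sub_trunc_eq hs0 (h.weighted t ht) hut.continuous hR _
    (hut.integrable_annulusMeasure hs0 R _), ← hμ]
  rcases (measureReal_nonneg (μ := μ) (s := univ)).eq_or_lt with h0 | h0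
  · have hμ0 : μ = 0 := by
      rw [← Measure.measure_univ_eq_zero]
      exact (measureReal_eq_zero_iff (measure_ne_top _ _)).1 h0.symm
    have := hmu 0
    rw [hμ0] at this ⊢
    simpa using this
  have key : ∀ ε, 0 < ε → μ.real univ * u t x - ∫ ξ, u t (x + ξ) ∂μ ≤ m + 2 * K * ε := by
    intro ε hε
    obtain ⟨ι, hι, w, k, hw0, hw1, hq⟩ := exists_quadrature μ (integrable_id_annulusMeasure hs0 R) hε
    have hsumw : ∀ g : ι → ℝ, ∑ i, w i / μ.real univ * g i = (∑ i, w i * g i) / μ.real univ := by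
      intro g
      rw [Finset.sum_div]
      exact Finset.sum_congr rfl fun i _ => by ring
    have hdata : ∀ f : E n → ℝ, LipBound K f →
        (∀ z, μ.real univ * f z - ∫ ξ, f (z + ξ) ∂μ ≤ m) → ∀ z,
        f z ≤ ∑ i, w i / μ.real univ * f (z + k i) + (m + K * ε) / μ.real univ := by
      intro f hf hm z
      rw [hsumw fun i => f (z + k i), ← add_div, le_div_iff₀ h0]
      have h1 := (abs_le.1 (hq _ K hK (hshift f hf z))).2
      have h2 := hm z
      linarith
    have h1 := h.le_sum_shift hn hs0 hs1 hT hψ.continuous (lam := fun i => w i / μ.real univ) (k := k)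
      (b := (m + K * ε) / μ.real univ) (fun i => div_pos (hw0 i) h0)
      (by rw [← Finset.sum_div, hw1, div_self h0.ne']) (hdata ψ hψ hmψ) (hdata u₀ hu₀ hmu) ht x
    rw [hsumw fun i => u t (x + k i), ← add_div, le_div_iff₀ h0] at h1
    have h2 := (abs_le.1 (hq _ K hK (hshift _ hut x))).1
    linarith
  have hlim : Tendsto (fun ε : ℝ => m + 2 * K * ε) (𝓝[>] 0) (𝓝 m) :=
    Tendsto.mono_left (Continuous.tendsto' (by fun_prop) _ _ (by simp)) nhdsWithin_le_nhds
  exact ge_of_tendsto hlim (eventually_mem_nhdsWithin.mono key)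

/-- The operator truncated at radius `1` is bounded above along the flow: exhaust the complement of
the unit ball by annuli. -/
lemma trunc_one_le (hn : 0 < n) (hs0 : 0 < s) (hs1 : s < 1) (hT : 0 < T)
    (h : IsObstacleSolution s T u₀ ψ u) {K : ℝ} (hK : 0 ≤ K) (hu₀ : LipBound K u₀)
    (hψ : LipBound K ψ) (hψw : WeightedIntegrable s ψ) {D : ℝ}
    (hDu : ∀ r, 0 < r → ∀ x, |trunc s r u₀ x| ≤ D) (hDψ : ∀ r, 0 < r → ∀ x, |trunc s r ψ x| ≤ D)
    {t : ℝ} (ht : t ∈ Icc 0 T) (x : E n) : trunc s 1 (u t) x ≤ 2 * D := by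
  have h1 := tendsto_const_nhds (x := trunc s 1 (u t) x) |>.sub
    ((h.weighted t ht).tendsto_trunc_atTop hs0 (h.continuous ht) x)
  rw [sub_zero] at h1
  refine le_of_tendsto' h1 fun k => ?_
  have hk : (0 : ℝ) ≤ k := k.cast_nonneg
  refine h.trunc_one_sub_trunc_le hn hs0 hs1 hT hK hu₀ hψ hψw (by linarith) (fun x => ?_)
    (fun x => ?_) ht x
  · have := abs_le.1 (hDu 1 one_pos x)
    have := abs_le.1 (hDu (k + 1) (by linarith) x)
    linarith
  · have := abs_le.1 (hDψ 1 one_pos x)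
    have := abs_le.1 (hDψ (k + 1) (by linarith) x)
    linarith

end IsObstacleSolution

/-! ### The lower bound for the operator along the flow -/

namespace IsObstacleSolution

variable {T : ℝ} {u₀ ψ : E n → ℝ} {u : ℝ → E n → ℝ}

/-- At interior times the truncated operators are bounded below: since `u` is semiconvex in space and
`u - D t` is nonincreasing in time, `u` can be touched from below, at points approaching the given
one, by paraboloids whose slope in time is at most `D`. -/
lemma le_trunc_of_mem_Ioo (hn : 0 < n) (hs0 : 0 < s) (hs1 : s < 1)
    (h : IsObstacleSolution s T u₀ ψ u) {C D : ℝ} {t₀ : ℝ} (ht₀ : t₀ ∈ Ioo 0 T)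
    (hconv : Semiconvex C (u t₀))
    (hmono : ∀ t ∈ Icc 0 T, t ≤ t₀ → ∀ x, u t₀ x ≤ u t x + D * (t₀ - t)) {r : ℝ} (hr : 0 < r)
    (x₀ : E n) : -D - (C / 2 + 1) * (innerMoment n s * r ^ (2 - 2 * s)) ≤ trunc s r (u t₀) x₀ := by
  have ht₀' : t₀ ∈ Icc 0 T := Ioo_subset_Icc_self ht₀
  have hgc : Continuous fun x => u t₀ x + C * ‖x‖ ^ 2 / 2 := by
    have := h.continuous ht₀'
    fun_prop
  obtain ⟨p', hp'⟩ := exists_isSubgradient (g := fun x => u t₀ x + C * ‖x‖ ^ 2 / 2) hconv hgc x₀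
  set p := p' - C • x₀ with hp
  have hsub : ∀ x, u t₀ x₀ + inner ℝ p (x - x₀) - C / 2 * ‖x - x₀‖ ^ 2 ≤ u t₀ x := by
    intro x
    have h1 := hp' x
    have h2 : ‖x‖ ^ 2 = ‖x₀‖ ^ 2 + 2 * inner ℝ x₀ (x - x₀) + ‖x - x₀‖ ^ 2 := by
      rw [← norm_add_sq_real, add_sub_cancel]
    simp only at h1
    rw [hp, inner_sub_left, real_inner_smul_left]
    rw [h2] at h1
    linarith
  set A := C / 2 + 1 with hA
  set w : ℝ × E n → ℝ := fun q => u q.1 q.2 - D * (q.1 - t₀) - inner ℝ p (q.2 - x₀)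
    + A * ‖q.2 - x₀‖ ^ 2 with hw
  set Q := Icc 0 T ×ˢ Metric.closedBall x₀ (2 * r) with hQ
  have hQc : IsCompact Q := isCompact_Icc.prod (isCompact_closedBall _ _)
  have hwc : ContinuousOn w Q := by
    have h1 : ContinuousOn (fun q : ℝ × E n => u q.1 q.2) Q :=
      h.continuousOn.mono (prod_mono subset_rfl (subset_univ _))
    have h2 : Continuous fun q : ℝ × E n => D * (q.1 - t₀) := by fun_prop
    have h3 : Continuous fun q : ℝ × E n => inner ℝ p (q.2 - x₀) := by fun_prop
    have h4 : Continuous fun q : ℝ × E n => A * ‖q.2 - x₀‖ ^ 2 := by fun_prop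
    exact ((h1.sub h2.continuousOn).sub h3.continuousOn).add h4.continuousOn
  have hmem₀ : (t₀, x₀) ∈ Q := ⟨ht₀', Metric.mem_closedBall_self (by positivity)⟩
  have hw₀ : w (t₀, x₀) = u t₀ x₀ := by simp [hw]
  have hstrict : ∀ x, w (t₀, x₀) + ‖x - x₀‖ ^ 2 ≤ w (t₀, x) := by
    intro x
    rw [hw₀]
    have := hsub x
    simp only [hw, sub_self, mul_zero, sub_zero]
    rw [hA, add_mul, one_mul]
    linarith
  have hmin : ∀ k : ℕ, ∃ q ∈ Q, ∀ q' ∈ Q, w q + k * (q.1 - t₀) ^ 2 ≤ w q' + k * (q'.1 - t₀) ^ 2 :=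
    fun k => hQc.exists_isMinOn ⟨_, hmem₀⟩ (hwc.add (Continuous.continuousOn (by fun_prop)))
  choose q hqQ hqmin using hmin
  obtain ⟨q', hq'Q, φ, hφ, hlim⟩ := hQc.tendsto_subseq hqQ
  obtain ⟨b, hb⟩ := (hQc.image_of_continuousOn hwc).bddBelow
  have hwlim : Tendsto (fun j => w (q (φ j))) atTop (𝓝 (w q')) := by
    have h1 : Tendsto (q ∘ φ) atTop (𝓝[Q] q') :=
      tendsto_nhdsWithin_iff.2 ⟨hlim, .of_forall fun j => hqQ _⟩
    exact (hwc q' hq'Q).tendsto.comp h1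
  have hle : ∀ k, w (q k) + k * ((q k).1 - t₀) ^ 2 ≤ w (t₀, x₀) := by
    intro k
    simpa using hqmin k _ hmem₀
  have hfst : Tendsto (fun j => (q (φ j)).1) atTop (𝓝 q'.1) := (continuous_fst.tendsto q').comp hlim
  -- the minimum points cluster only at `(t₀, x₀)`
  have ht' : q'.1 = t₀ := by
    have h1 : ∀ j : ℕ, ((q (φ j)).1 - t₀) ^ 2 ≤ (w (t₀, x₀) - b) * ((j : ℝ) + 1)⁻¹ + (((q (φ j)).1 - t₀) ^ 2) * ((j : ℝ) + 1)⁻¹ := by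
      intro j
      have h2 := hle (φ j)
      have h3 : b ≤ w (q (φ j)) := hb (mem_image_of_mem _ (hqQ _))
      have h4 : (j : ℝ) ≤ φ j := by exact_mod_cast hφ.id_le j
      have h5 : (j : ℝ) * ((q (φ j)).1 - t₀) ^ 2 ≤ φ j * ((q (φ j)).1 - t₀) ^ 2 := by gcongr
      rw [← add_mul, ← div_eq_mul_inv, le_div_iff₀ (by positivity)]
      linarith
    have h2 : Tendsto (fun j : ℕ => ((j : ℝ) + 1)⁻¹) atTop (𝓝 0) := by
      simpa using tendsto_one_div_add_atTop_nhds_zero_nat (𝕜 := ℝ)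
    have h3 := (hfst.sub_const t₀).pow 2
    have h4 := le_of_tendsto_of_tendsto' h3 ((h2.const_mul (w (t₀, x₀) - b)).add (h3.mul h2)) h1
    simp only [mul_zero, add_zero] at h4
    have h5 := pow_eq_zero_iff (two_ne_zero) |>.1 (le_antisymm h4 (sq_nonneg _))
    linarith
  have hx' : q'.2 = x₀ := by
    have h1 : w q' ≤ w (t₀, x₀) := le_of_tendsto' hwlim fun j => by
      have := hle (φ j)
      have h2 : 0 ≤ (φ j : ℝ) * ((q (φ j)).1 - t₀) ^ 2 := by positivity
      linarith
    have h2 := hstrict q'.2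
    rw [← ht', Prod.mk.eta] at h2
    rw [ht'] at h2
    have h3 : ‖q'.2 - x₀‖ ^ 2 ≤ 0 := by linarith
    have h4 := pow_eq_zero_iff (two_ne_zero) |>.1 (le_antisymm h3 (sq_nonneg _))
    exact sub_eq_zero.1 (norm_eq_zero.1 h4)
  have hq' : q' = (t₀, x₀) := Prod.ext ht' hx'
  rw [hq'] at hlim
  have hge : ∀ k, 0 < k → t₀ ≤ (q k).1 := by
    intro k hk
    by_contra! hlt
    have h1 := hqmin k (t₀, (q k).2) ⟨ht₀', (hqQ k).2⟩
    have h2 := hmono (q k).1 (hqQ k).1 hlt.le (q k).2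
    have h3 : 0 < (k : ℝ) * ((q k).1 - t₀) ^ 2 := by
      have : (0 : ℝ) < k := Nat.cast_pos.2 hk
      have := sub_ne_zero.2 hlt.ne
      positivity
    simp only [hw, sub_self] at h1
    linarith
  have hev : ∀ᶠ j in atTop, -(A * (innerMoment n s * r ^ (2 - 2 * s)))
      ≤ D + trunc s r (u (q (φ j)).1) (q (φ j)).2 := by
    have h1 : ∀ᶠ j in atTop, (q (φ j)).1 < T :=
      (((continuous_fst.tendsto _).comp hlim).eventually (gt_mem_nhds ht₀.2))
    have h2 : ∀ᶠ j in atTop, (q (φ j)).2 ∈ Metric.ball x₀ r :=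
      ((continuous_snd.tendsto _).comp hlim).eventually (Metric.ball_mem_nhds x₀ hr)
    filter_upwards [h1, h2, eventually_gt_atTop 0] with j hj1 hj2 hj3
    set t₁ := (q (φ j)).1 with ht₁
    set x₁ := (q (φ j)).2 with hx₁
    set k : ℝ := ((φ j : ℕ) : ℝ) with hk
    have hk0 : 0 ≤ k := Nat.cast_nonneg _
    have ht₁0 := hge (φ j) (hj3.trans_le (hφ.id_le j))
    rw [← ht₁] at ht₁0
    have htouch := h.supersolution.le_trunc hn hs0 hs1 (t₀ := t₁) ⟨ht₀.1.trans_le ht₁0, hj1⟩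
      (h.weighted t₁ (hqQ _).1) (h.continuous (hqQ _).1) (x₀ := x₁)
      (p := p - (2 * A) • (x₁ - x₀)) (a := D - 2 * k * (t₁ - t₀)) (A := A) (B := k) hr
      (fun t ht _ x hx => ?_)
    · have h3 : 0 ≤ 2 * k * (t₁ - t₀) := by
        have : 0 ≤ t₁ - t₀ := by linarith
        positivity
      linarith [htouch.2]
    · have hxQ : x ∈ Metric.closedBall x₀ (2 * r) := by
        rw [Metric.mem_ball] at hx hj2
        rw [Metric.mem_closedBall]
        have := dist_triangle x x₁ x₀
        linarith
      have h3 := hqmin (φ j) (t, x) ⟨ht, hxQ⟩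
      have h4 : ‖x - x₀‖ ^ 2 = ‖x₁ - x₀‖ ^ 2 + 2 * inner ℝ (x₁ - x₀) (x - x₁) + ‖x - x₁‖ ^ 2 := by
        rw [← norm_add_sq_real]; congr 2; abel
      have h5 : inner ℝ p (x - x₀) = inner ℝ p (x₁ - x₀) + inner ℝ p (x - x₁) := by
        rw [← inner_add_right]; congr 1; abel
      simp only [hw, ← ht₁, ← hx₁, ← hk] at h3
      rw [h4, h5] at h3
      simp only [quadTest]
      rw [inner_sub_left, real_inner_smul_left]
      linarith
  have hlim' : Tendsto (fun j => q (φ j)) atTop (𝓝[Icc 0 T ×ˢ univ] (t₀, x₀)) :=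
    tendsto_nhdsWithin_iff.2 ⟨hlim, .of_forall fun j => ⟨(hqQ _).1, mem_univ _⟩⟩
  have := ge_of_tendsto (((h.tendsto_trunc hn hs0 hr ht₀' x₀).comp hlim').const_add D) hev
  linarith

/-- The lower bound of `le_trunc_of_mem_Ioo`, extended to the closed time interval by continuity of
`t ↦ trunc s r (u t) x₀`. -/
lemma le_trunc (hn : 0 < n) (hs0 : 0 < s) (hs1 : s < 1) (hT : 0 < T)
    (h : IsObstacleSolution s T u₀ ψ u) {C D : ℝ} (hconv : ∀ t ∈ Icc 0 T, Semiconvex C (u t))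
    (hmono : ∀ t ∈ Icc 0 T, ∀ t' ∈ Icc 0 T, t ≤ t' → ∀ x, u t' x ≤ u t x + D * (t' - t)) {r : ℝ}
    (hr : 0 < r) {t : ℝ} (ht : t ∈ Icc 0 T) (x₀ : E n) :
    -D - (C / 2 + 1) * (innerMoment n s * r ^ (2 - 2 * s)) ≤ trunc s r (u t) x₀ := by
  have hcont : ContinuousOn (fun t => trunc s r (u t) x₀) (Icc 0 T) := by
    intro t ht
    have h1 : Tendsto (fun t : ℝ => (t, x₀)) (𝓝[Icc 0 T] t) (𝓝[Icc 0 T ×ˢ univ] (t, x₀)) :=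
      tendsto_nhdsWithin_iff.2 ⟨(Continuous.tendsto' (by fun_prop) _ _ rfl).mono_left
        nhdsWithin_le_nhds, by filter_upwards [self_mem_nhdsWithin] with t ht using ⟨ht, mem_univ _⟩⟩
    exact (h.tendsto_trunc hn hs0 hr ht x₀).comp h1
  have := nonneg_Icc_of_Ioo hT (F := fun t => trunc s r (u t) x₀
    - (-D - (C / 2 + 1) * (innerMoment n s * r ^ (2 - 2 * s)))) (hcont.sub continuousOn_const)
    (fun t ht => by
      have := h.le_trunc_of_mem_Ioo hn hs0 hs1 ht (hconv t (Ioo_subset_Icc_self ht))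
        (fun t' ht' htt' x => hmono t' ht' t (Ioo_subset_Icc_self ht) htt' x) hr x₀
      linarith) t ht
  linarith

end IsObstacleSolution

lemma Semiconvex.mono {C C' : ℝ} {f : E n → ℝ} (hf : Semiconvex C f) (h : C ≤ C') :
    Semiconvex C' f := by
  have h1 : ConvexOn ℝ univ fun x : E n => ‖x‖ ^ 2 :=
    (convexOn_univ_norm).pow (fun x _ => norm_nonneg x) 2
  have h2 := ConvexOn.add hf (h1.smul (show 0 ≤ (C' - C) / 2 by linarith))
  refine h2.congr fun x _ => ?_
  simp only [Pi.add_apply, smul_eq_mul]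
  ring

lemma lipBound_of_lipschitzWith {K : ℝ≥0} {f : E n → ℝ} (hf : LipschitzWith K f) {K' : ℝ}
    (h : K ≤ K') : LipBound K' f := by
  intro x y
  have := hf.dist_le_mul x y
  rw [Real.dist_eq, dist_eq_norm] at this
  exact this.trans (by gcongr)

end FracObstacle

theorem proposition3p5 (n : ℕ) (s : ℝ) (hs : s ∈ Set.Ico (1 / 2 : ℝ) 1) (C₀ : ℝ) (M : ℝ≥0) :
    ∃ ω : ℝ≥0 → ℝ≥0, Monotone ω ∧ Tendsto ω (𝓝 0) (𝓝 0) ∧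
      ∀ (T : ℝ) (u₀ ψ : FracObstacle.E n → ℝ) (u : ℝ → FracObstacle.E n → ℝ),
        0 < T →
        (∃ K : ℝ≥0, LipschitzWith K u₀) → (∃ K : ℝ≥0, LipschitzWith K ψ) →
        (∀ x, ψ x ≤ u₀ x) →
        FracObstacle.Semiconvex C₀ u₀ → FracObstacle.Semiconvex C₀ ψ →
        FracObstacle.fracLapNorm s u₀ + FracObstacle.fracLapNorm s ψ ≤ (M : ℝ≥0∞) →
        FracObstacle.IsObstacleSolution s T u₀ ψ u →
        ∀ t ∈ Set.Icc 0 T,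
          ContDiff ℝ 1 (u t) ∧
            ∀ x y, ‖gradient (u t) x - gradient (u t) y‖₊ ≤ ω ‖x - y‖₊ := by
  rcases Nat.eq_zero_or_pos n with rfl | hn
  · refine ⟨fun _ => 0, monotone_const, tendsto_const_nhds, ?_⟩
    intro T u₀ ψ u _ _ _ _ _ _ _ _ t _
    refine ⟨?_, fun x y => ?_⟩
    · have : u t = fun _ => u t 0 := funext fun x => congrArg (u t) (Subsingleton.elim x 0)
      rw [this]
      exact contDiff_const
    rw [Subsingleton.elim x y, sub_self, nnnorm_zero]
  have hs0 : 0 < s := by linarith [hs.1]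
  obtain ⟨c, hc, hbound⟩ := FracObstacle.exists_abs_trunc_le (n := n) (s := s) hn hs0 hs.2
  set D := c * ((M : ℝ) + 1) with hD
  obtain ⟨ω, hω, hω0, hmod⟩ := FracObstacle.exists_modulus (n := n) hn hs.1 hs.2 (abs_nonneg C₀)
    (m := 3 * D + (|C₀| / 2 + 1) * FracObstacle.innerMoment n s)
  -- the near part of the operator is its truncation at a small radius `r`, at least `-D` up to the
  -- semiconvexity error, against its truncation at radius `1`, at most `2 * D`
  refine ⟨ω, hω, hω0, fun T u₀ ψ u hT ⟨K₁, hK₁⟩ ⟨K₂, hK₂⟩ hψu₀ hcu hcψ hM h t ht => ?_⟩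
  set K : ℝ := max K₁ K₂ with hK
  have hK0 : 0 ≤ K := K₁.2.trans (le_max_left _ _)
  have hlu := FracObstacle.lipBound_of_lipschitzWith hK₁ (K' := K) (le_max_left _ _)
  have hlψ := FracObstacle.lipBound_of_lipschitzWith hK₂ (K' := K) (le_max_right _ _)
  have hMu := FracObstacle.ae_hasFracLapAt_of_fracLapNorm_le (le_self_add.trans hM)
  have hMψ := FracObstacle.ae_hasFracLapAt_of_fracLapNorm_le (le_add_self.trans hM)
  have hM0 : (0 : ℝ) ≤ M + 1 := by positivity
  have hD0 : 0 ≤ D := by positivity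
  obtain ⟨-, hDu⟩ := hbound u₀ K |C₀| (M + 1) hK0 (abs_nonneg _) hM0 hlu hcu.le_secondDiff hMu
  obtain ⟨hwψ, hDψ⟩ := hbound ψ K |C₀| (M + 1) hK0 (abs_nonneg _) hM0 hlψ hcψ.le_secondDiff hMψ
  have hconv : ∀ t ∈ Set.Icc 0 T, FracObstacle.Semiconvex |C₀| (u t) := fun t ht =>
    h.semiconvex hn hs0 hs.2 hT hlψ.continuous (hcu.mono (le_abs_self _)) (hcψ.mono (le_abs_self _)) ht
  refine hmod (u t) (h.continuous ht) (h.weighted t ht) (hconv t ht) fun r hr hr1 x => ?_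
  have h1 := h.trunc_one_le hn hs0 hs.2 hT hK0 hlu hlψ hwψ hDu hDψ ht x
  have h2 := h.le_trunc hn hs0 hs.2 hT hconv (D := D) (fun t ht t' ht' htt' x =>
    h.le_add_time hn hs0 hs.2 hT hlψ.continuous hψu₀ hD0
      (fun r hr x => (abs_le.1 (hDu r hr x)).1) ht ht' htt' x) hr ht x
  have h3 : r ^ (2 - 2 * s) ≤ 1 := Real.rpow_le_one hr.le hr1 (by linarith [hs.2])
  have h4 : (|C₀| / 2 + 1) * (FracObstacle.innerMoment n s * r ^ (2 - 2 * s))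
      ≤ (|C₀| / 2 + 1) * FracObstacle.innerMoment n s := by
    gcongr
    exact mul_le_of_le_one_right FracObstacle.innerMoment_nonneg h3
  linarith
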